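/- Fix a clipping level $B>0$. There is a constant $C=C_B>0$, depending only on $B$, such that the following holds for every dimension $d\ge 1$, every probability distribution $p_{\mathrm{data}}$ on $\mathbb R^d$ with finite second moment $M_2^2=\mathbb E_{X\sim p_{\mathrm{data}}}\|X\|^2<\infty$, and every $\delta\in(0,\tfrac12]$. Setting. A variance-preserving schedule of length $T\ge 1$ with early-stopping noise level $\sigma_\ast\in(0,1)$ is a sequence $\sigma_1=\sigma_\ast,\sigma_2,\dots,\sigma_T\in(0,1)$; put $\bar\alpha_t=\sqrt{1-\sigma_t^2}$ for $1\le t\le T$, with $\bar\alpha_0=1$ and noise level $0$ at time $0$, and $\alpha_t=\bar\alpha_{t+1}/\bar\alpha_t$, $\eta_t=\sigma_{t+1}^2/\alpha_t^2-\sigma_t^2$ (the term $\sigma_t^2$ being $0$ for $t=0$), all $\eta_t$ being required to be positive. The forward process is $X_0\sim p_{\mathrm{data}}$, $X_{t+1}\mid X_t\sim N(\alpha_tX_t,\alpha_t^2\eta_tI)$, and $p_t$ is the law of $X_t$. Given measurable score estimates $s_t:\mathbb R^d\to\mathbb R^d$, let $\varepsilon_{\mathrm{score},t}^2=\mathbb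 E_{X\sim p_t}\|s_t(X)-\nabla\log p_t(X)\|^2\in[0,\infty]$. The sampler draws $\hat X_T\sim\hat p_T=N(0,\sigma_T^2I)$ and, for $t=T-1,\dots,1$, with $\bar x_t=\alpha_t^{-1}\hat X_{t+1}$, repeats independent rounds until one accepts: draw $x\sim N(\bar x_t,\eta_tI)$, $J\sim\mathrm{Poisson}(2B)$ and i.i.d. $r_1,\dots,r_J\sim\mathrm{Unif}[0,1]$, put $W_j=\max\{-B,\min\{B,\langle x-\bar x_t,\ s_t(r_jx+(1-r_j)\bar x_t)\rangle\}\}$, and accept $\hat X_t=x$ with probability $\prod_{j=1}^J\frac{B+W_j}{2B}$. Let $\hat p_1$ be the law of $\hat X_1$ and $N$ the total number of score queries (one per $W_j$, rejected rounds included). (i) For every $\sigma_0\in(0,1)$, with $\kappa=(d+M_2^2)/\sigma_0^2$, there is a variance-preserving schedule with $\sigma_1=\sigma_0$ and $$T\le C\,(d+\log(1/\delta))\,\log^2(\kappa/\delta)$$ such that for all measurable score estimates $(s_t)$ $$\mathrm{KL}(p_1\,\|\,\hat p_1)\le C\Big(\delta^2+\sum_{t=1}^{T-1}\eta_t\,\varepsilon_{\mathrm{score},t}^2\Big),$$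 and $N=O(T)$ with high probability: $\Pr(N\le CT)\ge1-\delta$, and $\Pr\big(N\le C(T+\log(1/\varepsilon))\big)\ge1-\varepsilon$ for every $\varepsilon\in(0,1)$. (ii) There is a variance-preserving schedule with $\sigma_1=\delta/\sqrt{d+M_2^2}$ and $$T\le C\max\{d,\log(1/\delta)\}\,\log^2\Big(\frac{d+M_2^2}{\delta^2}\Big)$$ such that for all measurable score estimates $(s_t)$ $$D_{\mathrm{BL}}(p_{\mathrm{data}},\hat p_1)^2\le C\Big(\delta^2+\sum_{t=1}^{T-1}\eta_t\,\varepsilon_{\mathrm{score},t}^2\Big),$$ with the same two bounds on $N$; here $D_{\mathrm{BL}}(\mu,\nu)=\sup\{\mathbb E_\mu f-\mathbb E_\nu f:\ |f|\le1,\ \|f\|_{\mathrm{Lip}}\le1\}$. -/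

import Mathlib

open MeasureTheory ProbabilityTheory InformationTheory
open scoped ENNReal NNReal

noncomputable section

/-- The space `ℝ^d` with its Euclidean norm. -/
abbrev Euc (d : ℕ) : Type := EuclideanSpace ℝ (Fin d)

/-! ### Densities, scores, the bounded Lipschitz metric -/

open Classical in
/-- The continuous probability density function of `μ` with respect to Lebesgue measure (it is
unique if it exists); the zero function if `μ` has no continuous density. -/
def contDensity {d : ℕ} (μ : Measure (Euc d)) : Euc d → ℝ :=
  if h : ∃ ρ : Euc d → ℝ, Continuous ρ ∧ (∀ x, 0 ≤ ρ x) ∧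
      μ = volume.withDensity (fun x => ENNReal.ofReal (ρ x))
  then h.choose else 0

/-- The score `∇ log p` of the law `μ` with continuous density `p`. -/
def score {d : ℕ} (μ : Measure (Euc d)) (x : Euc d) : Euc d :=
  gradient (fun y => Real.log (contDensity μ y)) x

/-- The squared score error `E_{X ∼ μ} ‖s(X) - ∇ log p(X)‖²` of the estimate `s`. -/
def scoreErrorSq {d : ℕ} (μ : Measure (Euc d)) (s : Euc d → Euc d) : ℝ≥0∞ :=
  ∫⁻ x, ‖s x - score μ x‖ₑ ^ 2 ∂μ

/-- The bounded Lipschitz metric: the supremum of `E_μ f - E_ν f` over all `f` with `|f| ≤ 1` and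
Lipschitz constant at most `1`. -/
def blDist {d : ℕ} (μ ν : Measure (Euc d)) : ℝ≥0∞ :=
  ⨆ f ∈ {f : Euc d → ℝ | (∀ x, |f x| ≤ 1) ∧ LipschitzWith 1 f},
    ENNReal.ofReal (∫ x, f x ∂μ - ∫ x, f x ∂ν)

/-- The second moment `E_{X ∼ μ} ‖X‖²`. -/
def secondMoment {d : ℕ} (μ : Measure (Euc d)) : ℝ := ∫ x, ‖x‖ ^ 2 ∂μ

/-- The isotropic Gaussian `N(m, v I)`. -/
def isoGaussian {d : ℕ} (m : Euc d) (v : ℝ) : Measure (Euc d) :=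
  (stdGaussian (Euc d)).map (fun g => m + √v • g)

/-! ### The forward process in the variance-preserving setting -/

/-- `ᾱ_t = √(1 - σ_t²)`, that is, `ᾱ_t² + σ_t² = 1`. -/
def vpAlphaBar (σ : ℕ → ℝ) (t : ℕ) : ℝ := √(1 - σ t ^ 2)

/-- `α_t = ᾱ_{t+1} / ᾱ_t`. -/
def vpAlpha (σ : ℕ → ℝ) (t : ℕ) : ℝ := vpAlphaBar σ (t + 1) / vpAlphaBar σ t

/-- `η_t = σ_{t+1}² / α_t² - σ_t²`. -/
def vpEta (σ : ℕ → ℝ) (t : ℕ) : ℝ := σ (t + 1) ^ 2 / vpAlpha σ t ^ 2 - σ t ^ 2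

/-- `σ_1, …, σ_T` is a variance-preserving noise schedule with first (early stopping) noise level
`σ₁`. The value `σ 0 = 0` (so `ᾱ_0 = 1`) encodes that the forward process starts from the data. -/
structure IsVPSchedule (T : ℕ) (σ : ℕ → ℝ) (σ₁ : ℝ) : Prop where
  one_le : 1 ≤ T
  zero : σ 0 = 0
  one : σ 1 = σ₁
  pos : ∀ t, 1 ≤ t → t ≤ T → 0 < σ t
  lt_one : ∀ t, 1 ≤ t → t ≤ T → σ t < 1
  eta_pos : ∀ t, t < T → 0 < vpEta σ t

/-- The law `p_t` of `X_t`, where `X_0 ∼ p_data` and, given `X_t`,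
`X_{t+1} ∼ N(α_t X_t, α_t² η_t I)`. -/
def forwardLaw {d : ℕ} (pdata : Measure (Euc d)) (σ : ℕ → ℝ) : ℕ → Measure (Euc d)
  | 0 => pdata
  | t + 1 => ((forwardLaw pdata σ t).prod (stdGaussian (Euc d))).map
      (fun z => vpAlpha σ t • z.1 + (vpAlpha σ t * √(vpEta σ t)) • z.2)

/-! ### First-order rejection sampling -/

/-- `clip_B(x) = max(-B, min(B, x))`. -/
def clip (B x : ℝ) : ℝ := max (-B) (min B x)

/-- The random inputs of one round of the rejection loop: a seed for the proposal, the number `J`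
of estimator draws, seeds for the estimator draws, a seed for the acceptance coin. -/
abbrev RoundNoise (d : ℕ) : Type := Euc d × ℕ × (ℕ → unitInterval) × unitInterval

/-- The law of the random inputs of one round: they are independent, the proposal seed is standard
Gaussian, `J ∼ Poisson(2B)`, and the other seeds are uniform on `[0,1]`. -/
def roundNoise (d : ℕ) (B : ℝ) : Measure (RoundNoise d) :=
  (stdGaussian (Euc d)).prod ((poissonMeasure (2 * B).toNNReal).prod
    ((Measure.infinitePi (fun _ : ℕ => (volume : Measure unitInterval))).prod (volume : Measure unitInterval)))

/-- The law of the random inputs of the rejection loop: independent rounds `0, 1, 2, …`. -/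
def forsNoise (d : ℕ) (B : ℝ) : Measure (ℕ → RoundNoise d) :=
  Measure.infinitePi (fun _ : ℕ => roundNoise d B)

/-- The round with inputs `ω = (g, J, r, u)` accepts its proposal `x = propose g` if
`u ≤ ∏_{j < J} (B + W_j) / (2B)` with `W_j = est x (r j)`: it does so with this product as
probability, given `x`, `J` and the `W_j`. -/
def roundAccepts {d : ℕ} (B : ℝ) (propose : Euc d → Euc d) (est : Euc d → unitInterval → ℝ)
    (ω : RoundNoise d) : Prop :=
  (ω.2.2.2 : ℝ) ≤ ∏ j ∈ Finset.range ω.2.1, (B + est (propose ω.1) (ω.2.2.1 j)) / (2 * B)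

/-- The index of the first accepting round (there is one almost surely). -/
def forsStop {d : ℕ} (B : ℝ) (propose : Euc d → Euc d) (est : Euc d → unitInterval → ℝ)
    (ω : ℕ → RoundNoise d) : ℕ :=
  sInf {i | roundAccepts B propose est (ω i)}

/-- The output of first-order rejection sampling: the first accepted proposal. -/
def forsOutput {d : ℕ} (B : ℝ) (propose : Euc d → Euc d) (est : Euc d → unitInterval → ℝ)
    (ω : ℕ → RoundNoise d) : Euc d :=
  propose (ω (forsStop B propose est ω)).1

/-- The total number of estimator draws `W_j` made up to and including the accepting round. -/
def forsCount {d : ℕ} (B : ℝ) (propose : Euc d → Euc d) (est : Euc d → unitInterval → ℝ)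
    (ω : ℕ → RoundNoise d) : ℕ :=
  ∑ i ∈ Finset.range (forsStop B propose est ω + 1), (ω i).2.1

/-! ### Backward diffusion sampling -/

/-- The proposal `N(x̄, η I)` as a function of a standard Gaussian seed. -/
def stepPropose {d : ℕ} (η : ℝ) (xbar : Euc d) (g : Euc d) : Euc d := xbar + √η • g

/-- The estimator `clip_B ⟨x - x̄, s(r x + (1 - r) x̄)⟩` with seed `r`; each draw makes exactly one
query to the score estimate `s`. -/
def stepEst {d : ℕ} (B : ℝ) (s : Euc d → Euc d) (xbar : Euc d) (x : Euc d) (r : unitInterval) : ℝ :=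
  clip B (inner ℝ (x - xbar) (s ((r : ℝ) • x + (1 - (r : ℝ)) • xbar)))

/-- One step of backward diffusion sampling at time `t`: from `X_{t+1}` and the number of queries
made so far to `X_t` and the updated number of queries. -/
def backwardStep {d : ℕ} (B : ℝ) (s : ℕ → Euc d → Euc d) (σ : ℕ → ℝ) (t : ℕ)
    (z : Euc d × ℕ) (ω : ℕ → RoundNoise d) : Euc d × ℕ :=
  let xbar := (vpAlpha σ t)⁻¹ • z.1
  (forsOutput B (stepPropose (vpEta σ t) xbar) (stepEst B (s t) xbar) ω,
    z.2 + forsCount B (stepPropose (vpEta σ t) xbar) (stepEst B (s t) xbar) ω)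

/-- The joint law of the state `X_{T-k}` and the number of score queries made so far, after the `k`
steps at times `T-1, …, T-k`, each with fresh random inputs, from `X_T ∼ init`. -/
def backwardLaw {d : ℕ} (B : ℝ) (s : ℕ → Euc d → Euc d) (σ : ℕ → ℝ) (T : ℕ)
    (init : Measure (Euc d)) : ℕ → Measure (Euc d × ℕ)
  | 0 => init.map (fun x => (x, 0))
  | k + 1 => ((backwardLaw B s σ T init k).prod (forsNoise d B)).map
      (fun z => backwardStep B s σ (T - (k + 1)) z.1 z.2)

/-- The joint law of the output `X_1` and the total number of score queries of backward diffusion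
sampling with `X_T ∼ N(0, σ_T² I)`. -/
def samplerLaw {d : ℕ} (B : ℝ) (s : ℕ → Euc d → Euc d) (σ : ℕ → ℝ) (T : ℕ) :
    Measure (Euc d × ℕ) :=
  backwardLaw B s σ T (isoGaussian 0 (σ T ^ 2)) (T - 1)

/-- The law `p̂_1` of the output. -/
def outputLaw {d : ℕ} (B : ℝ) (s : ℕ → Euc d → Euc d) (σ : ℕ → ℝ) (T : ℕ) : Measure (Euc d) :=
  (samplerLaw B s σ T).map Prod.fst

/-- The law of the total number of score queries. -/
def queryLaw {d : ℕ} (B : ℝ) (s : ℕ → Euc d → Euc d) (σ : ℕ → ℝ) (T : ℕ) : Measure ℕ :=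
  (samplerLaw B s σ T).map Prod.snd

/-- The weighted score error `∑_{t=1}^{T-1} η_t ε_{score,t}²`. -/
def totalScoreError {d : ℕ} (pdata : Measure (Euc d)) (s : ℕ → Euc d → Euc d) (σ : ℕ → ℝ)
    (T : ℕ) : ℝ≥0∞ :=
  ∑ t ∈ Finset.Ico 1 T, ENNReal.ofReal (vpEta σ t) * scoreErrorSq (forwardLaw pdata σ t) (s t)

end

/-! Write x̄ = X_{t+1}/α_t. By Bayes' rule the law of X_t given X_{t+1} is the proposal N(x̄, η_t I)
tilted by exp(log p_t(x) - log p_t(x̄)), and the exponent is the integral over r in [0,1] of ⟨x -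
x̄, ∇log p_t(rx + (1-r)x̄)⟩. One score query at a uniform r is an unbiased estimate of it. The
Poisson number of factors makes the conditional acceptance probability exactly exp(w - B), where w
is the mean of the clipped estimator (`lintegral_acceptSet`). Hence a backward step samples exactly
from the proposal tilted by e^w (`lintegral_forsOutput`), and its only errors come from clipping and
from the score estimate.

The chain rule and data processing for relative entropy add up the errors of the steps
(`klDiv_backward_le`, `klDiv_forward_backward_le`). Each step is compared with an unnormalised
version of the sampler's tilt. This is legitimate because `klDiv` of finite measures contains the
mass correction, so no normalising constant has to be estimated.

For one step the divergence is the mean of e^u - 1 - u, where u is the difference of the log weights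
(`klDiv_step_le`). Since p_t is a Gaussian smoothing at scale σ_t, log p_t + ‖x‖²/(2σ_t²) is convex
(`convexOn_log_smoothDensity`). This has two uses: derivatives of log p_t along the segment from X_t
to x̄ are controlled by those at its endpoints, and the directional derivative in a Gaussian
direction is sub-Gaussian (`lintegral_exp_scoreStep_le`). On a good event the exact score is never
clipped, and a quadratic bound for e^u - 1 - u gives η_t ε²_{score,t}, with no dimension factor
because E⟨g, e⟩² = ‖e‖². The bad event has exponentially small probability and contributes little.

The schedule multiplies σ²/(1-σ²) by 1 + h at each step, so η_t = hσ_t². Take h = c/(aL) with a = d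
+ log(1/δ) and L = log(κ/δ). Then the bad event has probability of order exp(-8S), S = √(min(a,L)
L), while T is of order L/h, that is aL². The inequality aL² ≤ 24 e^{2S} together with S ≥ log(1/δ)
makes the total bad contribution O(δ²). The initialisation error is O(δ²) as well, by a Gaussian
shift computation.

For the bounded Lipschitz metric, combine the coupling of X_0 with X_1 and a Pinsker-type inequality
(`blDist_sq_le`). For the queries, each step has a bounded exponential moment whatever the score
estimate (`lintegral_forsCount_le`), and Markov's inequality applies to the product (`le_queryLaw`).
-/

noncomputable section

/-! ### First hitting of a set by an i.i.d. sequence -/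

section FirstHit

variable {Ω : Type*} [MeasurableSpace Ω] (ν : Measure Ω) [IsProbabilityMeasure ν]

lemma lintegral_infinitePi_prod_range (f : ℕ → Ω → ℝ≥0∞) (hf : ∀ i, Measurable (f i)) (n : ℕ) :
    ∫⁻ ω, ∏ i ∈ Finset.range n, f i (ω i) ∂(Measure.infinitePi fun _ : ℕ => ν) =
      ∏ i ∈ Finset.range n, ∫⁻ x, f i x ∂ν := by
  have h := lintegral_prod_eq_prod_lintegral_of_indepFun (Finset.range n)
    (fun i (ω : ℕ → Ω) => f i (ω i)) (iIndepFun_infinitePi (P := fun _ : ℕ => ν) hf)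
    (fun i => (hf i).comp (measurable_pi_apply i))
  rw [h]
  refine Finset.prod_congr rfl fun i _ => ?_
  exact (measurePreserving_eval_infinitePi (fun _ : ℕ => ν) i).lintegral_comp (hf i)

lemma ae_exists_mem_infinitePi {A : Set Ω} (hA : MeasurableSet A) (h0 : ν A ≠ 0) :
    ∀ᵐ ω ∂(Measure.infinitePi fun _ : ℕ => ν), ∃ i, ω i ∈ A := by
  rw [ae_iff]
  have hlt : ν Aᶜ < 1 := by
    rw [prob_compl_eq_one_sub hA]
    exact ENNReal.sub_lt_self ENNReal.one_ne_top one_ne_zero h0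
  refine le_antisymm (ge_of_tendsto' (ENNReal.tendsto_pow_atTop_nhds_zero_of_lt_one hlt)
    fun n => ?_) zero_le
  have hsub : {ω : ℕ → Ω | ¬ ∃ i, ω i ∈ A} ⊆ {ω | ∀ i ∈ Finset.range n, ω i ∈ Aᶜ} :=
    fun ω hω i _ hi => hω ⟨i, hi⟩
  refine (measure_mono hsub).trans (le_of_eq ?_)
  have := lintegral_infinitePi_prod_range ν (fun _ => Aᶜ.indicator 1)
    (fun _ => measurable_one.indicator hA.compl) n
  simp only [lintegral_indicator_one hA.compl, Finset.prod_const, Finset.card_range] at this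
  rw [← this, ← lintegral_indicator_one]
  · refine lintegral_congr fun ω => ?_
    by_cases h : ∀ i ∈ Finset.range n, ω i ∈ Aᶜ
    · rw [Set.indicator_of_mem (by exact h)]
      exact (Finset.prod_eq_one fun i hi => by rw [Set.indicator_of_mem (h i hi)]; rfl).symm
    · rw [Set.indicator_of_notMem (by exact h)]
      push Not at h
      obtain ⟨i, hi, hiA⟩ := h
      exact (Finset.prod_eq_zero hi (by simp [hiA])).symm
  · have : {ω : ℕ → Ω | ∀ i ∈ Finset.range n, ω i ∈ Aᶜ} =
        ⋂ i ∈ Finset.range n, (fun ω : ℕ → Ω => ω i) ⁻¹' Aᶜ := by ext; simp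
    rw [this]
    exact Finset.measurableSet_biInter _ fun i _ => (measurable_pi_apply i) hA.compl

/-- Split according to the index k of the first hit: k independent coordinates outside `A`, then one
inside. With `c = 1` this gives the law of the accepted round; a general `c` gives exponential
moments of the number of queries. -/
lemma lintegral_firstHit {A : Set Ω} (hA : MeasurableSet A) (h0 : ν A ≠ 0) {c f : Ω → ℝ≥0∞}
    (hc : Measurable c) (hf : Measurable f) :
    ∫⁻ ω, (∏ i ∈ Finset.range (sInf {i | ω i ∈ A}), c (ω i)) * f (ω (sInf {i | ω i ∈ A}))
        ∂(Measure.infinitePi fun _ : ℕ => ν) =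
      ∑' k : ℕ, (∫⁻ x in Aᶜ, c x ∂ν) ^ k * ∫⁻ x in A, f x ∂ν := by
  have hterm : ∀ k : ℕ, ∫⁻ ω, (∏ i ∈ Finset.range k, Aᶜ.indicator c (ω i)) * A.indicator f (ω k)
      ∂(Measure.infinitePi fun _ : ℕ => ν) =
      (∫⁻ x in Aᶜ, c x ∂ν) ^ k * ∫⁻ x in A, f x ∂ν := by
    intro k
    have := lintegral_infinitePi_prod_range ν
      (fun i => if i < k then Aᶜ.indicator c else A.indicator f)
      (fun i => by split_ifs; exacts [hc.indicator hA.compl, hf.indicator hA]) (k + 1)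
    simp only [Finset.prod_range_succ, lt_irrefl, if_false] at this
    rw [← lintegral_indicator hA.compl, ← lintegral_indicator hA]
    convert! this using 1
    · refine lintegral_congr fun ω => ?_
      congr 1
      exact Finset.prod_congr rfl fun i hi => by rw [if_pos (Finset.mem_range.1 hi)]
    · congr 1
      rw [Finset.prod_congr rfl fun i hi => by rw [if_pos (Finset.mem_range.1 hi)]]
      simp
  simp_rw [← hterm]
  rw [← lintegral_tsum]
  · refine lintegral_congr_ae ?_
    -- Almost surely there is a hit, so exactly one term of the series survives and the default
    -- `sInf ∅ = 0` plays no role.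
    filter_upwards [ae_exists_mem_infinitePi ν hA h0] with ω hω
    have hne : {i | ω i ∈ A}.Nonempty := hω
    have hmem : ω (sInf {i | ω i ∈ A}) ∈ A := Nat.sInf_mem hne
    rw [tsum_eq_single (sInf {i | ω i ∈ A})]
    · rw [Set.indicator_of_mem hmem]
      congr 1
      refine Finset.prod_congr rfl fun i hi => ?_
      rw [Set.indicator_of_mem]
      exact fun h => Nat.notMem_of_lt_sInf (Finset.mem_range.1 hi) h
    · intro k hk
      rcases lt_or_gt_of_ne hk with h | h
      · rw [Set.indicator_of_notMem (fun hh : ω k ∈ A => Nat.notMem_of_lt_sInf h hh), mul_zero]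
      · rw [Finset.prod_eq_zero (Finset.mem_range.2 h), zero_mul]
        rw [Set.indicator_of_notMem]
        simpa using hmem
  · intro k
    refine (Measurable.mul ?_ ?_).aemeasurable
    · exact Finset.measurable_prod _ fun i _ =>
        (hc.indicator hA.compl).comp (measurable_pi_apply i)
    · exact (hf.indicator hA).comp (measurable_pi_apply k)

end FirstHit

/-! ### First-order rejection sampling -/

lemma unitInterval_volume_le {q : ℝ} (h0 : 0 ≤ q) (h1 : q ≤ 1) :
    (volume : Measure unitInterval) {u | (u : ℝ) ≤ q} = ENNReal.ofReal q := by
  have : {u : unitInterval | (u : ℝ) ≤ q} = Set.Iic ⟨q, h0, h1⟩ := rfl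
  rw [this]
  simp

section Poisson

lemma lintegral_poissonMeasure_pow (r : ℝ≥0) {q : ℝ} (hq : 0 ≤ q) :
    ∫⁻ n, ENNReal.ofReal (q ^ n) ∂(poissonMeasure r) = ENNReal.ofReal (Real.exp (r * (q - 1))) := by
  rw [lintegral_countable']
  have hs : HasSum (fun n : ℕ => q ^ n * (Real.exp (-r) * r ^ n / n.factorial))
      (Real.exp (r * (q - 1))) := by
    have := (NormedSpace.expSeries_div_hasSum_exp (q * (r : ℝ))).mul_left (Real.exp (-r))
    rw [← Real.exp_eq_exp_ℝ, ← Real.exp_add] at this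
    rw [show (r : ℝ) * (q - 1) = -r + q * r by ring]
    have hf : (fun n : ℕ => q ^ n * (Real.exp (-r) * r ^ n / n.factorial)) =
        fun n : ℕ => Real.exp (-r) * ((q * r) ^ n / n.factorial) := by
      ext n; rw [mul_pow]; ring
    rw [hf]
    exact this
  rw [← hs.tsum_eq, ENNReal.ofReal_tsum_of_nonneg (fun n => by positivity) hs.summable]
  refine tsum_congr fun n => ?_
  rw [poissonMeasure_singleton, ← ENNReal.ofReal_mul (by positivity)]

end Poisson

section Fors

variable {d : ℕ} {B : ℝ} {propose : Euc d → Euc d} {est : Euc d → unitInterval → ℝ}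

/-- The inputs of a round for which the proposal is accepted. -/
def acceptSet {d : ℕ} (B : ℝ) (propose : Euc d → Euc d) (est : Euc d → unitInterval → ℝ) :
    Set (RoundNoise d) := {ω | roundAccepts B propose est ω}

/-- The logarithmic weight of the proposal with seed `g`. -/
def meanEst {d : ℕ} (propose : Euc d → Euc d) (est : Euc d → unitInterval → ℝ) (g : Euc d) : ℝ :=
  ∫ r, est (propose g) r

instance (d : ℕ) (B : ℝ) : IsProbabilityMeasure (roundNoise d B) := by
  unfold roundNoise; infer_instance

instance (d : ℕ) (B : ℝ) : IsProbabilityMeasure (forsNoise d B) := by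
  unfold forsNoise; infer_instance

lemma measurableSet_roundAccepts {α : Type*} [MeasurableSpace α] {φ : α → RoundNoise d}
    (hφ : Measurable φ) {w : α → unitInterval → ℝ} (hw : Measurable fun z : α × unitInterval => w z.1 z.2) :
    MeasurableSet {a | ((φ a).2.2.2 : ℝ) ≤
      ∏ j ∈ Finset.range (φ a).2.1, (B + w a ((φ a).2.2.1 j)) / (2 * B)} := by
  refine measurableSet_le (by fun_prop) ?_
  have h : Measurable fun z : α × ℕ => ∏ j ∈ Finset.range z.2,
      (B + w z.1 ((φ z.1).2.2.1 j)) / (2 * B) := by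
    refine measurable_from_prod_countable_left fun n => ?_
    refine Finset.measurable_fun_prod (f := fun j x => (B + w x ((φ x).2.2.1 j)) / (2 * B))
      (Finset.range n) fun j _ => ?_
    have : Measurable fun x => w x ((φ x).2.2.1 j) :=
      hw.comp (measurable_id.prodMk ((measurable_pi_apply j).comp hφ.snd.snd.fst))
    exact (measurable_const.add this).div_const _
  exact h.comp (measurable_id.prodMk (by fun_prop))

lemma measurableSet_acceptSet (hp : Measurable propose)
    (he : Measurable fun z : Euc d × unitInterval => est z.1 z.2) :
    MeasurableSet (acceptSet B propose est) :=
  measurableSet_roundAccepts (φ := id) measurable_id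
    (w := fun ω r => est (propose ω.1) r) (he.comp ((hp.comp measurable_fst.fst).prodMk measurable_snd))

/-- Given the proposal, each factor has mean q = (B + w)/(2B), where w is the mean of the estimator.
Integrating out the coin, then the independent seeds, then J leaves E q^J = exp(2B(q - 1)) = exp(w -
B). -/
lemma lintegral_acceptSet (hB : 0 < B) (hp : Measurable propose)
    (he : Measurable fun z : Euc d × unitInterval => est z.1 z.2)
    (hb : ∀ x r, |est x r| ≤ B) {f : Euc d → ℝ≥0∞} (hf : Measurable f) :
    ∫⁻ ω in acceptSet B propose est, f ω.1 ∂(roundNoise d B) =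
      ∫⁻ g, f g * ENNReal.ofReal (Real.exp (meanEst propose est g - B)) ∂(stdGaussian (Euc d)) := by
  have hA := measurableSet_acceptSet (B := B) hp he
  rw [← lintegral_indicator hA]
  have hmeas : Measurable ((acceptSet B propose est).indicator fun ω => f ω.1) :=
    (hf.comp measurable_fst).indicator hA
  rw [roundNoise, lintegral_prod _ hmeas.aemeasurable]
  refine lintegral_congr fun g => ?_
  set q : unitInterval → ℝ := fun r => (B + est (propose g) r) / (2 * B) with hq
  have hq0 : ∀ r, 0 ≤ q r := fun r => div_nonneg (by linarith [(abs_le.1 (hb (propose g) r)).1]) (by positivity)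
  have hq1 : ∀ r, q r ≤ 1 := fun r => by
    rw [hq]; simp only; rw [div_le_one (by positivity)]; linarith [(abs_le.1 (hb (propose g) r)).2]
  have heg : Measurable (est (propose g)) := he.comp measurable_prodMk_left
  have hqm : Measurable q := by fun_prop
  have hint : Integrable (est (propose g)) (volume : Measure unitInterval) :=
    Integrable.of_bound heg.aestronglyMeasurable B (ae_of_all _ fun r => hb _ r)
  have hmean : ∫ r, q r = (B + meanEst propose est g) / (2 * B) := by
    simp only [hq]
    rw [integral_div, integral_add (integrable_const _) hint]
    simp [meanEst]
  have hmean0 : 0 ≤ ∫ r, q r := integral_nonneg hq0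
  have hqlint : ∫⁻ r, ENNReal.ofReal (q r) = ENNReal.ofReal (∫ r, q r) := by
    rw [ofReal_integral_eq_lintegral_ofReal _ (ae_of_all _ hq0)]
    exact Integrable.of_bound hqm.aestronglyMeasurable 1
      (ae_of_all _ fun r => by rw [Real.norm_eq_abs, abs_of_nonneg (hq0 r)]; exact hq1 r)
  have hms : Measurable fun y : ℕ × (ℕ → unitInterval) × unitInterval =>
      (acceptSet B propose est).indicator (fun ω => f ω.1) (g, y) := hmeas.comp measurable_prodMk_left
  rw [lintegral_prod _ hms.aemeasurable]
  have hJ : ∀ J : ℕ, ∫⁻ y, (acceptSet B propose est).indicator (fun ω => f ω.1) (g, (J, y))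
      ∂((Measure.infinitePi (fun _ : ℕ => (volume : Measure unitInterval))).prod
        (volume : Measure unitInterval)) = f g * ENNReal.ofReal ((∫ r, q r) ^ J) := by
    intro J
    have hmJ : Measurable fun y : (ℕ → unitInterval) × unitInterval =>
        (acceptSet B propose est).indicator (fun ω => f ω.1) (g, (J, y)) :=
      hms.comp measurable_prodMk_left
    rw [lintegral_prod _ hmJ.aemeasurable]
    have hr : ∀ r : ℕ → unitInterval,
        ∫⁻ u, (acceptSet B propose est).indicator (fun ω => f ω.1) (g, (J, (r, u)))
        = f g * ∏ j ∈ Finset.range J, ENNReal.ofReal (q (r j)) := by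
      intro r
      rw [← ENNReal.ofReal_prod_of_nonneg (fun j _ => hq0 _), ← unitInterval_volume_le
        (Finset.prod_nonneg fun j _ => hq0 (r j)) (Finset.prod_le_one (fun j _ => hq0 _) fun j _ => hq1 _)]
      rw [← lintegral_indicator_one (measurableSet_le (by fun_prop) (by fun_prop)),
        ← lintegral_const_mul _ (measurable_one.indicator (measurableSet_le (by fun_prop) (by fun_prop)))]
      refine lintegral_congr fun u => ?_
      simp only [Set.indicator_apply, acceptSet, roundAccepts, Set.mem_ofPred_eq, hq, Pi.one_apply]
      split_ifs <;> simp
    simp_rw [hr]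
    rw [lintegral_const_mul _ (by fun_prop), lintegral_infinitePi_prod_range _ (fun _ r => ENNReal.ofReal (q r))
      (fun _ => by fun_prop)]
    simp only [Finset.prod_const, Finset.card_range]
    rw [hqlint, ENNReal.ofReal_pow hmean0]
  simp_rw [hJ]
  rw [lintegral_const_mul _ .of_discrete, lintegral_poissonMeasure_pow _ hmean0, hmean]
  congr 3
  rw [Real.coe_toNNReal _ (by positivity)]
  field_simp
  ring

lemma measurable_meanEst (hp : Measurable propose)
    (he : Measurable fun z : Euc d × unitInterval => est z.1 z.2) :
    Measurable (meanEst propose est) := by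
  have : StronglyMeasurable fun z : Euc d × unitInterval => est (propose z.1) z.2 :=
    (he.comp ((hp.comp measurable_fst).prodMk measurable_snd)).stronglyMeasurable
  exact this.integral_prod_right.measurable

lemma abs_meanEst_le (hb : ∀ x r, |est x r| ≤ B) (g : Euc d) : |meanEst propose est g| ≤ B := by
  have := norm_integral_le_of_norm_le_const (μ := (volume : Measure unitInterval))
    (f := est (propose g)) (C := B) (ae_of_all _ fun r => hb _ r)
  simpa [meanEst] using this

lemma roundNoise_acceptSet (hB : 0 < B) (hp : Measurable propose)
    (he : Measurable fun z : Euc d × unitInterval => est z.1 z.2)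
    (hb : ∀ x r, |est x r| ≤ B) :
    roundNoise d B (acceptSet B propose est) =
      ∫⁻ g, ENNReal.ofReal (Real.exp (meanEst propose est g - B)) ∂(stdGaussian (Euc d)) := by
  have := lintegral_acceptSet hB hp he hb (f := 1) measurable_one
  simpa using this

/-- The mean of the estimator is at least `-B`. The bound is uniform in the proposal and the
estimator, so the query count does not depend on the quality of the score. -/
lemma le_roundNoise_acceptSet (hB : 0 < B) (hp : Measurable propose)
    (he : Measurable fun z : Euc d × unitInterval => est z.1 z.2)
    (hb : ∀ x r, |est x r| ≤ B) :
    ENNReal.ofReal (Real.exp (-(2 * B))) ≤ roundNoise d B (acceptSet B propose est) := by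
  rw [roundNoise_acceptSet hB hp he hb]
  have : ∫⁻ _ : Euc d, ENNReal.ofReal (Real.exp (-(2 * B))) ∂(stdGaussian (Euc d)) =
    ENNReal.ofReal (Real.exp (-(2 * B))) := by simp
  rw [← this]
  refine lintegral_mono fun g => ENNReal.ofReal_le_ofReal (Real.exp_le_exp.2 ?_)
  linarith [(abs_le.1 (abs_meanEst_le (propose := propose) hb g)).1]

lemma roundNoise_acceptSet_ne_zero (hB : 0 < B) (hp : Measurable propose)
    (he : Measurable fun z : Euc d × unitInterval => est z.1 z.2)
    (hb : ∀ x r, |est x r| ≤ B) : roundNoise d B (acceptSet B propose est) ≠ 0 := by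
  have h := le_roundNoise_acceptSet hB hp he hb
  have : 0 < ENNReal.ofReal (Real.exp (-(2 * B))) := ENNReal.ofReal_pos.2 (Real.exp_pos _)
  exact (this.trans_le h).ne'

/-- The law of the output of first-order rejection sampling: the proposal law reweighted by the
exponential of the mean of the estimator. -/
lemma lintegral_forsOutput (hB : 0 < B) (hp : Measurable propose)
    (he : Measurable fun z : Euc d × unitInterval => est z.1 z.2)
    (hb : ∀ x r, |est x r| ≤ B) {f : Euc d → ℝ≥0∞} (hf : Measurable f) :
    (∫⁻ g, ENNReal.ofReal (Real.exp (meanEst propose est g)) ∂(stdGaussian (Euc d))) *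
      ∫⁻ ω, f (forsOutput B propose est ω) ∂(forsNoise d B) =
      ∫⁻ g, f (propose g) * ENNReal.ofReal (Real.exp (meanEst propose est g))
        ∂(stdGaussian (Euc d)) := by
  have hA := measurableSet_acceptSet (B := B) hp he
  have hm := measurable_meanEst hp he
  have h0 := roundNoise_acceptSet_ne_zero hB hp he hb
  have key := lintegral_firstHit (roundNoise d B) hA h0 (c := 1) (f := fun ω => f (propose ω.1))
    measurable_one (by fun_prop)
  simp only [Pi.one_apply, Finset.prod_const_one, one_mul, ENNReal.tsum_mul_right] at key
  rw [lintegral_acceptSet hB hp he hb (f := fun g => f (propose g)) (by fun_prop)] at key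
  rw [setLIntegral_const, one_mul, ENNReal.tsum_geometric, prob_compl_eq_one_sub hA,
    ENNReal.sub_sub_cancel ENNReal.one_ne_top prob_le_one] at key
  change ∫⁻ ω, f (forsOutput B propose est ω) ∂(forsNoise d B) = _ at key
  -- The geometric series has produced the inverse of the acceptance probability; the constant e^B
  -- between the tilt and the acceptance weight occurs on both sides.
  have hexp : ∀ g, ENNReal.ofReal (Real.exp (meanEst propose est g)) =
      ENNReal.ofReal (Real.exp B) * ENNReal.ofReal (Real.exp (meanEst propose est g - B)) := by
    intro g
    rw [← ENNReal.ofReal_mul (Real.exp_pos _).le, ← Real.exp_add]; congr 2; ring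
  simp_rw [hexp]
  rw [lintegral_const_mul _ (by fun_prop), ← roundNoise_acceptSet hB hp he hb, key]
  simp_rw [mul_left_comm _ (ENNReal.ofReal (Real.exp B))]
  rw [lintegral_const_mul _ (by fun_prop), mul_assoc, ← mul_assoc (roundNoise d B _),
    ENNReal.mul_inv_cancel h0 (measure_ne_top _ _), one_mul]

/-- The rate at which the exponential moments of the number of queries are controlled. -/
def queryRate (B : ℝ) : ℝ := Real.log (1 + Real.log (1 + Real.exp (-(2 * B)) / 2) / (2 * B))

lemma queryRate_pos (hB : 0 < B) : 0 < queryRate B := by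
  have h1 : 0 < Real.log (1 + Real.exp (-(2 * B)) / 2) :=
    Real.log_pos (by linarith [Real.exp_pos (-(2 * B))])
  exact Real.log_pos (by linarith [div_pos h1 (by positivity : 0 < 2 * B)])

/-- `queryRate` is obtained by inverting the Poisson moment generating function. The excess over 1
is half of the guaranteed acceptance probability e^{-2B}. -/
lemma lintegral_poisson_queryRate (hB : 0 < B) :
    ∫⁻ n, ENNReal.ofReal (Real.exp (queryRate B * (n : ℕ))) ∂(poissonMeasure (2 * B).toNNReal) =
      ENNReal.ofReal (1 + Real.exp (-(2 * B)) / 2) := by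
  have := lintegral_poissonMeasure_pow (2 * B).toNNReal (Real.exp_pos (queryRate B)).le
  simp_rw [← Real.exp_nat_mul] at this
  simp_rw [mul_comm (queryRate B)]
  rw [this]
  have h1 : 0 < Real.log (1 + Real.exp (-(2 * B)) / 2) :=
    Real.log_pos (by linarith [Real.exp_pos (-(2 * B))])
  rw [queryRate, Real.exp_log (by positivity), Real.coe_toNNReal _ (by positivity)]
  congr 1
  rw [add_sub_cancel_left, mul_div_cancel₀ _ (by positivity), Real.exp_log (by positivity)]

/-- The total weight of a round is 1 + e^{-2B}/2, and its accepted part is at least e^{-2B} because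
the weight is at least 1. Hence the rejected part is at most 1 - e^{-2B}/2, the geometric series is
at most 2e^{2B}, and the accepting round contributes at most 2. -/
lemma lintegral_forsCount_le (hB : 0 < B) (hp : Measurable propose)
    (he : Measurable fun z : Euc d × unitInterval => est z.1 z.2)
    (hb : ∀ x r, |est x r| ≤ B) :
    ∫⁻ ω, ENNReal.ofReal (Real.exp (queryRate B * forsCount B propose est ω)) ∂(forsNoise d B) ≤
      ENNReal.ofReal (4 * Real.exp (2 * B)) := by
  have hA := measurableSet_acceptSet (B := B) hp he
  have h0 := roundNoise_acceptSet_ne_zero hB hp he hb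
  set c : RoundNoise d → ℝ≥0∞ := fun ω => ENNReal.ofReal (Real.exp (queryRate B * ω.2.1)) with hc
  have hcm : Measurable c := by fun_prop
  have hE := Real.exp_pos (-(2 * B))
  have hE1 : Real.exp (-(2 * B)) ≤ 1 := Real.exp_le_one_iff.2 (by linarith)
  have hctot : ∫⁻ ω, c ω ∂(roundNoise d B) = ENNReal.ofReal (1 + Real.exp (-(2 * B)) / 2) := by
    rw [← lintegral_poisson_queryRate hB, roundNoise]
    have h1 := lintegral_prod (μ := stdGaussian (Euc d)) (ν := (poissonMeasure (2 * B).toNNReal).prod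
      ((Measure.infinitePi (fun _ : ℕ => (volume : Measure unitInterval))).prod
        (volume : Measure unitInterval))) c hcm.aemeasurable
    rw [h1]
    simp only [hc, lintegral_const, measure_univ, mul_one]
    have h2 := lintegral_prod (μ := poissonMeasure (2 * B).toNNReal)
      (ν := (Measure.infinitePi (fun _ : ℕ => (volume : Measure unitInterval))).prod
        (volume : Measure unitInterval))
      (fun y => ENNReal.ofReal (Real.exp (queryRate B * (y.1 : ℕ)))) (by fun_prop)
    rw [h2]
    simp
  have hc1 : ∀ ω, 1 ≤ c ω := fun ω => by
    rw [hc, ← ENNReal.ofReal_one]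
    exact ENNReal.ofReal_le_ofReal (Real.one_le_exp (mul_nonneg (queryRate_pos hB).le (Nat.cast_nonneg _)))
  have hcA : ENNReal.ofReal (Real.exp (-(2 * B))) ≤ ∫⁻ ω in acceptSet B propose est, c ω ∂(roundNoise d B) := by
    refine (le_roundNoise_acceptSet hB hp he hb).trans ?_
    calc roundNoise d B (acceptSet B propose est)
        = ∫⁻ ω in acceptSet B propose est, 1 ∂(roundNoise d B) := by simp
      _ ≤ _ := lintegral_mono fun ω => hc1 ω
  have hrej : ∫⁻ ω in (acceptSet B propose est)ᶜ, c ω ∂(roundNoise d B) ≤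
      ENNReal.ofReal (1 - Real.exp (-(2 * B)) / 2) := by
    have hsum := lintegral_add_compl c hA (μ := roundNoise d B)
    rw [hctot] at hsum
    have : ENNReal.ofReal (Real.exp (-(2 * B))) + ∫⁻ ω in (acceptSet B propose est)ᶜ, c ω ∂(roundNoise d B)
        ≤ ENNReal.ofReal (Real.exp (-(2 * B))) + ENNReal.ofReal (1 - Real.exp (-(2 * B)) / 2) := by
      rw [← ENNReal.ofReal_add hE.le (by linarith)]
      refine (add_le_add_left hcA _).trans ?_
      rw [hsum]
      exact ENNReal.ofReal_le_ofReal (by linarith)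
    exact (ENNReal.add_le_add_iff_left ENNReal.ofReal_ne_top).1 this
  have hacc : ∫⁻ ω in acceptSet B propose est, c ω ∂(roundNoise d B) ≤ ENNReal.ofReal 2 := by
    refine (setLIntegral_le_lintegral _ _).trans ?_
    rw [hctot]
    exact ENNReal.ofReal_le_ofReal (by linarith)
  have key := lintegral_firstHit (roundNoise d B) hA h0 hcm hcm
  have hrw : ∀ ω : ℕ → RoundNoise d, ENNReal.ofReal (Real.exp (queryRate B * forsCount B propose est ω)) =
      (∏ i ∈ Finset.range (sInf {i | ω i ∈ acceptSet B propose est}), c (ω i)) *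
        c (ω (sInf {i | ω i ∈ acceptSet B propose est})) := by
    intro ω
    rw [← Finset.prod_range_succ (fun i => c (ω i))]
    simp only [hc]
    rw [← ENNReal.ofReal_prod_of_nonneg (fun i _ => (Real.exp_pos _).le), ← Real.exp_sum,
      ← Finset.mul_sum]
    simp [forsCount, forsStop, acceptSet]
  simp_rw [hrw]
  refine key.trans_le ?_
  rw [ENNReal.tsum_mul_right, ENNReal.tsum_geometric]
  have hinv : (1 - ∫⁻ ω in (acceptSet B propose est)ᶜ, c ω ∂(roundNoise d B))⁻¹ ≤
      ENNReal.ofReal (2 * Real.exp (2 * B)) := by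
    rw [ENNReal.inv_le_iff_inv_le, ← ENNReal.ofReal_inv_of_pos (by positivity)]
    refine le_trans ?_ (tsub_le_tsub_left hrej 1)
    rw [← ENNReal.ofReal_one, ← ENNReal.ofReal_sub _ (by linarith)]
    refine ENNReal.ofReal_le_ofReal (le_of_eq ?_)
    rw [mul_inv, ← Real.exp_neg]; ring
  refine (mul_le_mul' hinv hacc).trans (le_of_eq ?_)
  rw [← ENNReal.ofReal_mul (by positivity)]
  congr 1; ring

end Fors
end

noncomputable section

/-! ### The standard Gaussian on Euclidean space -/

section Gaussian

variable {d : ℕ}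

/-- The density of `N(0, σ² I)`. -/
def gaussDensity {d : ℕ} (σ : ℝ) (x : Euc d) : ℝ :=
  (2 * Real.pi * σ ^ 2) ^ (-(d / 2 : ℝ)) * Real.exp (-(‖x‖ ^ 2 / (2 * σ ^ 2)))

lemma gaussDensity_pos {σ : ℝ} (hσ : 0 < σ) (x : Euc d) : 0 < gaussDensity σ x := by
  unfold gaussDensity; positivity

@[fun_prop]
lemma continuous_gaussDensity (σ : ℝ) : Continuous (gaussDensity σ : Euc d → ℝ) := by
  unfold gaussDensity; fun_prop

lemma integrable_rexp_neg_mul_sq_norm {b : ℝ} (hb : 0 < b) :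
    Integrable (fun x : Euc d => Real.exp (-b * ‖x‖ ^ 2)) := by
  have h := GaussianFourier.integrable_cexp_neg_mul_sq_norm_add (V := Euc d) (b := b)
    (by simpa using hb) 0 0
  refine (h.re).congr (ae_of_all _ fun x => ?_)
  simp only [zero_mul, add_zero]
  rw [show (-(b : ℂ) * (‖x‖ : ℂ) ^ 2) = ((-b * ‖x‖ ^ 2 : ℝ) : ℂ) by push_cast; ring]
  exact Complex.exp_ofReal_re _

lemma integrable_gaussDensity {σ : ℝ} (hσ : 0 < σ) :
    Integrable (gaussDensity σ : Euc d → ℝ) := by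
  have := (integrable_rexp_neg_mul_sq_norm (d := d) (b := 1 / (2 * σ ^ 2)) (by positivity)).const_mul
    ((2 * Real.pi * σ ^ 2) ^ (-(d / 2 : ℝ)))
  refine this.congr (ae_of_all _ fun x => ?_)
  simp only [gaussDensity]
  congr 2; ring

lemma map_smul_stdGaussian {σ : ℝ} (hσ : 0 < σ) :
    (stdGaussian (Euc d)).map (σ • ·) =
      volume.withDensity fun x => ENNReal.ofReal (gaussDensity σ x) := by
  have : IsProbabilityMeasure ((stdGaussian (Euc d)).map (σ • ·)) :=
    Measure.isProbabilityMeasure_map (by fun_prop)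
  have : IsFiniteMeasure ((volume : Measure (Euc d)).withDensity
      fun x => ENNReal.ofReal (gaussDensity σ x)) :=
    isFiniteMeasure_withDensity_ofReal (integrable_gaussDensity hσ).2
  refine Measure.ext_of_charFun (funext fun t => ?_)
  rw [charFun_map_smul, charFun_stdGaussian, charFun_apply,
    integral_withDensity_eq_integral_toReal_smul (by fun_prop) (ae_of_all _ fun _ => ENNReal.ofReal_lt_top)]
  have hint := GaussianFourier.integral_cexp_neg_mul_sq_norm_add (V := Euc d)
    (b := ((1 / (2 * σ ^ 2) : ℝ) : ℂ)) (by rw [Complex.ofReal_re]; positivity) Complex.I t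
  have h1 : ∀ x : Euc d, (ENNReal.ofReal (gaussDensity σ x)).toReal • Complex.exp ((inner ℝ x t : ℝ) * Complex.I)
      = (((2 * Real.pi * σ ^ 2) ^ (-(d / 2 : ℝ)) : ℝ) : ℂ) *
        Complex.exp (-((1 / (2 * σ ^ 2) : ℝ) : ℂ) * (‖x‖ : ℂ) ^ 2 + Complex.I * (inner ℝ t x : ℝ)) := by
    intro x
    rw [ENNReal.toReal_ofReal (gaussDensity_pos hσ x).le, gaussDensity, Complex.exp_add,
      real_inner_comm, Complex.real_smul]
    push_cast
    rw [mul_assoc]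
    congr 1
    congr 1
    · congr 1; ring
    · congr 1; ring
  simp_rw [h1]
  rw [integral_const_mul, hint, ← mul_assoc]
  have h2 : ((Real.pi : ℂ) / ((1 / (2 * σ ^ 2) : ℝ) : ℂ)) ^ ((Module.finrank ℝ (Euc d) : ℂ) / 2) =
      (((2 * Real.pi * σ ^ 2) ^ (d / 2 : ℝ) : ℝ) : ℂ) := by
    rw [Complex.ofReal_cpow (by positivity)]
    congr 1
    · push_cast; field_simp
    · simp
  rw [h2, ← Complex.ofReal_mul, ← Real.rpow_add (by positivity), neg_add_cancel, Real.rpow_zero,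
    Complex.ofReal_one, one_mul]
  congr 1
  rw [norm_smul, Real.norm_eq_abs, abs_of_pos hσ, Complex.I_sq]
  push_cast
  have : (σ : ℂ) ≠ 0 := by exact_mod_cast hσ.ne'
  field_simp
  ring

lemma stdGaussian_eq_withDensity :
    stdGaussian (Euc d) = volume.withDensity fun x => ENNReal.ofReal (gaussDensity 1 x) := by
  rw [← map_smul_stdGaussian one_pos]
  simp

lemma one_div_sqrt_one_sub_le {θ : ℝ} (h0 : 0 ≤ θ) (h1 : θ ≤ 1 / 2) :
    (1 / (1 - θ)) ^ (1 / 2 : ℝ) ≤ Real.exp θ := by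
  have hp : 0 < 1 - θ := by linarith
  rw [show Real.exp θ = (Real.exp (2 * θ)) ^ (1 / 2 : ℝ) by rw [← Real.exp_mul]; congr 1; ring]
  refine Real.rpow_le_rpow (by positivity) ?_ (by norm_num)
  rw [div_le_iff₀ hp]
  have := Real.quadratic_le_exp_of_nonneg (show (0 : ℝ) ≤ 2 * θ by linarith)
  nlinarith [mul_nonneg h0 (sub_nonneg.2 h1), mul_nonneg (mul_nonneg h0 h0) (sub_nonneg.2 h1)]

/-- The exponential moment of the squared norm of a standard Gaussian. -/
lemma lintegral_exp_sq_norm_le {θ : ℝ} (h0 : 0 ≤ θ) (h1 : θ ≤ 1 / 2) :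
    ∫⁻ g, ENNReal.ofReal (Real.exp (θ * ‖g‖ ^ 2 / 2)) ∂(stdGaussian (Euc d)) ≤
      ENNReal.ofReal (Real.exp (θ * d)) := by
  have hp : 0 < 1 - θ := by linarith
  rw [stdGaussian_eq_withDensity, lintegral_withDensity_eq_lintegral_mul _ (by fun_prop) (by fun_prop)]
  have h : ∀ x : Euc d, ((fun x : Euc d => ENNReal.ofReal (gaussDensity 1 x)) *
      fun g : Euc d => ENNReal.ofReal (Real.exp (θ * ‖g‖ ^ 2 / 2))) x =
      ENNReal.ofReal ((2 * Real.pi) ^ (-(d / 2 : ℝ)) * Real.exp (-((1 - θ) / 2) * ‖x‖ ^ 2)) := by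
    intro x
    rw [Pi.mul_apply, ← ENNReal.ofReal_mul (gaussDensity_pos one_pos x).le, gaussDensity, mul_assoc,
      ← Real.exp_add]
    congr 3
    · norm_num
    · ring
  simp_rw [h]
  rw [← ofReal_integral_eq_lintegral_ofReal
    ((integrable_rexp_neg_mul_sq_norm (by linarith)).const_mul _) (ae_of_all _ fun x => by positivity),
    integral_const_mul, GaussianFourier.integral_rexp_neg_mul_sq_norm (by linarith)]
  refine ENNReal.ofReal_le_ofReal ?_
  have hd : (Module.finrank ℝ (Euc d) / 2 : ℝ) = d / 2 := by simp
  rw [hd, show Real.pi / ((1 - θ) / 2) = (2 * Real.pi) * (1 / (1 - θ)) by field_simp,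
    Real.mul_rpow (x := 2 * Real.pi) (by positivity) (by positivity), ← mul_assoc, ← Real.rpow_add (by positivity),
    neg_add_cancel, Real.rpow_zero, one_mul, show (d / 2 : ℝ) = (1 / 2) * d by ring,
    Real.rpow_mul (by positivity), Real.exp_mul]
  exact Real.rpow_le_rpow (by positivity) (one_div_sqrt_one_sub_le h0 h1) (by positivity)

lemma map_neg_stdGaussian : (stdGaussian (Euc d)).map (fun g => -g) = stdGaussian (Euc d) :=
  stdGaussian_map (LinearIsometryEquiv.neg ℝ)

lemma map_add_smul_stdGaussian (a b : ℝ) :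
    ((stdGaussian (Euc d)).prod (stdGaussian (Euc d))).map (fun z => a • z.1 + b • z.2) =
      (stdGaussian (Euc d)).map (√(a ^ 2 + b ^ 2) • ·) := by
  have h1 : ((stdGaussian (Euc d)).prod (stdGaussian (Euc d))).map (fun z => a • z.1 + b • z.2) =
      ((stdGaussian (Euc d)).map (a • ·)) ∗ ((stdGaussian (Euc d)).map (b • ·)) := by
    rw [Measure.conv, Measure.map_prod_map _ _ (by fun_prop) (by fun_prop),
      Measure.map_map (by fun_prop) (by fun_prop)]
    rfl
  have : IsProbabilityMeasure ((stdGaussian (Euc d)).map (a • ·)) :=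
    Measure.isProbabilityMeasure_map (by fun_prop)
  have : IsProbabilityMeasure ((stdGaussian (Euc d)).map (b • ·)) :=
    Measure.isProbabilityMeasure_map (by fun_prop)
  have : IsProbabilityMeasure ((stdGaussian (Euc d)).map (√(a ^ 2 + b ^ 2) • ·)) :=
    Measure.isProbabilityMeasure_map (by fun_prop)
  rw [h1]
  refine Measure.ext_of_charFun (funext fun t => ?_)
  rw [charFun_conv, charFun_map_smul, charFun_map_smul, charFun_map_smul, charFun_stdGaussian,
    charFun_stdGaussian, charFun_stdGaussian, ← Complex.exp_add]
  congr 1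
  simp only [norm_smul, Real.norm_eq_abs, Complex.ofReal_mul, mul_pow, ← Complex.ofReal_pow, sq_abs]
  rw [Real.sq_sqrt (by positivity)]
  push_cast
  ring

lemma integrable_inner_sq_stdGaussian (e : Euc d) :
    Integrable (fun g => (inner ℝ g e : ℝ) ^ 2) (stdGaussian (Euc d)) := by
  have h : MemLp (fun g : Euc d => (inner ℝ g e : ℝ)) 2 (stdGaussian (Euc d)) := by
    have := (IsGaussian.memLp_two_id (μ := stdGaussian (Euc d))).continuousLinearMap_comp (innerSL ℝ e)
    refine this.ae_eq (ae_of_all _ fun g => ?_)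
    simp [real_inner_comm]
  exact h.integrable_sq

lemma integral_inner_stdGaussian (e : Euc d) :
    ∫ g, (inner ℝ g e : ℝ) ∂(stdGaussian (Euc d)) = 0 := by
  have := integral_strongDual_stdGaussian (innerSL ℝ e)
  simpa [real_inner_comm] using this

lemma integral_inner_sq_stdGaussian (e : Euc d) :
    ∫ g, (inner ℝ g e : ℝ) ^ 2 ∂(stdGaussian (Euc d)) = ‖e‖ ^ 2 := by
  have h := variance_dual_stdGaussian (innerSL ℝ e)
  rw [variance_eq_integral (by fun_prop), integral_strongDual_stdGaussian] at h
  simpa [real_inner_comm] using h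

lemma lintegral_inner_sq_stdGaussian (e : Euc d) :
    ∫⁻ g, ENNReal.ofReal ((inner ℝ g e : ℝ) ^ 2) ∂(stdGaussian (Euc d)) = ‖e‖ₑ ^ 2 := by
  rw [← ofReal_integral_eq_lintegral_ofReal (integrable_inner_sq_stdGaussian e)
    (ae_of_all _ fun g => by positivity), integral_inner_sq_stdGaussian,
    ENNReal.ofReal_pow (norm_nonneg _), ofReal_norm]

lemma integrable_norm_sq_stdGaussian :
    Integrable (fun g => ‖g‖ ^ 2) (stdGaussian (Euc d)) :=
  (IsGaussian.memLp_two_id (μ := stdGaussian (Euc d))).integrable_norm_pow (by norm_num)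

lemma integral_norm_sq_stdGaussian :
    ∫ g, ‖g‖ ^ 2 ∂(stdGaussian (Euc d)) = d := by
  have h : ∀ g : Euc d, ‖g‖ ^ 2 = ∑ i, (inner ℝ g (EuclideanSpace.single i (1 : ℝ)) : ℝ) ^ 2 := by
    intro g
    rw [EuclideanSpace.norm_sq_eq]
    refine Finset.sum_congr rfl fun i _ => ?_
    simp [EuclideanSpace.inner_single_right]
  simp_rw [h]
  rw [integral_finsetSum _ fun i _ => integrable_inner_sq_stdGaussian _]
  simp [integral_inner_sq_stdGaussian]

end Gaussian
end

noncomputable section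

/-! ### Densities that are smoothed by a Gaussian -/

/-- `p` is a positive differentiable function for which `log p + ‖x‖² / (2σ²)` lies above its tangent
hyperplanes; this holds for every density which is a Gaussian smoothing at scale `σ`. -/
structure LogSmooth {d : ℕ} (p : Euc d → ℝ) (σ : ℝ) : Prop where
  pos : ∀ x, 0 < p x
  diff : Differentiable ℝ p
  inner_gradient_le : ∀ x v, inner ℝ v (gradient (fun y => Real.log (p y)) x) ≤
    Real.log (p (x + v)) - Real.log (p x) + ‖v‖ ^ 2 / (2 * σ ^ 2)

section Smooth

variable {d : ℕ}

/-- The density of `Y + σ Z` with `Y ∼ ν` and `Z` standard Gaussian. -/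
def smoothDensity {d : ℕ} (ν : Measure (Euc d)) (σ : ℝ) (x : Euc d) : ℝ :=
  ∫ y, gaussDensity σ (x - y) ∂ν

variable {ν : Measure (Euc d)} [IsProbabilityMeasure ν] {σ : ℝ}

lemma gaussDensity_le (x : Euc d) : gaussDensity σ x ≤ gaussDensity σ (0 : Euc d) := by
  unfold gaussDensity
  refine mul_le_mul_of_nonneg_left (Real.exp_le_exp.2 ?_) (by positivity)
  simp only [norm_zero]
  have : 0 ≤ ‖x‖ ^ 2 / (2 * σ ^ 2) := by positivity
  simpa using this

lemma integrable_gaussDensity_sub (hσ : 0 < σ) (x : Euc d) :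
    Integrable (fun y => gaussDensity σ (x - y)) ν := by
  refine Integrable.of_bound (by fun_prop) (gaussDensity σ (0 : Euc d)) (ae_of_all _ fun y => ?_)
  rw [Real.norm_eq_abs, abs_of_pos (gaussDensity_pos hσ _)]
  exact gaussDensity_le _

lemma smoothDensity_pos (hσ : 0 < σ) (x : Euc d) : 0 < smoothDensity ν σ x := by
  refine (integral_pos_iff_support_of_nonneg (fun _ => (gaussDensity_pos hσ _).le)
    (integrable_gaussDensity_sub hσ x)).2 ?_
  have : Function.support (fun y => gaussDensity σ (x - y)) = Set.univ := by
    ext; simp [(gaussDensity_pos hσ _).ne']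
  simp [this]

lemma lintegral_gaussDensity_sub (hσ : 0 < σ) (x : Euc d) :
    ∫⁻ y, ENNReal.ofReal (gaussDensity σ (x - y)) ∂ν = ENNReal.ofReal (smoothDensity ν σ x) :=
  (ofReal_integral_eq_lintegral_ofReal (integrable_gaussDensity_sub hσ x)
    (ae_of_all _ fun _ => (gaussDensity_pos hσ _).le)).symm

lemma map_add_smul_eq_withDensity (hσ : 0 < σ) :
    (ν.prod (stdGaussian (Euc d))).map (fun z => z.1 + σ • z.2) =
      volume.withDensity fun x => ENNReal.ofReal (smoothDensity ν σ x) := by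
  refine Measure.ext_of_lintegral _ fun f hf => ?_
  rw [lintegral_map hf (by fun_prop), lintegral_prod _ (by fun_prop)]
  have hy : ∀ y : Euc d, ∫⁻ g, f (y + σ • g) ∂(stdGaussian (Euc d)) =
      ∫⁻ x, f x * ENNReal.ofReal (gaussDensity σ (x - y)) := by
    intro y
    rw [← lintegral_map (f := fun z => f (y + z)) (g := fun g : Euc d => σ • g) (by fun_prop) (by fun_prop),
      map_smul_stdGaussian hσ, lintegral_withDensity_eq_lintegral_mul _ (by fun_prop) (by fun_prop),
      ← lintegral_sub_right_eq_self _ y]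
    refine lintegral_congr fun x => ?_
    simp [mul_comm]
  simp_rw [hy]
  rw [lintegral_lintegral_swap (by fun_prop)]
  simp_rw [← lintegral_gaussDensity_sub (ν := ν) hσ]
  rw [lintegral_withDensity_eq_lintegral_mul _ (Measurable.lintegral_prod_right (by fun_prop)) hf]
  refine lintegral_congr fun x => ?_
  rw [lintegral_const_mul _ (by fun_prop)]
  simp [mul_comm]

lemma hasFDerivAt_gaussDensity (x : Euc d) :
    HasFDerivAt (gaussDensity σ : Euc d → ℝ) (-(gaussDensity σ x / σ ^ 2) • innerSL ℝ x) x := by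
  have h1 : HasFDerivAt (fun x : Euc d => -(‖x‖ ^ 2 / (2 * σ ^ 2))) (-((2 * σ ^ 2)⁻¹ • (2 • innerSL ℝ x))) x := by
    have := ((hasStrictFDerivAt_norm_sq x).hasFDerivAt.const_mul ((2 * σ ^ 2)⁻¹)).neg
    refine this.congr_of_eventuallyEq (Filter.Eventually.of_forall fun y => ?_)
    simp only [Pi.neg_apply]; ring
  have h2 := (h1.exp).const_mul ((2 * Real.pi * σ ^ 2) ^ (-(d / 2 : ℝ)))
  refine h2.congr_fderiv ?_
  ext v
  simp [gaussDensity]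
  ring

lemma mul_exp_neg_sq_le (hσ : 0 < σ) (t : ℝ) :
    t * Real.exp (-(t ^ 2 / (2 * σ ^ 2))) ≤ σ := by
  rw [Real.exp_neg, ← div_eq_mul_inv, div_le_iff₀ (Real.exp_pos _)]
  have h := Real.add_one_le_exp (t ^ 2 / (2 * σ ^ 2))
  have h2 : t ≤ σ * (t ^ 2 / (2 * σ ^ 2) + 1) := by
    have : σ * (t ^ 2 / (2 * σ ^ 2) + 1) - t = ((t - σ) ^ 2 + σ ^ 2) / (2 * σ) := by
      field_simp; ring
    have h3 : 0 ≤ ((t - σ) ^ 2 + σ ^ 2) / (2 * σ) := by positivity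
    linarith
  exact h2.trans (mul_le_mul_of_nonneg_left h hσ.le)

/-- The gradient of the Gaussian density is bounded, by `mul_exp_neg_sq_le`, so a constant dominates
the differentiation under the integral and no moment of `ν` is needed. -/
lemma differentiable_smoothDensity (hσ : 0 < σ) : Differentiable ℝ (smoothDensity ν σ) := by
  intro x
  refine (hasFDerivAt_integral_of_dominated_of_fderiv_le (𝕜 := ℝ) (μ := ν) (s := Set.univ)
    (F := fun x y => gaussDensity σ (x - y))
    (F' := fun x y => -(gaussDensity σ (x - y) / σ ^ 2) • innerSL ℝ (x - y))
    (bound := fun _ => (2 * Real.pi * σ ^ 2) ^ (-(d / 2 : ℝ)) * σ / σ ^ 2)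
    Filter.univ_mem (Filter.Eventually.of_forall fun x => by fun_prop)
    (integrable_gaussDensity_sub hσ x) ?_ ?_ (integrable_const _) ?_).differentiableAt
  · refine Continuous.aestronglyMeasurable ?_
    have h1 : Continuous fun y : Euc d => -(gaussDensity σ (x - y) / σ ^ 2) := by fun_prop
    have h2 : Continuous fun y : Euc d => innerSL ℝ (x - y) :=
      (innerSL ℝ).continuous.comp (continuous_const.sub continuous_id)
    exact h1.smul h2
  · refine ae_of_all _ fun y z _ => ?_
    rw [norm_smul, innerSL_apply_norm, norm_neg, Real.norm_eq_abs,
      abs_of_nonneg (div_nonneg (gaussDensity_pos hσ _).le (by positivity)), gaussDensity]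
    have := mul_exp_neg_sq_le hσ ‖z - y‖
    rw [div_mul_eq_mul_div, mul_assoc, mul_comm (Real.exp _)]
    gcongr
  · refine ae_of_all _ fun y z _ => ?_
    have := (hasFDerivAt_gaussDensity (σ := σ) (z - y)).comp z ((hasFDerivAt_id z).sub_const y)
    simpa [Function.comp_def] using this

/-- The exponential tilt of the mixing measure. -/
lemma smoothDensity_mul_exp (hσ : 0 < σ) (x : Euc d) :
    ENNReal.ofReal (smoothDensity ν σ x * Real.exp (‖x‖ ^ 2 / (2 * σ ^ 2))) =
      ∫⁻ y, ENNReal.ofReal ((2 * Real.pi * σ ^ 2) ^ (-(d / 2 : ℝ)) *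
        Real.exp ((2 * inner ℝ x y - ‖y‖ ^ 2) / (2 * σ ^ 2))) ∂ν := by
  rw [ENNReal.ofReal_mul (smoothDensity_pos hσ x).le, ← lintegral_gaussDensity_sub hσ,
    ← lintegral_mul_const _ (by fun_prop)]
  refine lintegral_congr fun y => ?_
  rw [← ENNReal.ofReal_mul (gaussDensity_pos hσ _).le, gaussDensity, mul_assoc, ← Real.exp_add]
  congr 3
  rw [norm_sub_sq_real]
  ring

/-- The exponential of this function is the Laplace transform of a positive measure, by
`smoothDensity_mul_exp`; Hölder's inequality makes it log-convex. -/
lemma convexOn_log_smoothDensity (hσ : 0 < σ) :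
    ConvexOn ℝ Set.univ fun x => Real.log (smoothDensity ν σ x) + ‖x‖ ^ 2 / (2 * σ ^ 2) := by
  have hlog : ∀ x, Real.log (smoothDensity ν σ x) + ‖x‖ ^ 2 / (2 * σ ^ 2) =
      Real.log (smoothDensity ν σ x * Real.exp (‖x‖ ^ 2 / (2 * σ ^ 2))) := fun x => by
    rw [Real.log_mul (smoothDensity_pos hσ x).ne' (Real.exp_pos _).ne', Real.log_exp]
  have hpos : ∀ x, 0 < smoothDensity ν σ x * Real.exp (‖x‖ ^ 2 / (2 * σ ^ 2)) :=
    fun x => mul_pos (smoothDensity_pos hσ x) (Real.exp_pos _)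
  refine ⟨convex_univ, fun x _ z _ a b ha hb hab => ?_⟩
  simp only [hlog, smul_eq_mul]
  rw [← Real.log_rpow (hpos x), ← Real.log_rpow (hpos z),
    ← Real.log_mul (Real.rpow_pos_of_pos (hpos x) _).ne' (Real.rpow_pos_of_pos (hpos z) _).ne']
  refine Real.log_le_log (hpos _) ?_
  rw [← ENNReal.ofReal_le_ofReal_iff (by have := hpos x; have := hpos z; positivity),
    ENNReal.ofReal_mul (Real.rpow_nonneg (hpos x).le _),
    ← ENNReal.ofReal_rpow_of_pos (hpos x), ← ENNReal.ofReal_rpow_of_pos (hpos z),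
    smoothDensity_mul_exp hσ, smoothDensity_mul_exp hσ, smoothDensity_mul_exp hσ]
  refine le_trans (le_of_eq ?_) (ENNReal.lintegral_mul_norm_pow_le (by fun_prop) (by fun_prop) ha hb hab)
  refine lintegral_congr fun y => ?_
  have hc : 0 < (2 * Real.pi * σ ^ 2) ^ (-(d / 2 : ℝ)) := by positivity
  rw [ENNReal.ofReal_rpow_of_pos (by positivity), ENNReal.ofReal_rpow_of_pos (by positivity),
    ← ENNReal.ofReal_mul (by positivity)]
  congr 1
  rw [Real.mul_rpow (x := (2 * Real.pi * σ ^ 2) ^ (-(d / 2 : ℝ))) hc.le (Real.exp_pos _).le,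
    Real.mul_rpow (x := (2 * Real.pi * σ ^ 2) ^ (-(d / 2 : ℝ))) hc.le (Real.exp_pos _).le,
    mul_mul_mul_comm, ← Real.rpow_add hc, hab, Real.rpow_one, ← Real.exp_mul, ← Real.exp_mul,
    ← Real.exp_add]
  congr 2
  rw [inner_add_left, real_inner_smul_left, real_inner_smul_left]
  obtain rfl : b = 1 - a := by linarith
  ring

/-- Restrict the convex function to the line through x in direction v and compare its slope at 0
with its secant over [0,1]. The linear terms of the quadratic cancel and ‖v‖²/(2σ²) remains. -/
lemma logSmooth_smoothDensity (hσ : 0 < σ) : LogSmooth (smoothDensity ν σ) σ where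
  pos := smoothDensity_pos hσ
  diff := differentiable_smoothDensity hσ
  inner_gradient_le x v := by
    have hc : ConvexOn ℝ Set.univ fun t : ℝ => Real.log (smoothDensity ν σ (x + t • v)) +
        ‖x + t • v‖ ^ 2 / (2 * σ ^ 2) := by
      have := (convexOn_log_smoothDensity (ν := ν) hσ).comp_affineMap (AffineMap.lineMap x (x + v))
      refine this.congr fun t _ => ?_
      simp [AffineMap.lineMap_apply, add_comm]
    have hline : HasDerivAt (fun t : ℝ => x + t • v) v 0 := by
      have := ((hasDerivAt_id (0 : ℝ)).smul_const v).const_add x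
      simpa using this
    have hdL : DifferentiableAt ℝ (fun y => Real.log (smoothDensity ν σ y)) (x + (0 : ℝ) • v) :=
      (differentiable_smoothDensity hσ _).log (smoothDensity_pos hσ _).ne'
    have h1 := hdL.hasFDerivAt.comp_hasDerivAt (0 : ℝ) hline
    have h2 := ((hasStrictFDerivAt_norm_sq (x + (0 : ℝ) • v)).hasFDerivAt.comp_hasDerivAt (0 : ℝ)
      hline).div_const (2 * σ ^ 2)
    have h3 := hc.le_slope_of_hasDerivAt (Set.mem_univ _) (Set.mem_univ _) one_pos (h1.add h2)
    have h4 : inner ℝ v (gradient (fun y => Real.log (smoothDensity ν σ y)) x) =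
        fderiv ℝ (fun y => Real.log (smoothDensity ν σ y)) x v := by
      rw [← toDual_gradient, InnerProductSpace.toDual_apply_apply, real_inner_comm]
    rw [h4]
    simp only [slope_def_field, zero_smul, add_zero, one_smul, sub_zero, div_one] at h3
    rw [norm_add_sq_real] at h3
    simp at h3
    have h5 : (‖x‖ ^ 2 + 2 * inner ℝ x v + ‖v‖ ^ 2) / (2 * σ ^ 2) = ‖x‖ ^ 2 / (2 * σ ^ 2) +
      2 * inner ℝ x v / (2 * σ ^ 2) + ‖v‖ ^ 2 / (2 * σ ^ 2) := by ring
    linarith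

end Smooth

/-! ### Scores and line integrals for log-smooth densities. -/

section LogSmooth

variable {d : ℕ} {p : Euc d → ℝ} {σ : ℝ}

/-- Continuous densities that agree almost everywhere agree everywhere, so the chosen density is `p`
itself. -/
lemma contDensity_withDensity (hc : Continuous p) (h0 : ∀ x, 0 ≤ p x) :
    contDensity (volume.withDensity fun x => ENNReal.ofReal (p x)) = p := by
  have h : ∃ ρ : Euc d → ℝ, Continuous ρ ∧ (∀ x, 0 ≤ ρ x) ∧
      (volume.withDensity fun x => ENNReal.ofReal (p x)) =
        volume.withDensity (fun x => ENNReal.ofReal (ρ x)) := ⟨p, hc, h0, rfl⟩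
  rw [contDensity, dif_pos h]
  obtain ⟨h1, h2, h3⟩ := h.choose_spec
  have hae := (withDensity_eq_iff_of_sigmaFinite (by fun_prop) (by fun_prop)).1 h3
  refine ((Continuous.ae_eq_iff_eq volume hc h1).1 ?_).symm
  filter_upwards [hae] with x hx
  exact (ENNReal.ofReal_eq_ofReal_iff (h0 x) (h2 x)).1 hx

lemma measurable_gradient (f : Euc d → ℝ) : Measurable (gradient f) := by
  have : gradient f = fun x => (InnerProductSpace.toDual ℝ (Euc d)).symm (fderiv ℝ f x) := rfl
  rw [this]
  exact (LinearIsometryEquiv.continuous _).measurable.comp (measurable_fderiv ℝ f)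

/-- Add the tangent inequalities at the two points of the line; the values of log p cancel. -/
lemma LogSmooth.inner_gradient_mono (h : LogSmooth p σ) (hσ : 0 < σ) (x v : Euc d) {r t : ℝ} (hrt : r ≤ t) :
    inner ℝ v (gradient (fun y => Real.log (p y)) (x + r • v)) + r * (‖v‖ ^ 2 / σ ^ 2) ≤
      inner ℝ v (gradient (fun y => Real.log (p y)) (x + t • v)) + t * (‖v‖ ^ 2 / σ ^ 2) := by
  rcases hrt.eq_or_lt with rfl | hlt
  · rfl
  have h1 := h.inner_gradient_le (x + r • v) ((t - r) • v)
  have h2 := h.inner_gradient_le (x + t • v) ((r - t) • v)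
  rw [show x + r • v + (t - r) • v = x + t • v by module] at h1
  rw [show x + t • v + (r - t) • v = x + r • v by module] at h2
  rw [real_inner_smul_left, norm_smul, mul_pow, Real.norm_eq_abs, sq_abs] at h1 h2
  set a := inner ℝ v (gradient (fun y => Real.log (p y)) (x + r • v))
  set b := inner ℝ v (gradient (fun y => Real.log (p y)) (x + t • v))
  have h3 : (t - r) * (a - b) ≤ (t - r) * ((t - r) * (‖v‖ ^ 2 / σ ^ 2)) := by
    have e1 : (t - r) ^ 2 * ‖v‖ ^ 2 / (2 * σ ^ 2) + (r - t) ^ 2 * ‖v‖ ^ 2 / (2 * σ ^ 2) =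
      (t - r) * ((t - r) * (‖v‖ ^ 2 / σ ^ 2)) := by field_simp; ring
    nlinarith
  have h4 := le_of_mul_le_mul_left h3 (sub_pos.2 hlt)
  linarith

lemma LogSmooth.hasDerivAt_line (h : LogSmooth p σ) (x v : Euc d) (t : ℝ) :
    HasDerivAt (fun t : ℝ => Real.log (p (x + t • v)))
      (inner ℝ v (gradient (fun y => Real.log (p y)) (x + t • v))) t := by
  have hline : HasDerivAt (fun t : ℝ => x + t • v) v t := by
    have := ((hasDerivAt_id t).smul_const v).const_add x
    simpa using this
  have hdL : DifferentiableAt ℝ (fun y => Real.log (p y)) (x + t • v) :=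
    (h.diff _).log (h.pos _).ne'
  have := hdL.hasFDerivAt.comp_hasDerivAt t hline
  rwa [← toDual_gradient, InnerProductSpace.toDual_apply_apply, real_inner_comm] at this

/-- `LogSmooth` does not assume a continuous gradient. Along a line the derivative is a monotone
function minus a linear one, which is enough for the fundamental theorem of calculus. -/
lemma LogSmooth.intervalIntegrable_inner_gradient (h : LogSmooth p σ) (hσ : 0 < σ) (x v : Euc d) (a b : ℝ) :
    IntervalIntegrable (fun t : ℝ => inner ℝ v (gradient (fun y => Real.log (p y)) (x + t • v)))
      volume a b := by
  have h1 : Monotone fun t : ℝ => inner ℝ v (gradient (fun y => Real.log (p y)) (x + t • v)) +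
      t * (‖v‖ ^ 2 / σ ^ 2) := fun r t hrt => h.inner_gradient_mono hσ x v hrt
  have h2 := (h1.intervalIntegrable (μ := volume) (a := a) (b := b)).sub
    (Continuous.intervalIntegrable (by fun_prop : Continuous fun t : ℝ => t * (‖v‖ ^ 2 / σ ^ 2)) a b)
  simpa using h2

lemma LogSmooth.log_sub_log_eq_integral (h : LogSmooth p σ) (hσ : 0 < σ) (x v : Euc d) :
    Real.log (p (x + v)) - Real.log (p x) =
      ∫ t in (0 : ℝ)..1, inner ℝ v (gradient (fun y => Real.log (p y)) (x + t • v)) := by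
  rw [intervalIntegral.integral_eq_sub_of_hasDerivAt (fun t _ => h.hasDerivAt_line x v t)
    (h.intervalIntegrable_inner_gradient hσ x v 0 1)]
  simp

end LogSmooth

/-! ### The forward process -/

section Forward

variable {d : ℕ} {T : ℕ} {σ : ℕ → ℝ} {σ₁ : ℝ}

lemma IsVPSchedule.alphaBar_pos (h : IsVPSchedule T σ σ₁) {t : ℕ} (ht : t ≤ T) : 0 < vpAlphaBar σ t := by
  refine Real.sqrt_pos.2 ?_
  rcases Nat.eq_zero_or_pos t with rfl | h1
  · simp [h.zero]
  · nlinarith [h.pos t h1 ht, h.lt_one t h1 ht]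

/-- Independent Gaussian noises add in variance, and α_t²(σ_t² + η_t) = σ_{t+1}² by the definition
of η_t. -/
lemma forwardLaw_eq_map (pdata : Measure (Euc d)) [IsProbabilityMeasure pdata]
    (h : IsVPSchedule T σ σ₁) {t : ℕ} (ht : t ≤ T) :
    forwardLaw pdata σ t = (pdata.prod (stdGaussian (Euc d))).map
      (fun z => vpAlphaBar σ t • z.1 + σ t • z.2) := by
  induction t with
  | zero =>
    simp only [forwardLaw, vpAlphaBar, h.zero]
    have : (fun z : Euc d × Euc d => √(1 - 0 ^ 2) • z.1 + (0 : ℝ) • z.2) = Prod.fst := by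
      ext z; simp
    rw [this, ← Measure.fst, Measure.fst_prod]
  | succ t ih =>
    rw [forwardLaw, ih (by omega)]
    have hα := h.alphaBar_pos (t := t) (by omega)
    have hα' := h.alphaBar_pos ht
    have hη := h.eta_pos t (by omega)
    have hσ' := h.pos (t + 1) (by omega) ht
    have ha : 0 < vpAlpha σ t := div_pos hα' hα
    refine Measure.ext_of_lintegral _ fun f hf => ?_
    rw [lintegral_map hf (by fun_prop), lintegral_map hf (by fun_prop),
      lintegral_prod _ (by fun_prop), lintegral_map (Measurable.lintegral_prod_right (by fun_prop)) (by fun_prop),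
      lintegral_prod _ (by fun_prop)]
    rw [lintegral_prod _ (by fun_prop)]
    refine lintegral_congr fun y => ?_
    have key := map_add_smul_stdGaussian (d := d) (vpAlpha σ t * σ t) (vpAlpha σ t * √(vpEta σ t))
    have hsq : √((vpAlpha σ t * σ t) ^ 2 + (vpAlpha σ t * √(vpEta σ t)) ^ 2) = σ (t + 1) := by
      rw [mul_pow, mul_pow, Real.sq_sqrt hη.le, ← mul_add, vpEta, add_sub_cancel,
        mul_div_cancel₀ _ (by positivity), Real.sqrt_sq hσ'.le]
    rw [hsq] at key
    have h1 := lintegral_map (μ := stdGaussian (Euc d)) (f := fun z => f (vpAlphaBar σ (t + 1) • y + z))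
      (g := fun g : Euc d => σ (t + 1) • g) (by fun_prop) (by fun_prop)
    rw [← h1, ← key, lintegral_map (by fun_prop) (by fun_prop), lintegral_prod _ (by fun_prop)]
    refine lintegral_congr fun g => lintegral_congr fun g' => ?_
    congr 1
    have : vpAlphaBar σ (t + 1) = vpAlpha σ t * vpAlphaBar σ t := by
      rw [vpAlpha, div_mul_cancel₀ _ hα.ne']
    rw [this]
    module

/-- The density of the law of `X_t`. -/
def forwardDensity {d : ℕ} (pdata : Measure (Euc d)) (σ : ℕ → ℝ) (t : ℕ) : Euc d → ℝ :=
  smoothDensity (pdata.map (vpAlphaBar σ t • ·)) (σ t)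

variable (pdata : Measure (Euc d)) [IsProbabilityMeasure pdata]

instance (a : ℝ) : IsProbabilityMeasure (pdata.map (a • ·)) :=
  Measure.isProbabilityMeasure_map (by fun_prop)

lemma logSmooth_forwardDensity (h : IsVPSchedule T σ σ₁) {t : ℕ} (h1 : 1 ≤ t) (ht : t ≤ T) :
    LogSmooth (forwardDensity pdata σ t) (σ t) :=
  logSmooth_smoothDensity (h.pos t h1 ht)

lemma forwardLaw_eq_withDensity (h : IsVPSchedule T σ σ₁) {t : ℕ} (h1 : 1 ≤ t) (ht : t ≤ T) :
    forwardLaw pdata σ t = volume.withDensity fun x => ENNReal.ofReal (forwardDensity pdata σ t x) := by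
  rw [forwardDensity, ← map_add_smul_eq_withDensity (h.pos t h1 ht), forwardLaw_eq_map pdata h ht]
  refine Measure.ext_of_lintegral _ fun f hf => ?_
  rw [lintegral_map hf (by fun_prop), lintegral_map hf (by fun_prop), lintegral_prod _ (by fun_prop),
    lintegral_prod _ (by fun_prop), lintegral_map (Measurable.lintegral_prod_right (by fun_prop)) (by fun_prop)]

lemma score_forwardLaw (h : IsVPSchedule T σ σ₁) {t : ℕ} (h1 : 1 ≤ t) (ht : t ≤ T) :
    score (forwardLaw pdata σ t) = gradient fun y => Real.log (forwardDensity pdata σ t y) := by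
  have hs := logSmooth_forwardDensity pdata h h1 ht
  ext1 x
  rw [score, forwardLaw_eq_withDensity pdata h h1 ht, contDensity_withDensity hs.diff.continuous
    fun x => (hs.pos x).le]

lemma isProbabilityMeasure_forwardLaw (h : IsVPSchedule T σ σ₁) {t : ℕ} (ht : t ≤ T) :
    IsProbabilityMeasure (forwardLaw pdata σ t) := by
  rw [forwardLaw_eq_map pdata h ht]
  exact Measure.isProbabilityMeasure_map (by fun_prop)

end Forward
end

noncomputable section

/-! ### Relative entropy of measures with densities -/

/-- The excess of the exponential over its tangent at `0`. -/
def expGap (u : ℝ) : ℝ := Real.exp u - 1 - u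

lemma expGap_nonneg (u : ℝ) : 0 ≤ expGap u := by
  unfold expGap; linarith [Real.add_one_le_exp u]

@[fun_prop]
lemma measurable_expGap : Measurable expGap := by unfold expGap; fun_prop

lemma expGap_le_sq {u b : ℝ} (hu : |u| ≤ b) : expGap u ≤ Real.exp b * u ^ 2 := by
  have h1 : expGap u ≤ u ^ 2 * Real.exp |u| := by
    rcases le_total 0 u with h | h
    · have h2 := Real.add_one_le_exp (-u)
      rw [abs_of_nonneg h]
      have h3 : Real.exp u - 1 ≤ u * Real.exp u := by
        have := mul_le_mul_of_nonneg_left h2 (Real.exp_pos u).le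
        rw [← Real.exp_add, add_neg_cancel, Real.exp_zero] at this
        linarith
      have h4 : u * (Real.exp u - 1) ≤ u * (u * Real.exp u) := mul_le_mul_of_nonneg_left h3 h
      unfold expGap
      nlinarith
    · rw [abs_of_nonpos h]
      have h2 := Real.add_one_le_exp (-u)
      have h3 : Real.exp u ≤ 1 + u * Real.exp u := by
        have := mul_le_mul_of_nonneg_left h2 (Real.exp_pos u).le
        rw [← Real.exp_add, add_neg_cancel, Real.exp_zero] at this
        linarith
      have h5 := Real.add_one_le_exp u
      have h4 : u * Real.exp u ≤ u * (u + 1) + 0 → expGap u ≤ u ^ 2 * Real.exp (-u) := by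
        intro hh
        unfold expGap
        have : (1 : ℝ) ≤ Real.exp (-u) := Real.one_le_exp (by linarith)
        nlinarith [sq_nonneg u]
      exact h4 (by nlinarith)
  refine h1.trans ?_
  rw [mul_comm]
  exact mul_le_mul_of_nonneg_right (Real.exp_le_exp.2 hu) (sq_nonneg u)

/-- With u = log(g/f) one has g · klFun(f/g) = f(e^u - 1 - u). The integrand is nonnegative even
when the two masses differ, so unnormalised densities are allowed. -/
lemma klDiv_withDensity {α : Type*} [MeasurableSpace α] (m : Measure α) {f g : α → ℝ}
    (hf : Measurable f) (hg : Measurable g) (hf0 : ∀ x, 0 < f x) (hg0 : ∀ x, 0 < g x)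
    (hfi : ∫⁻ x, ENNReal.ofReal (f x) ∂m ≠ ∞) (hgi : ∫⁻ x, ENNReal.ofReal (g x) ∂m ≠ ∞) :
    klDiv (m.withDensity fun x => ENNReal.ofReal (f x)) (m.withDensity fun x => ENNReal.ofReal (g x)) =
      ∫⁻ x, ENNReal.ofReal (f x) * ENNReal.ofReal (expGap (Real.log (g x) - Real.log (f x))) ∂m := by
  have : IsFiniteMeasure (m.withDensity fun x => ENNReal.ofReal (f x)) := isFiniteMeasure_withDensity hfi
  have : IsFiniteMeasure (m.withDensity fun x => ENNReal.ofReal (g x)) := isFiniteMeasure_withDensity hgi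
  have heq : (m.withDensity fun x => ENNReal.ofReal (f x)) =
      (m.withDensity fun x => ENNReal.ofReal (g x)).withDensity fun x => ENNReal.ofReal (f x / g x) := by
    rw [← withDensity_mul _ (by fun_prop) (by fun_prop)]
    congr 1
    ext x
    rw [Pi.mul_apply, ← ENNReal.ofReal_mul (hg0 x).le, mul_div_cancel₀ _ (hg0 x).ne']
  have hac : (m.withDensity fun x => ENNReal.ofReal (f x)) ≪
      (m.withDensity fun x => ENNReal.ofReal (g x)) := by
    rw [heq]; exact withDensity_absolutelyContinuous _ _
  rw [klDiv_eq_lintegral_klFun_of_ac hac]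
  have hrn : ((m.withDensity fun x => ENNReal.ofReal (f x)).rnDeriv
      (m.withDensity fun x => ENNReal.ofReal (g x)))
      =ᵐ[m.withDensity fun x => ENNReal.ofReal (g x)] fun x => ENNReal.ofReal (f x / g x) := by
    conv_lhs => rw [heq]
    exact Measure.rnDeriv_withDensity _ (by fun_prop)
  rw [lintegral_congr_ae (g := fun x => ENNReal.ofReal (klFun (f x / g x)))
    (by
      filter_upwards [hrn] with x hx
      rw [hx, ENNReal.toReal_ofReal (div_pos (hf0 x) (hg0 x)).le]),
    lintegral_withDensity_eq_lintegral_mul _ (by fun_prop)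
      (show Measurable fun x => ENNReal.ofReal (klFun (f x / g x)) from
        ENNReal.measurable_ofReal.comp (measurable_klFun.comp (hf.div hg)))]
  refine lintegral_congr fun x => ?_
  rw [Pi.mul_apply, ← ENNReal.ofReal_mul (hg0 x).le, ← ENNReal.ofReal_mul (hf0 x).le]
  congr 1
  have hfx := hf0 x
  have hgx := hg0 x
  rw [klFun_apply, expGap, Real.exp_sub, Real.exp_log hfx, Real.exp_log hgx,
    Real.log_div hfx.ne' hgx.ne']
  field_simp
  ring

/-! ### One step of the reverse process -/

section Step

variable {d : ℕ} {p : Euc d → ℝ} {σ η B β h : ℝ}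

lemma lintegral_volume_prod_shift (c : ℝ) {F : Euc d × Euc d → ℝ≥0∞} (hF : Measurable F) :
    ∫⁻ z, F (z.1 + c • z.2, z.2) ∂((volume : Measure (Euc d)).prod (stdGaussian (Euc d))) =
      ∫⁻ z, F z ∂((volume : Measure (Euc d)).prod (stdGaussian (Euc d))) := by
  rw [lintegral_prod_symm _ (by fun_prop), lintegral_prod_symm _ (by fun_prop)]
  refine lintegral_congr fun g => ?_
  exact lintegral_add_right_eq_self (fun x => F (x, g)) (c • g)

lemma lintegral_volume_prod_neg {F : Euc d × Euc d → ℝ≥0∞} (hF : Measurable F) :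
    ∫⁻ z, F (z.1, -z.2) ∂((volume : Measure (Euc d)).prod (stdGaussian (Euc d))) =
      ∫⁻ z, F z ∂((volume : Measure (Euc d)).prod (stdGaussian (Euc d))) := by
  rw [lintegral_prod _ (by fun_prop), lintegral_prod _ (by fun_prop)]
  refine lintegral_congr fun x => ?_
  conv_rhs => rw [← map_neg_stdGaussian]
  rw [lintegral_map (by fun_prop) (by fun_prop)]

/-- The map (x, g) ↦ (x + cg, -g) is a measure-preserving involution. For c = √η it reverses a step,
exchanging X_t and X_{t+1}/α_t. -/
lemma lintegral_volume_prod_swap (c : ℝ) {F : Euc d × Euc d → ℝ≥0∞} (hF : Measurable F) :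
    ∫⁻ z, F (z.1 + c • z.2, -z.2) ∂((volume : Measure (Euc d)).prod (stdGaussian (Euc d))) =
      ∫⁻ z, F z ∂((volume : Measure (Euc d)).prod (stdGaussian (Euc d))) := by
  rw [← lintegral_volume_prod_neg hF,
    ← lintegral_volume_prod_shift c (F := fun z => F (z.1, -z.2)) (by fun_prop)]

/-- The joint law of `(X, G)` with `X` of density `p` and an independent standard Gaussian `G`. -/
def stateNoise {d : ℕ} (p : Euc d → ℝ) : Measure (Euc d × Euc d) :=
  (volume.withDensity fun x => ENNReal.ofReal (p x)).prod (stdGaussian (Euc d))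

lemma lintegral_stateNoise (hp : Measurable p) {F : Euc d × Euc d → ℝ≥0∞} (hF : Measurable F) :
    ∫⁻ z, F z ∂(stateNoise p) = ∫⁻ z, ENNReal.ofReal (p z.1) * F z
      ∂((volume : Measure (Euc d)).prod (stdGaussian (Euc d))) := by
  rw [stateNoise, lintegral_prod _ (by fun_prop), lintegral_prod _ (by fun_prop),
    lintegral_withDensity_eq_lintegral_mul _ (by fun_prop) (Measurable.lintegral_prod_right (by fun_prop))]
  refine lintegral_congr fun x => ?_
  dsimp only
  rw [Pi.mul_apply, lintegral_const_mul _ (by fun_prop)]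

/-- The directional derivative of `log p` at `x` in the direction `√η g`. -/
def scoreStep {d : ℕ} (p : Euc d → ℝ) (η : ℝ) (z : Euc d × Euc d) : ℝ :=
  inner ℝ (√η • z.2) (gradient (fun y => Real.log (p y)) z.1)

@[fun_prop]
lemma measurable_scoreStep : Measurable (scoreStep p η) := by
  have := measurable_gradient (fun y => Real.log (p y))
  unfold scoreStep
  fun_prop

/-- The steps for which the increments of `log p` are controlled. -/
def goodStep {d : ℕ} (p : Euc d → ℝ) (η h β : ℝ) : Set (Euc d × Euc d) :=
  {z | -β ≤ scoreStep p η z ∧ scoreStep p η (z.1 + √η • z.2, z.2) ≤ β ∧ h * ‖z.2‖ ^ 2 ≤ β}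

lemma measurableSet_goodStep : MeasurableSet (goodStep p η h β) := by
  have h1 : Measurable fun z : Euc d × Euc d => scoreStep p η (z.1 + √η • z.2, z.2) :=
    measurable_scoreStep.comp ((measurable_fst.add (measurable_snd.const_smul (√η))).prodMk measurable_snd)
  exact (measurableSet_le measurable_const measurable_scoreStep).inter
    ((measurableSet_le h1 measurable_const).inter (measurableSet_le ((measurable_snd.norm.pow_const 2).const_mul h) measurable_const))

/-- Reversing a step exchanges the endpoints and changes the sign of the derivatives, so the lower
bound at the start and the upper bound at the end trade places. -/
lemma swap_mem_goodStep (z : Euc d × Euc d) :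
    (z.1 + √η • z.2, -z.2) ∈ goodStep p η h β ↔ z ∈ goodStep p η h β := by
  have e : ∀ x g : Euc d, scoreStep p η (x, -g) = -scoreStep p η (x, g) := by
    intro x g; simp [scoreStep]
  simp only [goodStep, Set.mem_ofPred_eq, e, smul_neg, add_neg_cancel_right, norm_neg]
  constructor <;> rintro ⟨h1, h2, h3⟩ <;> exact ⟨by linarith, by linarith, h3⟩

lemma isProbabilityMeasure_stateNoise (hp1 : ∫⁻ x, ENNReal.ofReal (p x) = 1) : IsProbabilityMeasure (stateNoise p) := by
  have : IsProbabilityMeasure (volume.withDensity fun x => ENNReal.ofReal (p x)) :=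
    ⟨by rw [withDensity_apply _ MeasurableSet.univ, setLIntegral_univ, hp1]⟩
  unfold stateNoise
  infer_instance

/-- The score of a Gaussian smoothing is sub-Gaussian. -/
lemma lintegral_exp_scoreStep_le (hp : LogSmooth p σ) (hp1 : ∫⁻ x, ENNReal.ofReal (p x) = 1)
    (hσ : 0 < σ) (hh : 0 ≤ h) (hη : η = h * σ ^ 2) {c : ℝ}
    (hc : c ^ 2 * h ≤ 1 / 2) :
    ∫⁻ z, ENNReal.ofReal (Real.exp (c * scoreStep p η z)) ∂(stateNoise p) ≤
      ENNReal.ofReal (Real.exp (c ^ 2 * h * d)) := by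
  have hpm : Measurable p := hp.diff.continuous.measurable
  rw [lintegral_stateNoise hpm (by fun_prop)]
  have hη0 : 0 ≤ η := by rw [hη]; positivity
  -- For v = c√η g the tangent inequality reads p(x) exp⟨v, ∇log p(x)⟩ ≤ p(x + v) exp(‖v‖²/(2σ²)).
  -- Translation invariance then removes p and leaves an exponential moment of ‖g‖².
  refine le_trans (lintegral_mono (g := fun z : Euc d × Euc d =>
    ENNReal.ofReal (p (z.1 + (c * √η) • z.2)) * ENNReal.ofReal (Real.exp (c ^ 2 * h * ‖z.2‖ ^ 2 / 2))) ?_) ?_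
  · intro z
    simp only
    rw [← ENNReal.ofReal_mul (hp.pos _).le, ← ENNReal.ofReal_mul (hp.pos _).le]
    refine ENNReal.ofReal_le_ofReal ?_
    have h1 := hp.inner_gradient_le z.1 ((c * √η) • z.2)
    have h2 : c * scoreStep p η z = inner ℝ ((c * √η) • z.2) (gradient (fun y => Real.log (p y)) z.1) := by
      rw [scoreStep, mul_smul, real_inner_smul_left _ _ c]
    have h3 : ‖(c * √η) • z.2‖ ^ 2 / (2 * σ ^ 2) = c ^ 2 * h * ‖z.2‖ ^ 2 / 2 := by
      rw [norm_smul, mul_pow, Real.norm_eq_abs, sq_abs, mul_pow, Real.sq_sqrt hη0, hη]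
      field_simp
    rw [h2]
    rw [h3] at h1
    calc p z.1 * Real.exp _ ≤ p z.1 * Real.exp (Real.log (p (z.1 + (c * √η) • z.2)) - Real.log (p z.1)
          + c ^ 2 * h * ‖z.2‖ ^ 2 / 2) :=
          mul_le_mul_of_nonneg_left (Real.exp_le_exp.2 h1) (hp.pos _).le
      _ = _ := by
        rw [Real.exp_add, Real.exp_sub, Real.exp_log (hp.pos _), Real.exp_log (hp.pos _)]
        have := hp.pos z.1
        field_simp
  · rw [lintegral_volume_prod_shift (c * √η)
      (F := fun z => ENNReal.ofReal (p z.1) * ENNReal.ofReal (Real.exp (c ^ 2 * h * ‖z.2‖ ^ 2 / 2)))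
      (by fun_prop), lintegral_prod_symm _ (by fun_prop)]
    simp_rw [lintegral_mul_const _ (show Measurable fun x : Euc d => ENNReal.ofReal (p x) by fun_prop), hp1,
      one_mul]
    exact lintegral_exp_sq_norm_le (by positivity) hc

lemma measure_scoreStep_lt_le (hp : LogSmooth p σ) (hp1 : ∫⁻ x, ENNReal.ofReal (p x) = 1)
    (hσ : 0 < σ) (hh : 0 ≤ h) (hη : η = h * σ ^ 2) {c : ℝ} (hc0 : 0 < c)
    (hc : c ^ 2 * h ≤ 1 / 2) :
    stateNoise p {z | scoreStep p η z < -β} ≤ ENNReal.ofReal (Real.exp (c ^ 2 * h * d - c * β)) := by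
  have h1 := lintegral_exp_scoreStep_le hp hp1 hσ hh hη (c := -c) (by rwa [neg_sq])
  have h2 := meas_ge_le_lintegral_div (μ := stateNoise p)
    (f := fun z => ENNReal.ofReal (Real.exp (-c * scoreStep p η z))) (by fun_prop)
    (ε := ENNReal.ofReal (Real.exp (c * β))) (ENNReal.ofReal_pos.2 (Real.exp_pos _)).ne' ENNReal.ofReal_ne_top
  refine (measure_mono fun z hz => ?_).trans (h2.trans ((ENNReal.div_le_div_right h1 _).trans (le_of_eq ?_)))
  · rw [Set.mem_ofPred_eq] at hz
    rw [Set.mem_ofPred_eq]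
    exact ENNReal.ofReal_le_ofReal (Real.exp_le_exp.2 (by nlinarith))
  · rw [← ENNReal.ofReal_div_of_pos (Real.exp_pos _), ← Real.exp_sub, neg_sq]

lemma measure_norm_sq_gt_le (hp : LogSmooth p σ) (hp1 : ∫⁻ x, ENNReal.ofReal (p x) = 1)
    (hh : 0 < h) :
    stateNoise p {z | β < h * ‖z.2‖ ^ 2} ≤ ENNReal.ofReal (Real.exp (d / 2 - β / (4 * h))) := by
  have hpm : Measurable p := hp.diff.continuous.measurable
  have h1 : ∫⁻ z, ENNReal.ofReal (Real.exp (1 / 2 * ‖z.2‖ ^ 2 / 2)) ∂(stateNoise p) ≤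
      ENNReal.ofReal (Real.exp (1 / 2 * d)) := by
    rw [lintegral_stateNoise hpm (by fun_prop), lintegral_prod_symm _ (by fun_prop)]
    simp_rw [lintegral_mul_const _ (show Measurable fun x : Euc d => ENNReal.ofReal (p x) by fun_prop), hp1,
      one_mul]
    exact lintegral_exp_sq_norm_le (by norm_num) (by norm_num)
  have h2 := meas_ge_le_lintegral_div (μ := stateNoise p)
    (f := fun z => ENNReal.ofReal (Real.exp (1 / 2 * ‖z.2‖ ^ 2 / 2))) (by fun_prop)
    (ε := ENNReal.ofReal (Real.exp (β / (4 * h)))) (ENNReal.ofReal_pos.2 (Real.exp_pos _)).ne' ENNReal.ofReal_ne_top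
  refine (measure_mono fun z hz => ?_).trans (h2.trans ((ENNReal.div_le_div_right h1 _).trans (le_of_eq ?_)))
  · rw [Set.mem_ofPred_eq] at hz
    rw [Set.mem_ofPred_eq]
    refine ENNReal.ofReal_le_ofReal (Real.exp_le_exp.2 ?_)
    rw [div_le_iff₀ (by positivity)]
    nlinarith
  · rw [← ENNReal.ofReal_div_of_pos (Real.exp_pos _), ← Real.exp_sub]
    congr 2; ring

lemma log_sub_log_le_scoreStep (hp : LogSmooth p σ) (hσ : 0 < σ) (hh : 0 ≤ h) (hη : η = h * σ ^ 2) (z : Euc d × Euc d) (t : ℝ) :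
    Real.log (p z.1) - Real.log (p (z.1 + (t * √η) • z.2)) ≤
      -(t * scoreStep p η z) + t ^ 2 * (h * ‖z.2‖ ^ 2) / 2 := by
  have hη0 : 0 ≤ η := by rw [hη]; positivity
  have h1 := hp.inner_gradient_le z.1 ((t * √η) • z.2)
  have h2 : t * scoreStep p η z = inner ℝ ((t * √η) • z.2) (gradient (fun y => Real.log (p y)) z.1) := by
    rw [scoreStep, mul_smul, real_inner_smul_left _ _ t]
  have h3 : ‖(t * √η) • z.2‖ ^ 2 / (2 * σ ^ 2) = t ^ 2 * (h * ‖z.2‖ ^ 2) / 2 := by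
    rw [norm_smul, mul_pow, Real.norm_eq_abs, sq_abs, mul_pow, Real.sq_sqrt hη0, hη]
    field_simp
  linarith

/-- The bad set is invariant under reversal of the step, so it has the same mass under the density
at either end. -/
lemma lintegral_compl_goodStep_swap (hp : LogSmooth p σ) (F : ℝ≥0∞) :
    ∫⁻ z, ENNReal.ofReal (p (z.1 + √η • z.2)) * (goodStep p η h β)ᶜ.indicator (fun _ => F) z
      ∂((volume : Measure (Euc d)).prod (stdGaussian (Euc d))) =
    F * stateNoise p (goodStep p η h β)ᶜ := by
  have hpm : Measurable p := hp.diff.continuous.measurable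
  have hG := (measurableSet_goodStep (p := p) (η := η) (h := h) (β := β)).compl
  have hI : Measurable ((goodStep p η h β)ᶜ.indicator fun _ => F) := measurable_const.indicator hG
  rw [← lintegral_indicator_const hG, lintegral_stateNoise hpm hI,
    ← lintegral_volume_prod_swap (√η) (F := fun z => ENNReal.ofReal (p z.1) *
      (goodStep p η h β)ᶜ.indicator (fun _ => F) z) (by fun_prop)]
  refine lintegral_congr fun z => ?_
  simp only
  congr 1
  by_cases hz : z ∈ goodStep p η h β
  · rw [Set.indicator_of_notMem (by simpa using hz),
      Set.indicator_of_notMem (by simpa [swap_mem_goodStep] using hz)]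
  · rw [Set.indicator_of_mem (by simpa using hz),
      Set.indicator_of_mem (by simpa [swap_mem_goodStep] using hz)]

lemma measure_compl_goodStep_le (hp : LogSmooth p σ) (hp1 : ∫⁻ x, ENNReal.ofReal (p x) = 1)
    (hσ : 0 < σ) (hh : 0 < h) (hη : η = h * σ ^ 2) (hβ : 0 ≤ β) {c : ℝ}
    (hc0 : 0 < c) (hc : c ^ 2 * h ≤ 1 / 2) :
    stateNoise p (goodStep p η h β)ᶜ ≤
      ENNReal.ofReal ((1 + Real.exp (2 * β)) * Real.exp (c ^ 2 * h * d - c * β) +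
        Real.exp (d / 2 - β / (4 * h))) := by
  have hpm : Measurable p := hp.diff.continuous.measurable
  have hsub : (goodStep p η h β)ᶜ ⊆ ({z | scoreStep p η z < -β} ∪
      {z | -β ≤ scoreStep p η z ∧ β < scoreStep p η (z.1 + √η • z.2, z.2) ∧ h * ‖z.2‖ ^ 2 ≤ β}) ∪
      {z | β < h * ‖z.2‖ ^ 2} := by
    intro z hz
    by_contra hcon
    simp only [Set.mem_union, Set.mem_ofPred_eq, not_or, not_lt, not_and] at hcon
    refine hz ⟨hcon.1.1, ?_, hcon.2⟩
    by_contra h4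
    exact hcon.1.2 hcon.1.1 (not_le.1 h4) hcon.2
  have hA := measure_scoreStep_lt_le (β := β) hp hp1 hσ hh.le hη hc0 hc
  have hC := measure_norm_sq_gt_le (β := β) hp hp1 hh
  have h1 : Measurable fun z : Euc d × Euc d => scoreStep p η (z.1 + √η • z.2, z.2) :=
    measurable_scoreStep.comp ((measurable_fst.add (measurable_snd.const_smul (√η))).prodMk measurable_snd)
  -- On this event log p(x) - log p(x + √η g) ≤ 2β, so moving the density to the other endpoint
  -- costs a factor e^{2β}. Reversing the step then turns a large derivative at the end into the
  -- lower tail at the start, which is already bounded.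
  have hB : stateNoise p {z | -β ≤ scoreStep p η z ∧ β < scoreStep p η (z.1 + √η • z.2, z.2) ∧
      h * ‖z.2‖ ^ 2 ≤ β} ≤ ENNReal.ofReal (Real.exp (2 * β)) *
        stateNoise p {z | scoreStep p η z < -β} := by
    have hms : MeasurableSet {z : Euc d × Euc d | -β ≤ scoreStep p η z ∧
        β < scoreStep p η (z.1 + √η • z.2, z.2) ∧ h * ‖z.2‖ ^ 2 ≤ β} :=
      (measurableSet_le measurable_const measurable_scoreStep).inter
        ((measurableSet_lt measurable_const h1).inter (measurableSet_le ((measurable_snd.norm.pow_const 2).const_mul h) measurable_const))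
    have hms2 : MeasurableSet {z : Euc d × Euc d | scoreStep p η z < -β} :=
      measurableSet_lt measurable_scoreStep measurable_const
    rw [← lintegral_indicator_one hms, ← lintegral_indicator_const hms2,
      lintegral_stateNoise hpm (measurable_one.indicator hms),
      lintegral_stateNoise hpm (measurable_const.indicator hms2),
      ← lintegral_volume_prod_swap (√η) (F := fun z => ENNReal.ofReal (p z.1) *
        Set.indicator {z | scoreStep p η z < -β} (fun _ => ENNReal.ofReal (Real.exp (2 * β))) z)
        ((by fun_prop : Measurable fun z : Euc d × Euc d => ENNReal.ofReal (p z.1)).mul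
          (measurable_const.indicator hms2))]
    refine lintegral_mono fun z => ?_
    simp only
    by_cases hz : -β ≤ scoreStep p η z ∧ β < scoreStep p η (z.1 + √η • z.2, z.2) ∧ h * ‖z.2‖ ^ 2 ≤ β
    · rw [Set.indicator_of_mem (by exact hz), Set.indicator_of_mem, Pi.one_apply, mul_one,
        ← ENNReal.ofReal_mul (hp.pos _).le]
      · refine ENNReal.ofReal_le_ofReal ?_
        have h2 := log_sub_log_le_scoreStep hp hσ hh.le hη z 1
        rw [one_mul, one_mul, one_pow, one_mul] at h2
        have h3 : Real.log (p z.1) ≤ Real.log (p (z.1 + √η • z.2)) + 2 * β := by linarith [hz.1, hz.2.2]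
        calc p z.1 = Real.exp (Real.log (p z.1)) := (Real.exp_log (hp.pos _)).symm
          _ ≤ Real.exp (Real.log (p (z.1 + √η • z.2)) + 2 * β) := Real.exp_le_exp.2 h3
          _ = _ := by rw [Real.exp_add, Real.exp_log (hp.pos _)]
      · have : scoreStep p η (z.1 + √η • z.2, -z.2) = -scoreStep p η (z.1 + √η • z.2, z.2) := by
          simp [scoreStep]
        rw [Set.mem_ofPred_eq, this]
        linarith [hz.2.1]
    · rw [Set.indicator_of_notMem (by exact hz), mul_zero]
      exact zero_le
  refine (measure_mono hsub).trans ((measure_union_le _ _).trans ((add_le_add (measure_union_le _ _) hC).trans ?_))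
  rw [ENNReal.ofReal_add (by positivity) (by positivity), ENNReal.ofReal_mul (by positivity),
    ENNReal.ofReal_add zero_le_one (by positivity), ENNReal.ofReal_one, add_mul, one_mul]
  gcongr
  exact hB.trans (mul_le_mul_right hA _)

end Step
end

noncomputable section

/-! ### The error of one backward step -/

section StepError

variable {d : ℕ} {p : Euc d → ℝ} {σ η B h τ Pb : ℝ} {s : Euc d → Euc d}

lemma abs_clip_le (hB : 0 ≤ B) (x : ℝ) : |clip B x| ≤ B := by
  unfold clip
  rw [abs_le]
  exact ⟨le_max_left _ _, max_le (by linarith) (min_le_left _ _)⟩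

lemma abs_clip_sub_le {a b : ℝ} (hb : |b| ≤ B) : |clip B a - b| ≤ |a - b| := by
  rw [abs_le] at hb
  have h : b = max (-B) (min B b) := by rw [min_eq_right hb.2, max_eq_right hb.1]
  have h1 : |min B a - min B b| ≤ |a - b| := by
    simpa using abs_min_sub_min_le_max B a B b
  have h2 : |max (-B) (min B a) - max (-B) (min B b)| ≤ |min B a - min B b| := by
    simpa using abs_max_sub_max_le_max (-B) (min B a) (-B) (min B b)
  rw [← h] at h2
  exact h2.trans h1

lemma measurable_clip : Measurable (clip B) := by
  unfold clip; fun_prop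

lemma measurable_stepEst (hs : Measurable s) :
    Measurable fun y : (Euc d × Euc d) × unitInterval => stepEst B s y.1.1 y.1.2 y.2 := by
  unfold stepEst
  refine measurable_clip.comp (Measurable.inner (by fun_prop) (hs.comp (by fun_prop)))

/-- The logarithmic weight of the proposal with seed `z.2` from the state `z.1`. -/
def stepWeight {d : ℕ} (B : ℝ) (s : Euc d → Euc d) (η : ℝ) (z : Euc d × Euc d) : ℝ :=
  meanEst (stepPropose η z.1) (stepEst B s z.1) z.2

lemma measurable_stepWeight (hs : Measurable s) : Measurable (stepWeight B s η) := by
  have : StronglyMeasurable fun y : (Euc d × Euc d) × unitInterval =>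
      stepEst B s y.1.1 (stepPropose η y.1.1 y.1.2) y.2 := by
    refine Measurable.stronglyMeasurable ((measurable_stepEst hs).comp
      (g := fun y : (Euc d × Euc d) × unitInterval => stepEst B s y.1.1 y.1.2 y.2)
      (f := fun y : (Euc d × Euc d) × unitInterval => ((y.1.1, stepPropose η y.1.1 y.1.2), y.2)) ?_)
    unfold stepPropose
    fun_prop
  exact this.integral_prod_right.measurable

lemma abs_stepWeight_le (hB : 0 ≤ B) (z : Euc d × Euc d) : |stepWeight B s η z| ≤ B :=
  abs_meanEst_le (fun _ _ => abs_clip_le hB _) _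

/-- The difference of the logarithmic weights of the sampler and of the exact reverse process, in
terms of the forward step `z`. -/
def weightGap {d : ℕ} (B : ℝ) (s : Euc d → Euc d) (p : Euc d → ℝ) (η : ℝ) (z : Euc d × Euc d) : ℝ :=
  stepWeight B s η (z.1 + √η • z.2, -z.2) + Real.log (p (z.1 + √η • z.2)) - Real.log (p z.1)

lemma measurable_weightGap (hs : Measurable s) (hp : Measurable p) :
    Measurable (weightGap B s p η) := by
  have h1 : Measurable fun z : Euc d × Euc d => stepWeight B s η (z.1 + √η • z.2, -z.2) :=
    (measurable_stepWeight hs).comp (by fun_prop)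
  unfold weightGap
  fun_prop

lemma integral_unitInterval (f : ℝ → ℝ) : ∫ r : unitInterval, f r = ∫ t in (0 : ℝ)..1, f t := by
  rw [intervalIntegral.integral_of_le zero_le_one, ← integral_Icc_eq_integral_Ioc]
  exact integral_subtype_comap measurableSet_Icc f

lemma sq_integral_le_integral_sq {α : Type*} [MeasurableSpace α] {μ : Measure α}
    [IsProbabilityMeasure μ] {f : α → ℝ} {C : ℝ} (hf : Measurable f) (hC : ∀ x, |f x| ≤ C) :
    ENNReal.ofReal ((∫ x, f x ∂μ) ^ 2) ≤ ∫⁻ x, ENNReal.ofReal (f x ^ 2) ∂μ := by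
  have hint : MemLp f 2 μ := MemLp.of_bound hf.aestronglyMeasurable C (ae_of_all _ hC)
  rw [← ofReal_integral_eq_lintegral_ofReal hint.integrable_sq (ae_of_all _ fun x => sq_nonneg _)]
  refine ENNReal.ofReal_le_ofReal ?_
  have h1 := variance_eq_sub hint
  have h2 := variance_nonneg f μ
  simp only [Pi.pow_apply] at h1
  linarith

/-- On a good step the gap of log weights is the integral along the segment of the clipped estimate
minus the true derivative. It is at most 2B in size, so e^u - 1 - u ≤ e^{2B}u². Jensen's inequality
and the fact that clipping is 1-Lipschitz and fixes the true derivative give the squared score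
error. A further factor e^B moves the density to the point where the score is queried. -/
lemma expGap_weightGap_le_of_mem (hp : LogSmooth p σ) (hs : Measurable s) (hσ : 0 < σ) (hB : 0 < B)
    (hh : 0 ≤ h) (hη : η = h * σ ^ 2) {z : Euc d × Euc d} (hz : z ∈ goodStep p η h (B / 2)) :
    ENNReal.ofReal (p z.1) * ENNReal.ofReal (expGap (weightGap B s p η z)) ≤
      ENNReal.ofReal (Real.exp (3 * B)) * ∫⁻ r : unitInterval,
        ENNReal.ofReal (p (z.1 + ((1 - (r : ℝ)) * √η) • z.2)) *
        ENNReal.ofReal ((inner ℝ (√η • z.2) (s (z.1 + ((1 - (r : ℝ)) * √η) • z.2) -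
          gradient (fun y => Real.log (p y)) (z.1 + ((1 - (r : ℝ)) * √η) • z.2))) ^ 2) := by
  obtain ⟨x, g⟩ := z
  obtain ⟨hz1, hz2, hz3⟩ := hz
  simp only at hz1 hz2 hz3 ⊢
  have hη0 : 0 ≤ η := by rw [hη]; positivity
  set v : Euc d := √η • g with hv
  have hsm : ∀ t : ℝ, (t * √η) • g = t • v := fun t => by rw [hv, mul_smul]
  simp only [hsm]
  set S : Euc d → Euc d := gradient (fun y => Real.log (p y)) with hS
  have hSm : Measurable S := measurable_gradient _
  have hvσ : ‖v‖ ^ 2 / σ ^ 2 = h * ‖g‖ ^ 2 := by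
    rw [hv, norm_smul, mul_pow, Real.norm_eq_abs, sq_abs, Real.sq_sqrt hη0, hη]
    field_simp
  -- Monotonicity of the derivative plus t h‖g‖² bounds it by the two one-sided endpoint conditions.
  -- The endpoint and the correction cost B/2 each, which explains the choice β = B/2.
  have hD : ∀ t : ℝ, 0 ≤ t → t ≤ 1 → |inner ℝ v (S (x + t • v))| ≤ B := by
    intro t h0 h1
    have e0 := hp.inner_gradient_mono hσ x v h0
    have e1 := hp.inner_gradient_mono hσ x v h1
    rw [hvσ, zero_smul, add_zero] at e0
    rw [hvσ, one_smul] at e1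
    change -(B / 2) ≤ inner ℝ v (S x) at hz1
    change inner ℝ v (S (x + v)) ≤ B / 2 at hz2
    change inner ℝ v (S x) + _ ≤ inner ℝ v (S (x + t • v)) + _ at e0
    change inner ℝ v (S (x + t • v)) + _ ≤ inner ℝ v (S (x + v)) + _ at e1
    have hq : 0 ≤ h * ‖g‖ ^ 2 := by positivity
    rw [abs_le]
    constructor <;> nlinarith
  -- the weight of the sampler and the weight of the reverse process as integrals
  set f : unitInterval → ℝ := fun r => clip B (inner ℝ (-v) (s (x + (1 - (r : ℝ)) • v))) -
    inner ℝ (-v) (S (x + (1 - (r : ℝ)) • v)) with hf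
  have hb : ∀ r : unitInterval, |inner ℝ (-v) (S (x + (1 - (r : ℝ)) • v))| ≤ B := fun r => by
    rw [inner_neg_left, abs_neg]
    exact hD _ (by linarith [r.2.2]) (by linarith [r.2.1])
  have hm1 : Measurable fun r : unitInterval => clip B (inner ℝ (-v) (s (x + (1 - (r : ℝ)) • v))) :=
    measurable_clip.comp (Measurable.inner measurable_const (hs.comp (by fun_prop)))
  have hm2 : Measurable fun r : unitInterval => (inner ℝ (-v) (S (x + (1 - (r : ℝ)) • v)) : ℝ) :=
    Measurable.inner measurable_const (hSm.comp (by fun_prop))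
  have hi1 : Integrable (fun r : unitInterval => clip B (inner ℝ (-v) (s (x + (1 - (r : ℝ)) • v)))) :=
    Integrable.of_bound hm1.aestronglyMeasurable B (ae_of_all _ fun r => abs_clip_le hB.le _)
  have hi2 : Integrable (fun r : unitInterval => (inner ℝ (-v) (S (x + (1 - (r : ℝ)) • v)) : ℝ)) :=
    Integrable.of_bound hm2.aestronglyMeasurable B (ae_of_all _ hb)
  have hU : weightGap B s p η (x, g) = ∫ r, f r := by
    rw [hf, integral_sub hi1 hi2]
    have e1 : stepWeight B s η (x + v, -g) =
        ∫ r : unitInterval, clip B (inner ℝ (-v) (s (x + (1 - (r : ℝ)) • v))) := by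
      refine integral_congr_ae (ae_of_all _ fun r => ?_)
      simp only [stepPropose, stepEst, smul_neg, ← hv]
      congr 2
      · module
      · congr 1; module
    have e2 : ∫ r : unitInterval, (inner ℝ (-v) (S (x + (1 - (r : ℝ)) • v)) : ℝ) =
        Real.log (p x) - Real.log (p (x + v)) := by
      rw [integral_unitInterval (fun t => (inner ℝ (-v) (S (x + (1 - t) • v)) : ℝ)),
        intervalIntegral.integral_comp_sub_left (fun t => (inner ℝ (-v) (S (x + t • v)) : ℝ))]
      simp only [inner_neg_left, sub_self, sub_zero, intervalIntegral.integral_neg]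
      rw [← hp.log_sub_log_eq_integral hσ x v]
      ring
    rw [weightGap]
    simp only [← hv]
    rw [e1, e2]
    ring
  have hfb : ∀ r, |f r| ≤ 2 * B := fun r => by
    refine (abs_sub _ _).trans ?_
    linarith [hb r, abs_clip_le hB.le (inner ℝ (-v) (s (x + (1 - (r : ℝ)) • v)))]
  have hUb : |weightGap B s p η (x, g)| ≤ 2 * B := by
    rw [hU]
    have := norm_integral_le_of_norm_le_const (μ := (volume : Measure unitInterval)) (f := f)
      (C := 2 * B) (ae_of_all _ hfb)
    simpa using this
  have hgap : ENNReal.ofReal (expGap (weightGap B s p η (x, g))) ≤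
      ENNReal.ofReal (Real.exp (2 * B)) * ∫⁻ r, ENNReal.ofReal (f r ^ 2) := by
    refine (ENNReal.ofReal_le_ofReal (expGap_le_sq hUb)).trans ?_
    rw [ENNReal.ofReal_mul (Real.exp_pos _).le, hU]
    gcongr
    exact sq_integral_le_integral_sq (hm1.sub hm2) hfb
  have hratio : ∀ r : unitInterval, p x ≤ Real.exp B * p (x + (1 - (r : ℝ)) • v) := by
    intro r
    have h1 := log_sub_log_le_scoreStep hp hσ hh hη (x, g) (1 - (r : ℝ))
    simp only [hsm] at h1
    have h0 := r.2.1
    have h1' := r.2.2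
    have hq : 0 ≤ h * ‖g‖ ^ 2 := by positivity
    have h2 : Real.log (p x) ≤ B + Real.log (p (x + (1 - (r : ℝ)) • v)) := by
      have : (1 - (r : ℝ)) ^ 2 * (h * ‖g‖ ^ 2) ≤ h * ‖g‖ ^ 2 :=
        mul_le_of_le_one_left hq (by nlinarith)
      nlinarith
    calc p x = Real.exp (Real.log (p x)) := (Real.exp_log (hp.pos _)).symm
      _ ≤ _ := Real.exp_le_exp.2 h2
      _ = _ := by rw [Real.exp_add, Real.exp_log (hp.pos _)]
  refine (mul_le_mul_right hgap _).trans ?_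
  rw [← mul_assoc, mul_comm (ENNReal.ofReal (p x)), mul_assoc,
    show 3 * B = 2 * B + B by ring, Real.exp_add, ENNReal.ofReal_mul (Real.exp_pos _).le, mul_assoc]
  refine mul_le_mul_right ?_ _
  have hpm : Measurable p := hp.diff.continuous.measurable
  have hm3 : Measurable fun r : unitInterval => ENNReal.ofReal (p (x + (1 - (r : ℝ)) • v)) *
        ENNReal.ofReal ((inner ℝ v (s (x + (1 - (r : ℝ)) • v) - S (x + (1 - (r : ℝ)) • v))) ^ 2) := by
    have h4 : Measurable fun r : unitInterval => (x + (1 - (r : ℝ)) • v) := by fun_prop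
    refine (ENNReal.measurable_ofReal.comp (hpm.comp h4)).mul (ENNReal.measurable_ofReal.comp ?_)
    exact (Measurable.inner measurable_const ((hs.comp h4).sub (hSm.comp h4))).pow_const 2
  have hfm : Measurable fun r => ENNReal.ofReal (f r ^ 2) := ((hm1.sub hm2).pow_const 2).ennreal_ofReal
  rw [← lintegral_const_mul _ hfm, ← lintegral_const_mul _ hm3]
  refine lintegral_mono fun r => ?_
  rw [← mul_assoc, ← ENNReal.ofReal_mul (Real.exp_pos _).le]
  refine mul_le_mul' (ENNReal.ofReal_le_ofReal (hratio r)) (ENNReal.ofReal_le_ofReal ?_)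
  refine sq_le_sq.2 ((abs_clip_sub_le (hb r)).trans (le_of_eq ?_))
  rw [← inner_sub_right, inner_neg_left, abs_neg]

/-- For fixed r and g, translation invariance replaces the point of the segment by x, which
decouples it from g. Then E⟨√η g, e⟩² = η‖e‖² gives the score error without a factor d. -/
lemma lintegral_goodStep_le (hp : LogSmooth p σ) (hs : Measurable s) (hσ : 0 < σ) (hB : 0 < B)
    (hh : 0 ≤ h) (hη : η = h * σ ^ 2) :
    ∫⁻ z in goodStep p η h (B / 2), ENNReal.ofReal (expGap (weightGap B s p η z)) ∂(stateNoise p) ≤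
      ENNReal.ofReal (Real.exp (3 * B)) * (ENNReal.ofReal η *
        ∫⁻ x, ENNReal.ofReal (p x) * ‖s x - gradient (fun y => Real.log (p y)) x‖ₑ ^ 2) := by
  have hpm : Measurable p := hp.diff.continuous.measurable
  have hη0 : 0 ≤ η := by rw [hη]; positivity
  have hG := measurableSet_goodStep (p := p) (η := η) (h := h) (β := B / 2)
  have hWm := measurable_weightGap (B := B) (η := η) hs hpm
  have hSm : Measurable (gradient (fun y => Real.log (p y))) := measurable_gradient _
  have hem : Measurable fun x => s x - gradient (fun y => Real.log (p y)) x := hs.sub hSm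
  rw [← lintegral_indicator hG, lintegral_stateNoise hpm (Measurable.indicator (by fun_prop) hG)]
  set Φ : Euc d × Euc d → ℝ≥0∞ := fun z => ENNReal.ofReal (p z.1) *
    ENNReal.ofReal ((inner ℝ (√η • z.2) (s z.1 - gradient (fun y => Real.log (p y)) z.1)) ^ 2) with hΦ
  have hΦm : Measurable Φ := by
    refine (hpm.comp measurable_fst).ennreal_ofReal.mul (Measurable.ennreal_ofReal ?_)
    exact (Measurable.inner (by fun_prop) (hem.comp measurable_fst)).pow_const 2
  have hΦm2 : Measurable fun y : (Euc d × Euc d) × unitInterval =>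
      Φ (y.1.1 + ((1 - (y.2 : ℝ)) * √η) • y.1.2, y.1.2) := hΦm.comp (by fun_prop)
  calc ∫⁻ z, ENNReal.ofReal (p z.1) * (goodStep p η h (B / 2)).indicator
          (fun z => ENNReal.ofReal (expGap (weightGap B s p η z))) z
          ∂((volume : Measure (Euc d)).prod (stdGaussian (Euc d)))
      ≤ ∫⁻ z, ENNReal.ofReal (Real.exp (3 * B)) * (∫⁻ r : unitInterval,
          Φ (z.1 + ((1 - (r : ℝ)) * √η) • z.2, z.2))
          ∂((volume : Measure (Euc d)).prod (stdGaussian (Euc d))) := by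
        refine lintegral_mono fun z => ?_
        by_cases hz : z ∈ goodStep p η h (B / 2)
        · rw [Set.indicator_of_mem hz]
          exact expGap_weightGap_le_of_mem hp hs hσ hB hh hη hz
        · rw [Set.indicator_of_notMem hz, mul_zero]
          exact zero_le
    _ = ENNReal.ofReal (Real.exp (3 * B)) * ∫⁻ r : unitInterval, (∫⁻ z,
          Φ (z.1 + ((1 - (r : ℝ)) * √η) • z.2, z.2)
          ∂((volume : Measure (Euc d)).prod (stdGaussian (Euc d)))) := by
        rw [lintegral_const_mul _ (Measurable.lintegral_prod_right hΦm2),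
          lintegral_lintegral_swap hΦm2.aemeasurable]
    _ = ENNReal.ofReal (Real.exp (3 * B)) *
          ∫⁻ z, Φ z ∂((volume : Measure (Euc d)).prod (stdGaussian (Euc d))) := by
        simp_rw [lintegral_volume_prod_shift _ hΦm]
        simp
    _ = _ := by
        congr 1
        rw [lintegral_prod _ hΦm.aemeasurable, ← lintegral_const_mul _ (by fun_prop)]
        refine lintegral_congr fun x => ?_
        simp only [hΦ]
        have hin : Measurable fun g : Euc d => ENNReal.ofReal
            ((inner ℝ g (s x - gradient (fun y => Real.log (p y)) x)) ^ 2) := by fun_prop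
        have e : ∀ g : Euc d, ENNReal.ofReal
            ((inner ℝ (√η • g) (s x - gradient (fun y => Real.log (p y)) x)) ^ 2) =
            ENNReal.ofReal η * ENNReal.ofReal
            ((inner ℝ g (s x - gradient (fun y => Real.log (p y)) x)) ^ 2) := by
          intro g
          rw [real_inner_smul_left, mul_pow, Real.sq_sqrt hη0, ENNReal.ofReal_mul hη0]
        simp_rw [e]
        rw [lintegral_const_mul _ (hin.const_mul _), lintegral_const_mul _ hin,
          lintegral_inner_sq_stdGaussian]
        ring

lemma expGap_le_exp_add (u : ℝ) : expGap u ≤ Real.exp u + max (-u) 0 := by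
  unfold expGap
  have := le_max_left (-u) 0
  linarith

lemma sq_le_two_mul_exp {x : ℝ} (hx : 0 ≤ x) : x ^ 2 ≤ 2 * Real.exp x := by
  have := Real.quadratic_le_exp_of_nonneg hx
  nlinarith

/-- Use e^u - 1 - u ≤ e^u + max(-u, 0). The first term is at most e^B times the density ratio
between the endpoints, whose integral over the bad set is the bad probability by reversal. The
second is at most X = B + |derivative| + h‖g‖²/2, and X ≤ τX² + 1/τ stands in for the Cauchy–Schwarz
inequality, with E X² bounded through exponential moments. -/
lemma lintegral_compl_goodStep_le (hp : LogSmooth p σ) (hp1 : ∫⁻ x, ENNReal.ofReal (p x) = 1)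
    (hσ : 0 < σ) (hB : 0 < B)
    (hh : 0 ≤ h) (hη : η = h * σ ^ 2) (hh2 : h ≤ 1 / 2) (hhd : h * d ≤ 1) (hτ : 0 < τ) (hPb : 0 ≤ Pb)
    (hP : stateNoise p (goodStep p η h (B / 2))ᶜ ≤ ENNReal.ofReal Pb) :
    ∫⁻ z in (goodStep p η h (B / 2))ᶜ, ENNReal.ofReal (expGap (weightGap B s p η z)) ∂(stateNoise p) ≤
      ENNReal.ofReal (Real.exp B * Pb + (τ * (6 * (B ^ 2 + 3 * Real.exp 1)) + Pb / τ)) := by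
  have hpm : Measurable p := hp.diff.continuous.measurable
  have hG := (measurableSet_goodStep (p := p) (η := η) (h := h) (β := B / 2)).compl
  have := isProbabilityMeasure_stateNoise hp1
  set X : Euc d × Euc d → ℝ := fun z => B + |scoreStep p η z| + h * ‖z.2‖ ^ 2 / 2 with hX
  have hX0 : ∀ z, 0 ≤ X z := fun z => by
    have : 0 ≤ h * ‖z.2‖ ^ 2 := by positivity
    have := abs_nonneg (scoreStep p η z)
    simp only [hX]; linarith
  have hXm : Measurable X := by
    have := (measurable_scoreStep (p := p) (η := η)).abs
    fun_prop
  have hpt : ∀ z, ENNReal.ofReal (expGap (weightGap B s p η z)) ≤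
      ENNReal.ofReal (Real.exp B * (p (z.1 + √η • z.2) / p z.1)) +
      (ENNReal.ofReal (τ * X z ^ 2) + ENNReal.ofReal (1 / τ)) := by
    intro z
    have hp0 := hp.pos z.1
    have hp2 := hp.pos (z.1 + √η • z.2)
    have hW := abs_le.1 (abs_stepWeight_le (s := s) (η := η) hB.le (z.1 + √η • z.2, -z.2))
    rw [← ENNReal.ofReal_add (by positivity) (by positivity),
      ← ENNReal.ofReal_add (by positivity) (by positivity)]
    refine ENNReal.ofReal_le_ofReal ((expGap_le_exp_add _).trans (add_le_add ?_ ?_))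
    · rw [weightGap, add_sub_assoc, Real.exp_add, Real.exp_sub, Real.exp_log hp2, Real.exp_log hp0]
      exact mul_le_mul_of_nonneg_right (Real.exp_le_exp.2 hW.2) (by positivity)
    · have h1 : max (-weightGap B s p η z) 0 ≤ X z := by
        refine max_le ?_ (hX0 z)
        have h2 := log_sub_log_le_scoreStep hp hσ hh hη z 1
        rw [one_mul, one_mul, one_pow, one_mul] at h2
        simp only [weightGap, hX]
        linarith [neg_le_abs (scoreStep p η z)]
      have h3 : X z ≤ τ * X z ^ 2 + 1 / τ := by
        have : τ * X z ^ 2 + 1 / τ - X z = ((2 * τ * X z - 1) ^ 2 + 3) / (4 * τ) := by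
          field_simp; ring
        have h4 : 0 ≤ ((2 * τ * X z - 1) ^ 2 + 3) / (4 * τ) := by positivity
        linarith
      exact h1.trans h3
  have hX2 : ∫⁻ z, ENNReal.ofReal (τ * X z ^ 2) ∂(stateNoise p) ≤
      ENNReal.ofReal (τ * (6 * (B ^ 2 + 3 * Real.exp 1))) := by
    have hle : ∀ z, ENNReal.ofReal (τ * X z ^ 2) ≤ ENNReal.ofReal (τ * 6) * (ENNReal.ofReal (B ^ 2) +
        (ENNReal.ofReal (Real.exp (1 * scoreStep p η z)) + ENNReal.ofReal (Real.exp (-1 * scoreStep p η z)) +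
        ENNReal.ofReal (Real.exp (h * ‖z.2‖ ^ 2 / 2)))) := by
      intro z
      rw [← ENNReal.ofReal_add (by positivity) (by positivity),
        ← ENNReal.ofReal_add (by positivity) (by positivity),
        ← ENNReal.ofReal_add (by positivity) (by positivity), ← ENNReal.ofReal_mul (by positivity), mul_assoc]
      refine ENNReal.ofReal_le_ofReal (mul_le_mul_of_nonneg_left ?_ hτ.le)
      have h1 := sq_le_two_mul_exp (abs_nonneg (scoreStep p η z))
      have h2 := sq_le_two_mul_exp (show 0 ≤ h * ‖z.2‖ ^ 2 / 2 by positivity)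
      have h3 : Real.exp |scoreStep p η z| ≤
          Real.exp (1 * scoreStep p η z) + Real.exp (-1 * scoreStep p η z) := by
        rcases abs_cases (scoreStep p η z) with ⟨h, _⟩ | ⟨h, _⟩
        · rw [h, one_mul]; linarith [Real.exp_pos (-1 * scoreStep p η z)]
        · rw [h, neg_one_mul]; linarith [Real.exp_pos (1 * scoreStep p η z)]
      simp only [hX]
      set a := |scoreStep p η z|
      set b := h * ‖z.2‖ ^ 2 / 2
      nlinarith [sq_nonneg (B - a), sq_nonneg (B - b), sq_nonneg (a - b), sq_nonneg B]
    have e1 := lintegral_exp_scoreStep_le hp hp1 hσ hh hη (c := 1) (by linarith)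
    have e2 := lintegral_exp_scoreStep_le hp hp1 hσ hh hη (c := -1) (by linarith)
    have e3 : ∫⁻ z, ENNReal.ofReal (Real.exp (h * ‖z.2‖ ^ 2 / 2)) ∂(stateNoise p) ≤
        ENNReal.ofReal (Real.exp (h * d)) := by
      rw [lintegral_stateNoise hpm (by fun_prop), lintegral_prod_symm _ (by fun_prop)]
      simp_rw [lintegral_mul_const _ (show Measurable fun x : Euc d => ENNReal.ofReal (p x) by fun_prop), hp1,
        one_mul]
      exact lintegral_exp_sq_norm_le hh hh2
    refine (lintegral_mono hle).trans ?_
    rw [lintegral_const_mul _ (by fun_prop), lintegral_add_left (by fun_prop),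
      lintegral_add_left (by fun_prop), lintegral_add_left (by fun_prop), lintegral_const, measure_univ,
      mul_one]
    have hE : ENNReal.ofReal (Real.exp (h * d)) ≤ ENNReal.ofReal (Real.exp 1) :=
      ENNReal.ofReal_le_ofReal (Real.exp_le_exp.2 hhd)
    rw [one_pow, one_mul] at e1
    rw [neg_one_sq, one_mul] at e2
    rw [← mul_assoc, ENNReal.ofReal_mul (q := B ^ 2 + 3 * Real.exp 1) (by positivity),
      ENNReal.ofReal_add (by positivity) (by positivity)]
    refine mul_le_mul_right (add_le_add_right ?_ _) _
    rw [show 3 * Real.exp 1 = Real.exp 1 + Real.exp 1 + Real.exp 1 by ring,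
      ENNReal.ofReal_add (by positivity) (by positivity), ENNReal.ofReal_add (by positivity) (by positivity)]
    exact add_le_add (add_le_add (e1.trans hE) (e2.trans hE)) (e3.trans hE)
  have hexp : ∫⁻ z in (goodStep p η h (B / 2))ᶜ, ENNReal.ofReal (Real.exp B * (p (z.1 + √η • z.2) / p z.1))
      ∂(stateNoise p) = ENNReal.ofReal (Real.exp B) * stateNoise p (goodStep p η h (B / 2))ᶜ := by
    rw [← lintegral_compl_goodStep_swap hp, ← lintegral_indicator hG,
      lintegral_stateNoise hpm (Measurable.indicator (by fun_prop) hG)]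
    refine lintegral_congr fun z => ?_
    by_cases hz : z ∈ (goodStep p η h (B / 2))ᶜ
    · rw [Set.indicator_of_mem hz, Set.indicator_of_mem hz, ← ENNReal.ofReal_mul (hp.pos _).le,
        ← ENNReal.ofReal_mul (hp.pos _).le]
      congr 1
      have := hp.pos z.1
      field_simp
    · rw [Set.indicator_of_notMem hz, Set.indicator_of_notMem hz, mul_zero, mul_zero]
  refine (lintegral_mono hpt).trans ?_
  rw [lintegral_add_left (by fun_prop), lintegral_add_left (by fun_prop), hexp, setLIntegral_const,
    ENNReal.ofReal_add (by positivity) (by positivity), ENNReal.ofReal_add (by positivity) (by positivity),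
    ENNReal.ofReal_mul (Real.exp_pos _).le]
  refine add_le_add (mul_le_mul_right hP _) (add_le_add ((setLIntegral_le_lintegral _ _).trans hX2) ?_)
  refine (mul_le_mul_right hP _).trans (le_of_eq ?_)
  rw [← ENNReal.ofReal_mul (by positivity)]
  congr 1; ring

/-- The relative entropy of one step of the exact reverse process with respect to the unnormalised
step of the sampler. -/
lemma klDiv_step_le (hp : LogSmooth p σ) (hp1 : ∫⁻ x, ENNReal.ofReal (p x) = 1)
    (hs : Measurable s) (hσ : 0 < σ) (hB : 0 < B)
    (hh : 0 ≤ h) (hη : η = h * σ ^ 2) (hh2 : h ≤ 1 / 2) (hhd : h * d ≤ 1) (hτ : 0 < τ) (hPb : 0 ≤ Pb)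
    (hP : stateNoise p (goodStep p η h (B / 2))ᶜ ≤ ENNReal.ofReal Pb) :
    klDiv (((volume : Measure (Euc d)).prod (stdGaussian (Euc d))).withDensity
        fun z => ENNReal.ofReal (p (z.1 + √η • z.2)))
      (((volume : Measure (Euc d)).prod (stdGaussian (Euc d))).withDensity
        fun z => ENNReal.ofReal (p z.1 * Real.exp (stepWeight B s η z))) ≤
      ENNReal.ofReal (Real.exp (3 * B)) * (ENNReal.ofReal η *
        ∫⁻ x, ENNReal.ofReal (p x) * ‖s x - gradient (fun y => Real.log (p y)) x‖ₑ ^ 2) +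
      ENNReal.ofReal (Real.exp B * Pb + (τ * (6 * (B ^ 2 + 3 * Real.exp 1)) + Pb / τ)) := by
  have hpm : Measurable p := hp.diff.continuous.measurable
  have hWm := measurable_stepWeight (B := B) (η := η) hs
  have hGm := measurable_weightGap (B := B) (η := η) hs hpm
  have h1 : ∫⁻ z, ENNReal.ofReal (p z.1) ∂((volume : Measure (Euc d)).prod (stdGaussian (Euc d))) = 1 := by
    rw [lintegral_prod _ (by fun_prop)]
    simpa using hp1
  rw [klDiv_withDensity _ (by fun_prop) (by fun_prop) (fun _ => hp.pos _)
    (fun _ => mul_pos (hp.pos _) (Real.exp_pos _))]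
  · have hF : Measurable fun z : Euc d × Euc d => ENNReal.ofReal (p (z.1 + √η • z.2)) *
        ENNReal.ofReal (expGap (Real.log (p z.1 * Real.exp (stepWeight B s η z)) -
          Real.log (p (z.1 + √η • z.2)))) := by fun_prop
    rw [← lintegral_volume_prod_swap (√η) hF]
    have e : ∫⁻ z, ENNReal.ofReal (expGap (weightGap B s p η z)) ∂(stateNoise p) =
        ∫⁻ z, ENNReal.ofReal (p z.1) * ENNReal.ofReal (expGap (weightGap B s p η z))
          ∂((volume : Measure (Euc d)).prod (stdGaussian (Euc d))) :=
      lintegral_stateNoise hpm (by fun_prop)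
    refine le_trans (le_of_eq ?_) (add_le_add (lintegral_goodStep_le hp hs hσ hB hh hη)
      (lintegral_compl_goodStep_le (s := s) hp hp1 hσ hB hh hη hh2 hhd hτ hPb hP))
    rw [lintegral_add_compl _ measurableSet_goodStep, e]
    refine lintegral_congr fun z => ?_
    simp only [smul_neg, add_neg_cancel_right]
    rw [Real.log_mul (hp.pos _).ne' (Real.exp_pos _).ne', Real.log_exp, weightGap]
    congr 3; ring
  · have := lintegral_volume_prod_shift (d := d) (√η) (F := fun z => ENNReal.ofReal (p z.1)) (by fun_prop)
    simp only at this
    rw [this, h1]; exact ENNReal.one_ne_top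
  · refine ne_top_of_le_ne_top (b := ENNReal.ofReal (Real.exp B)) ENNReal.ofReal_ne_top ?_
    calc ∫⁻ z, ENNReal.ofReal (p z.1 * Real.exp (stepWeight B s η z))
          ∂((volume : Measure (Euc d)).prod (stdGaussian (Euc d)))
        ≤ ∫⁻ z, ENNReal.ofReal (p z.1) * ENNReal.ofReal (Real.exp B)
          ∂((volume : Measure (Euc d)).prod (stdGaussian (Euc d))) := by
          refine lintegral_mono fun z => ?_
          rw [ENNReal.ofReal_mul (hp.pos _).le]
          gcongr
          exact (abs_le.1 (abs_stepWeight_le hB.le z)).2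
      _ = ENNReal.ofReal (Real.exp B) := by
          rw [lintegral_mul_const _ (by fun_prop), h1, one_mul]

end StepError
end

noncomputable section

/-! ### The chain of backward steps -/

section Chain

variable {d : ℕ} {B : ℝ}

lemma measurable_sInf_nat {α : Type*} [MeasurableSpace α] {S : ℕ → Set α}
    (hS : ∀ i, MeasurableSet (S i)) : Measurable fun a => sInf {i | a ∈ S i} := by
  refine measurable_to_countable' fun n => ?_
  -- The second set accounts for `sInf ∅ = 0`, the value when no round accepts.
  have : (fun a => sInf {i | a ∈ S i}) ⁻¹' {n} =
      (S n ∩ ⋂ i ∈ Finset.range n, (S i)ᶜ) ∪ ({_a | n = 0} ∩ ⋂ i, (S i)ᶜ) := by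
    ext a
    simp only [Set.mem_preimage, Set.mem_singleton_iff, Set.mem_union, Set.mem_inter_iff,
      Set.mem_iInter, Finset.mem_range, Set.mem_compl_iff, Set.mem_ofPred_eq]
    constructor
    · rintro rfl
      rcases Set.eq_empty_or_nonempty {i | a ∈ S i} with h | h
      · right
        rw [h, Nat.sInf_empty]
        exact ⟨rfl, fun i hi => (Set.ext_iff.1 h i).1 hi⟩
      · left
        exact ⟨Nat.sInf_mem h, fun i hi => Nat.notMem_of_lt_sInf hi⟩
    · rintro (⟨h1, h2⟩ | ⟨rfl, h2⟩)
      · have hne : {i | a ∈ S i}.Nonempty := ⟨n, h1⟩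
        refine le_antisymm (Nat.sInf_le h1) (not_lt.1 fun hlt => h2 _ hlt (Nat.sInf_mem hne))
      · have : {i | a ∈ S i} = ∅ := by ext i; simpa using h2 i
        rw [this, Nat.sInf_empty]
  rw [this]
  refine ((hS n).inter (Finset.measurableSet_biInter _ fun i _ => (hS i).compl)).union
    ((MeasurableSet.const _).inter (MeasurableSet.iInter fun i => (hS i).compl))

variable {s : Euc d → Euc d} {η α : ℝ}

lemma measurable_stepStop (hs : Measurable s) :
    Measurable fun z : Euc d × (ℕ → RoundNoise d) =>
      forsStop B (stepPropose η (α⁻¹ • z.1)) (stepEst B s (α⁻¹ • z.1)) z.2 := by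
  unfold forsStop
  refine measurable_sInf_nat (S := fun i => {z : Euc d × (ℕ → RoundNoise d) |
    roundAccepts B (stepPropose η (α⁻¹ • z.1)) (stepEst B s (α⁻¹ • z.1)) (z.2 i)}) fun i => ?_
  refine measurableSet_roundAccepts (φ := fun z : Euc d × (ℕ → RoundNoise d) => z.2 i) (by fun_prop)
    (w := fun z r => stepEst B s (α⁻¹ • z.1) (stepPropose η (α⁻¹ • z.1) (z.2 i).1) r) ?_
  refine (measurable_stepEst hs).comp
    (g := fun y : (Euc d × Euc d) × unitInterval => stepEst B s y.1.1 y.1.2 y.2)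
    (f := fun y : (Euc d × (ℕ → RoundNoise d)) × unitInterval =>
      ((α⁻¹ • y.1.1, stepPropose η (α⁻¹ • y.1.1) (y.1.2 i).1), y.2)) ?_
  unfold stepPropose
  fun_prop

lemma measurable_stepOutput (hs : Measurable s) :
    Measurable fun z : Euc d × (ℕ → RoundNoise d) =>
      forsOutput B (stepPropose η (α⁻¹ • z.1)) (stepEst B s (α⁻¹ • z.1)) z.2 := by
  have h : Measurable fun y : (Euc d × (ℕ → RoundNoise d)) × ℕ =>
      stepPropose η (α⁻¹ • y.1.1) (y.1.2 y.2).1 := by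
    refine measurable_from_prod_countable_left fun n => ?_
    change Measurable fun x : Euc d × (ℕ → RoundNoise d) => α⁻¹ • x.1 + √η • (x.2 n).1
    fun_prop
  exact h.comp (measurable_id.prodMk (measurable_stepStop hs))

lemma measurable_stepCount (hs : Measurable s) :
    Measurable fun z : Euc d × (ℕ → RoundNoise d) =>
      forsCount B (stepPropose η (α⁻¹ • z.1)) (stepEst B s (α⁻¹ • z.1)) z.2 := by
  have h : Measurable fun y : (Euc d × (ℕ → RoundNoise d)) × ℕ =>
      ∑ i ∈ Finset.range (y.2 + 1), (y.1.2 i).2.1 := by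
    refine measurable_from_prod_countable_left fun n => ?_
    refine Finset.measurable_fun_sum (f := fun i (x : Euc d × (ℕ → RoundNoise d)) => (x.2 i).2.1)
      (Finset.range (n + 1)) fun i _ => ?_
    fun_prop
  exact h.comp (measurable_id.prodMk (measurable_stepStop hs))

lemma measurable_backwardStep {s : ℕ → Euc d → Euc d} (hs : ∀ t, Measurable (s t)) (σ : ℕ → ℝ) (t : ℕ) :
    Measurable fun z : (Euc d × ℕ) × (ℕ → RoundNoise d) => backwardStep B s σ t z.1 z.2 := by
  have hf : Measurable fun z : (Euc d × ℕ) × (ℕ → RoundNoise d) => (z.1.1, z.2) :=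
    measurable_fst.fst.prodMk measurable_snd
  have h1 := (measurable_stepOutput (η := vpEta σ t) (α := vpAlpha σ t) (B := B) (hs t)).comp hf
  have h2 := (measurable_stepCount (η := vpEta σ t) (α := vpAlpha σ t) (B := B) (hs t)).comp hf
  exact h1.prodMk (measurable_fst.snd.add h2)

/-- The transition kernel of one backward step. -/
def stepKernel (B : ℝ) (s : Euc d → Euc d) (η α : ℝ) : Kernel (Euc d) (Euc d) :=
  ((Kernel.id ×ₖ Kernel.const (Euc d) (forsNoise d B))).map (fun z : Euc d × (ℕ → RoundNoise d) =>
    forsOutput B (stepPropose η (α⁻¹ • z.1)) (stepEst B s (α⁻¹ • z.1)) z.2)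

lemma isMarkovKernel_stepKernel (hs : Measurable s) : IsMarkovKernel (stepKernel B s η α) :=
  Kernel.IsMarkovKernel.map _ (measurable_stepOutput hs)

lemma lintegral_stepKernel (hs : Measurable s) (x : Euc d) {f : Euc d → ℝ≥0∞} (hf : Measurable f) :
    ∫⁻ y, f y ∂(stepKernel B s η α x) =
      ∫⁻ ω, f (forsOutput B (stepPropose η (α⁻¹ • x)) (stepEst B s (α⁻¹ • x)) ω) ∂(forsNoise d B) := by
  have hm := measurable_stepOutput (B := B) (η := η) (α := α) hs
  have hfm : Measurable fun z : Euc d × (ℕ → RoundNoise d) =>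
      f (forsOutput B (stepPropose η (α⁻¹ • z.1)) (stepEst B s (α⁻¹ • z.1)) z.2) := hf.comp hm
  rw [stepKernel, Kernel.map_apply _ hm, lintegral_map hf hm, Kernel.prod_apply, Kernel.id_apply,
    Kernel.const_apply, lintegral_prod _ hfm.aemeasurable, lintegral_dirac' _ hfm.lintegral_prod_right]

/-- The law of the state after `k` backward steps. -/
def backwardState (B : ℝ) (s : ℕ → Euc d → Euc d) (σ : ℕ → ℝ) (T : ℕ) (init : Measure (Euc d)) (k : ℕ) :
    Measure (Euc d) := (backwardLaw B s σ T init k).map Prod.fst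

variable {S : ℕ → Euc d → Euc d} {σ : ℕ → ℝ} {T : ℕ} {init : Measure (Euc d)}

lemma isProbabilityMeasure_backwardLaw [IsProbabilityMeasure init] (hS : ∀ t, Measurable (S t)) (k : ℕ) :
    IsProbabilityMeasure (backwardLaw B S σ T init k) := by
  induction k with
  | zero => exact Measure.isProbabilityMeasure_map (by fun_prop)
  | succ k ih => exact Measure.isProbabilityMeasure_map (measurable_backwardStep hS σ _).aemeasurable

lemma backwardState_zero : backwardState B S σ T init 0 = init := by
  rw [backwardState, backwardLaw, Measure.map_map (by fun_prop) (by fun_prop)]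
  exact Measure.map_id

lemma backwardState_succ [IsProbabilityMeasure init] (hS : ∀ t, Measurable (S t)) (k : ℕ) :
    backwardState B S σ T init (k + 1) =
      (backwardState B S σ T init k ⊗ₘ stepKernel B (S (T - (k + 1))) (vpEta σ (T - (k + 1)))
        (vpAlpha σ (T - (k + 1)))).map Prod.snd := by
  have := isProbabilityMeasure_backwardLaw (B := B) (σ := σ) (T := T) (init := init) hS k
  have : IsProbabilityMeasure (backwardState B S σ T init k) :=
    Measure.isProbabilityMeasure_map (by fun_prop)
  have hm := measurable_backwardStep (B := B) hS σ (T - (k + 1))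
  refine Measure.ext_of_lintegral _ fun f hf => ?_
  have hmo := measurable_stepOutput (η := vpEta σ (T - (k + 1))) (α := vpAlpha σ (T - (k + 1)))
    (B := B) (hS (T - (k + 1)))
  have := isMarkovKernel_stepKernel (B := B) (η := vpEta σ (T - (k + 1))) (α := vpAlpha σ (T - (k + 1)))
    (hS (T - (k + 1)))
  have hf2 : Measurable fun z : Euc d × Euc d => f z.2 := hf.comp measurable_snd
  have hf1 : Measurable fun z : Euc d × ℕ => f z.1 := hf.comp measurable_fst
  have hfb : Measurable fun z : (Euc d × ℕ) × (ℕ → RoundNoise d) =>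
      f (backwardStep B S σ (T - (k + 1)) z.1 z.2).1 := hf1.comp hm
  have hfo : Measurable fun z : Euc d × (ℕ → RoundNoise d) =>
      f (forsOutput B (stepPropose (vpEta σ (T - (k + 1))) ((vpAlpha σ (T - (k + 1)))⁻¹ • z.1))
        (stepEst B (S (T - (k + 1))) ((vpAlpha σ (T - (k + 1)))⁻¹ • z.1)) z.2) := hf.comp hmo
  rw [lintegral_map hf measurable_snd, Measure.lintegral_compProd hf2]
  simp_rw [lintegral_stepKernel (hS _) _ hf]
  rw [backwardState, backwardLaw, lintegral_map hf measurable_fst,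
    lintegral_map hf1 hm, backwardState, lintegral_map hfo.lintegral_prod_right measurable_fst,
    lintegral_prod _ hfb.aemeasurable]
  rfl

lemma lintegral_exp_stepCount_le (hB : 0 < B) (hs : Measurable s) (x : Euc d) :
    ∫⁻ ω, ENNReal.ofReal (Real.exp (queryRate B *
      (forsCount B (stepPropose η (α⁻¹ • x)) (stepEst B s (α⁻¹ • x)) ω : ℕ))) ∂(forsNoise d B) ≤
      ENNReal.ofReal (4 * Real.exp (2 * B)) := by
  have hp : Measurable (stepPropose η (α⁻¹ • x)) := by unfold stepPropose; fun_prop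
  have he : Measurable fun z : Euc d × unitInterval => stepEst B s (α⁻¹ • x) z.1 z.2 :=
    (measurable_stepEst (B := B) hs).comp
      (g := fun y : (Euc d × Euc d) × unitInterval => stepEst B s y.1.1 y.1.2 y.2)
      (f := fun y : Euc d × unitInterval => ((α⁻¹ • x, y.1), y.2)) (by fun_prop)
  exact lintegral_forsCount_le hB hp he fun _ _ => abs_clip_le hB.le _

lemma lintegral_exp_backwardStep_le (hB : 0 < B) (hS : ∀ t, Measurable (S t)) (t : ℕ) (z : Euc d × ℕ) :
    ∫⁻ ω, ENNReal.ofReal (Real.exp (queryRate B * (backwardStep B S σ t z ω).2)) ∂(forsNoise d B) ≤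
      ENNReal.ofReal (4 * Real.exp (2 * B)) * ENNReal.ofReal (Real.exp (queryRate B * z.2)) := by
  rw [mul_comm]
  refine le_trans (le_of_eq ?_) (mul_le_mul_right (lintegral_exp_stepCount_le
    (η := vpEta σ t) (α := vpAlpha σ t) hB (hS t) z.1) _)
  rw [← lintegral_const_mul' _ _ ENNReal.ofReal_ne_top]
  refine lintegral_congr fun ω => ?_
  rw [← ENNReal.ofReal_mul (Real.exp_pos _).le, ← Real.exp_add, ← mul_add, ← Nat.cast_add]
  rfl

/-- The moment bound for one step holds from every state, so the bounds multiply although the counts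
of successive steps are dependent. -/
lemma lintegral_exp_query_le [IsProbabilityMeasure init] (hB : 0 < B) (hS : ∀ t, Measurable (S t)) (k : ℕ) :
    ∫⁻ z, ENNReal.ofReal (Real.exp (queryRate B * z.2)) ∂(backwardLaw B S σ T init k) ≤
      ENNReal.ofReal (4 * Real.exp (2 * B)) ^ k := by
  induction k with
  | zero =>
    rw [backwardLaw, lintegral_map (by fun_prop) (by fun_prop)]
    simp
  | succ k ih =>
    have := isProbabilityMeasure_backwardLaw (B := B) (σ := σ) (T := T) (init := init) hS k
    have hm := measurable_backwardStep (B := B) hS σ (T - (k + 1))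
    have hE : Measurable fun z : Euc d × ℕ => ENNReal.ofReal (Real.exp (queryRate B * z.2)) := by fun_prop
    have hEb : Measurable fun z : (Euc d × ℕ) × (ℕ → RoundNoise d) => ENNReal.ofReal
        (Real.exp (queryRate B * (backwardStep B S σ (T - (k + 1)) z.1 z.2).2)) := hE.comp hm
    rw [backwardLaw, lintegral_map hE hm, lintegral_prod _ hEb.aemeasurable, pow_succ']
    calc _ ≤ ∫⁻ z, ENNReal.ofReal (4 * Real.exp (2 * B)) * ENNReal.ofReal (Real.exp (queryRate B * z.2))
          ∂(backwardLaw B S σ T init k) := by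
          refine lintegral_mono fun z => ?_
          exact lintegral_exp_backwardStep_le hB hS (T - (k + 1)) z
      _ ≤ _ := by
          rw [lintegral_const_mul _ (by fun_prop)]
          exact mul_le_mul_right ih _

/-- One step of the comparison of the exact reverse process with the sampler. -/
lemma klDiv_backward_le (hB : 0 < B) {p : Euc d → ℝ} {σp : ℝ} (hp : LogSmooth p σp)
    (hp1 : ∫⁻ x, ENNReal.ofReal (p x) = 1) (hs : Measurable s) (hα : α ≠ 0)
    {ν νh : Measure (Euc d)} [IsProbabilityMeasure νh]
    (hν : ν = ((volume.withDensity fun x => ENNReal.ofReal (p x)).prod (stdGaussian (Euc d))).map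
      (fun z => α • z.1 + (α * √η) • z.2)) :
    klDiv (volume.withDensity fun x => ENNReal.ofReal (p x))
      ((νh ⊗ₘ stepKernel B s η α).map Prod.snd) ≤ klDiv ν νh +
      klDiv (((volume : Measure (Euc d)).prod (stdGaussian (Euc d))).withDensity
        fun z => ENNReal.ofReal (p (z.1 + √η • z.2)))
      (((volume : Measure (Euc d)).prod (stdGaussian (Euc d))).withDensity
        fun z => ENNReal.ofReal (p z.1 * Real.exp (stepWeight B s η z))) := by
  have hpm : Measurable p := hp.diff.continuous.measurable
  have hWm := measurable_stepWeight (B := B) (η := η) hs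
  set M := (volume : Measure (Euc d)).prod (stdGaussian (Euc d)) with hM
  set P0 := M.withDensity fun z => ENNReal.ofReal (p (z.1 + √η • z.2)) with hP0
  set Q0 := M.withDensity fun z => ENNReal.ofReal (p z.1 * Real.exp (stepWeight B s η z)) with hQ0
  -- Passes from the coordinates (x̄, g) to the pair (X_{t+1}, X_t).
  set ψ : Euc d × Euc d → Euc d × Euc d := fun z => (α • z.1, z.1 + √η • z.2) with hψ
  have hψm : Measurable ψ := by fun_prop
  set K := stepKernel B s η α with hK
  have : IsMarkovKernel K := isMarkovKernel_stepKernel hs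
  have hM1 : ∫⁻ z, ENNReal.ofReal (p z.1) ∂M = 1 := by
    rw [hM, lintegral_prod _ (by fun_prop)]
    simpa using hp1
  have hPfin : IsFiniteMeasure P0 := by
    refine isFiniteMeasure_withDensity ?_
    have := lintegral_volume_prod_shift (d := d) (√η) (F := fun z => ENNReal.ofReal (p z.1)) (by fun_prop)
    simp only at this
    rw [this, ← hM, hM1]; exact ENNReal.one_ne_top
  have hQfin : IsFiniteMeasure Q0 := by
    refine isFiniteMeasure_withDensity
      (ne_top_of_le_ne_top (b := ENNReal.ofReal (Real.exp B)) ENNReal.ofReal_ne_top ?_)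
    calc ∫⁻ z, ENNReal.ofReal (p z.1 * Real.exp (stepWeight B s η z)) ∂M
        ≤ ∫⁻ z, ENNReal.ofReal (p z.1) * ENNReal.ofReal (Real.exp B) ∂M := by
          refine lintegral_mono fun z => ?_
          rw [ENNReal.ofReal_mul (hp.pos _).le]
          gcongr
          exact (abs_le.1 (abs_stepWeight_le hB.le z)).2
      _ = ENNReal.ofReal (Real.exp B) := by
          rw [lintegral_mul_const _ (by fun_prop), hM1, one_mul]
  set P := P0.map ψ with hP
  set Q := Q0.map ψ with hQ
  have hPfst : P.fst = ν := by
    refine Measure.ext_of_lintegral _ fun f hf => ?_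
    have hf1 : Measurable fun z : Euc d × Euc d => f z.1 := hf.comp measurable_fst
    have hf1ψ : Measurable fun z : Euc d × Euc d => f (ψ z).1 := hf1.comp hψm
    rw [Measure.fst, lintegral_map hf measurable_fst, lintegral_map hf1 hψm, hP0,
      lintegral_withDensity_eq_lintegral_mul _ (by fun_prop) hf1ψ,
      hν, lintegral_map hf (by fun_prop), hM,
      ← lintegral_volume_prod_swap (√η) (by fun_prop)]
    change _ = ∫⁻ z, f (α • z.1 + (α * √η) • z.2) ∂(stateNoise p)
    rw [lintegral_stateNoise hpm (by fun_prop)]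
    refine lintegral_congr fun z => ?_
    simp only [Pi.mul_apply, hψ, smul_neg, add_neg_cancel_right, smul_add, mul_smul]
  have hPsnd : P.map Prod.snd = volume.withDensity fun x => ENNReal.ofReal (p x) := by
    refine Measure.ext_of_lintegral _ fun f hf => ?_
    have hf2 : Measurable fun z : Euc d × Euc d => f z.2 := hf.comp measurable_snd
    have hf2ψ : Measurable fun z : Euc d × Euc d => f (ψ z).2 := hf2.comp hψm
    rw [lintegral_map hf measurable_snd, lintegral_map hf2 hψm, hP0,
      lintegral_withDensity_eq_lintegral_mul _ (by fun_prop) hf2ψ,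
      lintegral_withDensity_eq_lintegral_mul _ (by fun_prop) hf, hM]
    have := lintegral_volume_prod_shift (√η) (F := fun z : Euc d × Euc d => ENNReal.ofReal (p z.1) * f z.1)
      (by fun_prop)
    simp only [Pi.mul_apply, hψ]
    rw [this, lintegral_prod _ (by fun_prop)]
    simp
  -- The second coordinate of `Q` given the first is the sampler's kernel; the unknown normalising
  -- constant is absorbed into the first marginal.
  have hQK : Q = Q.fst ⊗ₘ K := by
    refine Measure.ext_of_lintegral _ fun F hF => ?_
    have hkm : Measurable fun x => ∫⁻ y, F (x, y) ∂(K x) := hF.lintegral_kernel_prod_right'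
    have hk1 : Measurable fun z : Euc d × Euc d => ∫⁻ y, F (z.1, y) ∂(K z.1) := hkm.comp measurable_fst
    have hk1ψ : Measurable fun z : Euc d × Euc d => ∫⁻ y, F ((ψ z).1, y) ∂(K (ψ z).1) := hk1.comp hψm
    have hFψ : Measurable fun z : Euc d × Euc d => F (ψ z) := hF.comp hψm
    have hw : Measurable fun z : Euc d × Euc d => ENNReal.ofReal (p z.1 * Real.exp (stepWeight B s η z)) := by
      fun_prop
    rw [Measure.lintegral_compProd hF, Measure.fst, lintegral_map hkm measurable_fst,
      hQ, lintegral_map hF hψm, lintegral_map hk1 hψm, hQ0,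
      lintegral_withDensity_eq_lintegral_mul _ hw hFψ,
      lintegral_withDensity_eq_lintegral_mul _ hw hk1ψ, hM,
      lintegral_prod _ (hw.mul hFψ).aemeasurable,
      lintegral_prod _ (hw.mul hk1ψ).aemeasurable]
    refine lintegral_congr fun x => ?_
    have hFx : Measurable fun y => F (α • x, y) := hF.comp measurable_prodMk_left
    have hpr : Measurable (stepPropose η x) := by unfold stepPropose; fun_prop
    have hest : Measurable fun z : Euc d × unitInterval => stepEst B s x z.1 z.2 :=
      (measurable_stepEst (B := B) hs).comp
        (g := fun y : (Euc d × Euc d) × unitInterval => stepEst B s y.1.1 y.1.2 y.2)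
        (f := fun y : Euc d × unitInterval => ((x, y.1), y.2)) (by fun_prop)
    have key := lintegral_forsOutput hB hpr hest (fun _ _ => abs_clip_le hB.le _) hFx
    have hWx : Measurable fun g : Euc d => stepWeight B s η (x, g) := hWm.comp measurable_prodMk_left
    simp only [Pi.mul_apply, hψ]
    simp_rw [ENNReal.ofReal_mul (hp.pos x).le, mul_assoc]
    rw [lintegral_const_mul _ (by fun_prop), lintegral_const_mul _ (by fun_prop),
      lintegral_mul_const _ (by fun_prop), hK, lintegral_stepKernel hs _ hFx, inv_smul_smul₀ hα]
    congr 1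
    refine Eq.trans ?_ key.symm
    refine lintegral_congr fun g => ?_
    rw [mul_comm]
    rfl
  have hPK : P = P.fst ⊗ₘ P.condKernel := (P.disintegrate P.condKernel).symm
  have hsplit : klDiv P (νh ⊗ₘ K) = klDiv P.fst νh + klDiv P (P.fst ⊗ₘ K) := by
    conv_lhs => rw [hPK]
    rw [klDiv_compProd_eq_add, ← hPK]
  have hsplit2 : klDiv P Q = klDiv P.fst Q.fst + klDiv P (P.fst ⊗ₘ K) := by
    conv_lhs => rw [hPK, hQK]
    rw [klDiv_compProd_eq_add, ← hPK]
  calc klDiv (volume.withDensity fun x => ENNReal.ofReal (p x)) ((νh ⊗ₘ K).map Prod.snd)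
      = klDiv (P.map Prod.snd) ((νh ⊗ₘ K).map Prod.snd) := by rw [hPsnd]
    _ ≤ klDiv P (νh ⊗ₘ K) := klDiv_map_le _ _ measurable_snd
    _ = klDiv P.fst νh + klDiv P (P.fst ⊗ₘ K) := hsplit
    -- The divergence of first marginals is nonnegative also for finite measures of unequal mass, so
    -- it can be added.
    _ ≤ klDiv P.fst νh + klDiv P Q := by
        rw [hsplit2]; gcongr; exact le_add_self
    _ ≤ klDiv ν νh + klDiv P0 Q0 := by
        rw [hPfst]; gcongr; exact klDiv_map_le _ _ hψm

lemma klDiv_forward_backward_le (hB : 0 < B) (hS : ∀ t, Measurable (S t)) {σ₁ : ℝ}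
    [IsProbabilityMeasure init] (pdata : Measure (Euc d)) [IsProbabilityMeasure pdata] (hσ : IsVPSchedule T σ σ₁) (E : ℕ → ℝ≥0∞)
    (hE : ∀ t, 1 ≤ t → t < T →
      klDiv (((volume : Measure (Euc d)).prod (stdGaussian (Euc d))).withDensity
        fun z => ENNReal.ofReal (forwardDensity pdata σ t (z.1 + √(vpEta σ t) • z.2)))
      (((volume : Measure (Euc d)).prod (stdGaussian (Euc d))).withDensity
        fun z => ENNReal.ofReal (forwardDensity pdata σ t z.1 *
          Real.exp (stepWeight B (S t) (vpEta σ t) z))) ≤ E t) :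
    klDiv (forwardLaw pdata σ 1) (backwardState B S σ T init (T - 1)) ≤
      klDiv (forwardLaw pdata σ T) init + ∑ t ∈ Finset.Ico 1 T, E t := by
  have hT := hσ.one_le
  have key : ∀ k, k ≤ T - 1 → klDiv (forwardLaw pdata σ (T - k)) (backwardState B S σ T init k) ≤
      klDiv (forwardLaw pdata σ T) init + ∑ t ∈ Finset.Ico (T - k) T, E t := by
    intro k hk
    induction k with
    | zero => simp [backwardState_zero]
    | succ k ih =>
      set t := T - (k + 1) with ht
      have ht1 : 1 ≤ t := by omega
      have htT : t < T := by omega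
      have htk : T - k = t + 1 := by omega
      have ih' := ih (by omega)
      rw [htk] at ih'
      have := isProbabilityMeasure_backwardLaw (B := B) (σ := σ) (T := T) (init := init) hS k
      have : IsProbabilityMeasure (backwardState B S σ T init k) :=
        Measure.isProbabilityMeasure_map (by fun_prop)
      have hlaw := forwardLaw_eq_withDensity pdata hσ ht1 htT.le
      have hprob := isProbabilityMeasure_forwardLaw pdata hσ htT.le
      have hp1 : ∫⁻ x, ENNReal.ofReal (forwardDensity pdata σ t x) = 1 := by
        have := hprob.measure_univ
        rwa [hlaw, withDensity_apply _ MeasurableSet.univ, setLIntegral_univ] at this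
      have hα : vpAlpha σ t ≠ 0 :=
        (div_pos (hσ.alphaBar_pos (by omega)) (hσ.alphaBar_pos htT.le)).ne'
      rw [backwardState_succ hS k, hlaw, Finset.sum_eq_sum_Ico_succ_bot htT]
      refine (klDiv_backward_le (η := vpEta σ t) hB (logSmooth_forwardDensity pdata hσ ht1 htT.le) hp1 (hS t) hα
        (ν := forwardLaw pdata σ (t + 1)) (by rw [forwardLaw, hlaw])).trans ?_
      refine (add_le_add ih' (hE t ht1 htT)).trans (le_of_eq ?_)
      ring
  have := key (T - 1) le_rfl
  rwa [show T - (T - 1) = 1 by omega] at this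

end Chain
end

noncomputable section

/-! ### Initialization, early stopping, and the number of queries -/

section Initialization

variable {d : ℕ}

/-- The Cameron–Martin formula in finite dimension. -/
lemma lintegral_stdGaussian_shift (e : Euc d) {F : Euc d → ℝ≥0∞} (hF : Measurable F) :
    ∫⁻ g, F (g + e) ∂(stdGaussian (Euc d)) =
      ∫⁻ g, ENNReal.ofReal (Real.exp (inner ℝ g e - ‖e‖ ^ 2 / 2)) * F g ∂(stdGaussian (Euc d)) := by
  have hc : Measurable fun x : Euc d => ENNReal.ofReal (gaussDensity 1 x) :=
    (continuous_gaussDensity 1).measurable.ennreal_ofReal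
  have hFe : Measurable fun g => F (g + e) := hF.comp (measurable_id.add_const e)
  rw [stdGaussian_eq_withDensity, lintegral_withDensity_eq_lintegral_mul _ hc hFe,
    lintegral_withDensity_eq_lintegral_mul _ hc (by fun_prop),
    ← lintegral_add_right_eq_self _ (-e)]
  refine lintegral_congr fun x => ?_
  simp only [Pi.mul_apply, neg_add_cancel_right]
  rw [← mul_assoc, ← ENNReal.ofReal_mul (gaussDensity_pos one_pos _).le]
  congr 2
  unfold gaussDensity
  rw [mul_assoc ((2 * Real.pi * 1 ^ 2) ^ (-(d / 2 : ℝ))), ← Real.exp_add]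
  congr 2
  rw [← sub_eq_add_neg, norm_sub_sq_real]
  ring

/-- This is the relative entropy of N(e, I) with respect to N(0, I), written with `expGap`. -/
lemma lintegral_expGap_shift (e : Euc d) :
    ∫⁻ g, ENNReal.ofReal (Real.exp (inner ℝ g e - ‖e‖ ^ 2 / 2)) *
      ENNReal.ofReal (expGap (-(inner ℝ g e - ‖e‖ ^ 2 / 2))) ∂(stdGaussian (Euc d)) =
      ENNReal.ofReal (‖e‖ ^ 2 / 2) := by
  have hg : Measurable fun g : Euc d => ENNReal.ofReal (expGap (-(inner ℝ g e - ‖e‖ ^ 2 / 2))) :=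
    (measurable_expGap.comp (by fun_prop : Measurable fun g : Euc d =>
      -((inner ℝ g e : ℝ) - ‖e‖ ^ 2 / 2))).ennreal_ofReal
  rw [← lintegral_stdGaussian_shift e hg]
  have h1 : ∫⁻ g, ENNReal.ofReal (Real.exp (inner ℝ g (-e) - ‖-e‖ ^ 2 / 2)) ∂(stdGaussian (Euc d)) = 1 := by
    have := lintegral_stdGaussian_shift (-e) (F := fun _ => 1) measurable_const
    simpa using this.symm
  have hi : Integrable (fun g : Euc d => Real.exp (inner ℝ g (-e) - ‖-e‖ ^ 2 / 2)) (stdGaussian (Euc d)) :=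
    ⟨by fun_prop, by
      rw [hasFiniteIntegral_iff_ofReal (ae_of_all _ fun _ => (Real.exp_pos _).le), h1]
      exact ENNReal.one_lt_top⟩
  have hi2 : Integrable (fun g : Euc d => (inner ℝ g e : ℝ)) (stdGaussian (Euc d)) := by
    refine Integrable.mono' ((integrable_const 1).add (integrable_inner_sq_stdGaussian e)) (by fun_prop)
      (ae_of_all _ fun g => ?_)
    rw [Real.norm_eq_abs, abs_le]
    simp only [Pi.add_apply]
    constructor <;> nlinarith [sq_nonneg ((inner ℝ g e : ℝ) - 1), sq_nonneg ((inner ℝ g e : ℝ) + 1)]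
  have hval : ∫ g, Real.exp (inner ℝ g (-e) - ‖-e‖ ^ 2 / 2) ∂(stdGaussian (Euc d)) = 1 := by
    rw [integral_eq_lintegral_of_nonneg_ae (ae_of_all _ fun _ => (Real.exp_pos _).le) hi.1, h1]
    simp
  have heq : ∀ g : Euc d, expGap (-(inner ℝ (g + e) e - ‖e‖ ^ 2 / 2)) =
      Real.exp (inner ℝ g (-e) - ‖-e‖ ^ 2 / 2) - (1 - ‖e‖ ^ 2 / 2) + inner ℝ g e := by
    intro g
    unfold expGap
    rw [inner_add_left, real_inner_self_eq_norm_sq, inner_neg_right, norm_neg]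
    rw [show -(inner ℝ g e + ‖e‖ ^ 2 - ‖e‖ ^ 2 / 2) = -inner ℝ g e - ‖e‖ ^ 2 / 2 by ring]
    ring
  simp_rw [heq]
  have hint : Integrable (fun g : Euc d => Real.exp (inner ℝ g (-e) - ‖-e‖ ^ 2 / 2) - (1 - ‖e‖ ^ 2 / 2) +
    inner ℝ g e) (stdGaussian (Euc d)) := (hi.sub (integrable_const _)).add hi2
  rw [← ofReal_integral_eq_lintegral_ofReal hint
    (ae_of_all _ fun g => by
      change 0 ≤ Real.exp (inner ℝ g (-e) - ‖-e‖ ^ 2 / 2) - (1 - ‖e‖ ^ 2 / 2) + inner ℝ g e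
      rw [← heq]; exact expGap_nonneg _)]
  have h2 : ∫ g : Euc d, (Real.exp (inner ℝ g (-e) - ‖-e‖ ^ 2 / 2) - (1 - ‖e‖ ^ 2 / 2) + inner ℝ g e)
      ∂(stdGaussian (Euc d)) = ‖e‖ ^ 2 / 2 := by
    have hi' : Integrable (fun g : Euc d => Real.exp (inner ℝ g (-e) - ‖-e‖ ^ 2 / 2) - (1 - ‖e‖ ^ 2 / 2))
      (stdGaussian (Euc d)) := hi.sub (integrable_const _)
    rw [integral_add hi' hi2, integral_sub hi (integrable_const _), hval,
      integral_inner_stdGaussian]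
    simp
  rw [h2]

lemma isProbabilityMeasure_isoGaussian (m : Euc d) (v : ℝ) : IsProbabilityMeasure (isoGaussian m v) :=
  Measure.isProbabilityMeasure_map (by fun_prop)

variable {T : ℕ} {σ : ℕ → ℝ} {σ₁ : ℝ}

/-- Compare the joint laws with X_0 kept: conditionally on X_0 the divergence is that of a Gaussian
shift by (ᾱ_T/σ_T)X_0. Forgetting X_0 only decreases it. -/
lemma klDiv_forwardLaw_isoGaussian_le (pdata : Measure (Euc d)) [IsProbabilityMeasure pdata]
    (hm : Integrable (fun x : Euc d => ‖x‖ ^ 2) pdata) (h : IsVPSchedule T σ σ₁) :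
    klDiv (forwardLaw pdata σ T) (isoGaussian 0 (σ T ^ 2)) ≤
      ENNReal.ofReal ((vpAlphaBar σ T / σ T) ^ 2 * secondMoment pdata / 2) := by
  have hσ : 0 < σ T := h.pos T h.one_le le_rfl
  set c := vpAlphaBar σ T / σ T with hc
  set m := pdata.prod (stdGaussian (Euc d)) with hmdef
  set w : Euc d × Euc d → ℝ := fun z => Real.exp (inner ℝ z.2 (c • z.1) - ‖c • z.1‖ ^ 2 / 2) with hw
  have hwm : Measurable w := by fun_prop
  have hshift : ∀ {F : Euc d × Euc d → ℝ≥0∞}, Measurable F →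
      ∫⁻ z, ENNReal.ofReal (w z) * F z ∂m = ∫⁻ z, F (z.1, z.2 + c • z.1) ∂m := by
    intro F hF
    have hFs : Measurable fun z : Euc d × Euc d => F (z.1, z.2 + c • z.1) := hF.comp (by fun_prop)
    rw [hmdef, lintegral_prod _ (by fun_prop), lintegral_prod _ hFs.aemeasurable]
    refine lintegral_congr fun y => ?_
    exact (lintegral_stdGaussian_shift (c • y) (F := fun g => F (y, g))
      (hF.comp measurable_prodMk_left)).symm
  have hone : ∫⁻ z, ENNReal.ofReal (w z) ∂m = 1 := by
    have := hshift (F := fun _ => 1) measurable_const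
    simpa using this
  set ψ : Euc d × Euc d → Euc d := fun z => σ T • z.2 with hψ
  have hψm : Measurable ψ := by fun_prop
  have hP : (m.withDensity fun z => ENNReal.ofReal (w z)).map ψ = forwardLaw pdata σ T := by
    rw [forwardLaw_eq_map pdata h le_rfl]
    refine Measure.ext_of_lintegral _ fun f hf => ?_
    have hfψ : Measurable fun z => f (ψ z) := hf.comp hψm
    rw [lintegral_map hf hψm, lintegral_withDensity_eq_lintegral_mul _ hwm.ennreal_ofReal hfψ,
      lintegral_map hf (by fun_prop)]
    refine (hshift hfψ).trans (lintegral_congr fun z => ?_)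
    simp only [hψ, smul_add, smul_smul, hc, mul_div_cancel₀ _ hσ.ne', add_comm]
  have hQ : (m.withDensity fun _ => ENNReal.ofReal 1).map ψ = isoGaussian 0 (σ T ^ 2) := by
    rw [ENNReal.ofReal_one, show (fun _ : Euc d × Euc d => (1 : ℝ≥0∞)) = 1 from rfl, withDensity_one, isoGaussian, Real.sqrt_sq hσ.le]
    simp only [zero_add]
    have : ψ = (σ T • ·) ∘ Prod.snd := rfl
    rw [this, ← Measure.map_map (by fun_prop) measurable_snd, hmdef, ← Measure.snd, Measure.snd_prod]
  have : IsFiniteMeasure (m.withDensity fun z => ENNReal.ofReal (w z)) :=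
    isFiniteMeasure_withDensity (by rw [hone]; exact ENNReal.one_ne_top)
  have : IsFiniteMeasure (m.withDensity fun _ => ENNReal.ofReal 1) :=
    isFiniteMeasure_withDensity (by simp)
  rw [← hP, ← hQ]
  refine (klDiv_map_le _ _ hψm).trans ?_
  rw [klDiv_withDensity m hwm measurable_const (fun _ => Real.exp_pos _) (fun _ => one_pos)
    (by rw [hone]; exact ENNReal.one_ne_top) (by simp)]
  have hgap : Measurable fun z => ENNReal.ofReal (w z) *
      ENNReal.ofReal (expGap (-(inner ℝ z.2 (c • z.1) - ‖c • z.1‖ ^ 2 / 2))) :=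
    hwm.ennreal_ofReal.mul (measurable_expGap.comp (by fun_prop : Measurable fun z : Euc d × Euc d =>
      -((inner ℝ z.2 (c • z.1) : ℝ) - ‖c • z.1‖ ^ 2 / 2))).ennreal_ofReal
  simp only [Real.log_one, hw, Real.log_exp, zero_sub]
  rw [hmdef, lintegral_prod _ hgap.aemeasurable]
  rw [lintegral_congr fun y => lintegral_expGap_shift (c • y)]
  have hcm : ∀ y : Euc d, ‖c • y‖ ^ 2 / 2 = c ^ 2 / 2 * ‖y‖ ^ 2 := by
    intro y; rw [norm_smul, mul_pow, Real.norm_eq_abs, sq_abs]; ring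
  simp_rw [hcm]
  rw [← ofReal_integral_eq_lintegral_ofReal (hm.const_mul _) (ae_of_all _ fun y => by positivity),
    integral_const_mul, secondMoment]
  refine le_of_eq (congrArg _ ?_)
  ring

end Initialization

/-! ### From relative entropy to the bounded Lipschitz metric. -/

section BoundedLipschitz

/-- Young's inequality for the convex conjugate pair s ↦ klFun(1 + s) and e^a - 1 - a. -/
lemma mul_le_klFun_add_expGap {r : ℝ} (hr : 0 ≤ r) (a : ℝ) : (r - 1) * a ≤ klFun r + expGap a := by
  unfold klFun expGap
  rcases hr.eq_or_lt with rfl | hr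
  · have := Real.exp_pos a
    simp; linarith
  · have h := Real.add_one_le_exp (a - Real.log r)
    rw [Real.exp_sub, Real.exp_log hr, le_div_iff₀ hr] at h
    linarith

lemma sq_integral_sub_le_klDiv {α : Type*} [MeasurableSpace α] (μ ν : Measure α)
    [IsProbabilityMeasure μ] [IsProbabilityMeasure ν] {f : α → ℝ} (hf : Measurable f)
    (hf1 : ∀ x, |f x| ≤ 1) :
    ENNReal.ofReal ((∫ x, f x ∂μ - ∫ x, f x ∂ν) ^ 2) ≤ 12 * klDiv μ ν := by
  by_cases htop : klDiv μ ν = ∞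
  · simp [htop]
  obtain ⟨hac, hint⟩ := klDiv_ne_top_iff.1 htop
  have hfi : ∀ m : Measure α, IsProbabilityMeasure m → Integrable f m := fun m _ =>
    Integrable.of_bound hf.aestronglyMeasurable 1 (ae_of_all _ hf1)
  have hle : ∀ m : Measure α, IsProbabilityMeasure m → |∫ x, f x ∂m| ≤ 1 := fun m _ => by
    have := norm_integral_le_of_norm_le_const (μ := m) (f := f) (C := 1) (ae_of_all _ hf1)
    simpa using this
  set D := ∫ x, f x ∂μ - ∫ x, f x ∂ν with hD
  have hD2 : |D| ≤ 2 := by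
    refine (abs_sub _ _).trans ?_
    linarith [hle μ inferInstance, hle ν inferInstance]
  -- The maximiser of lD - 3l², with value D²/12; it also satisfies |l| ≤ 1, where the quadratic
  -- bound on `expGap` has constant e ≤ 3.
  set l := D / 6 with hl
  have hl1 : |l| ≤ 1 := by rw [hl, abs_div, abs_of_pos (by norm_num : (0 : ℝ) < 6)]; linarith
  set r : α → ℝ := fun x => (μ.rnDeriv ν x).toReal with hr
  have hkl : (klDiv μ ν).toReal = ∫ x, klFun (r x) ∂ν := toReal_klDiv_eq_integral_klFun hac
  have hki : Integrable (fun x => klFun (r x)) ν := (integrable_klFun_rnDeriv_iff hac).2 hint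
  have hrf : Integrable (fun x => r x * f x) ν := by
    have := (integrable_rnDeriv_smul_iff (f := f) hac).2 (hfi μ inferInstance)
    simpa [smul_eq_mul] using this
  have hrfv : ∫ x, r x * f x ∂ν = ∫ x, f x ∂μ := by
    have := integral_rnDeriv_smul (f := f) hac
    simpa [smul_eq_mul] using this
  have hmain : l * D ≤ (klDiv μ ν).toReal + 3 * l ^ 2 := by
    have h1 : ∫ x, l * (r x * f x - f x) ∂ν ≤ ∫ x, (klFun (r x) + 3 * l ^ 2) ∂ν := by
      refine integral_mono ((hrf.sub (hfi ν inferInstance)).const_mul l) (hki.add (integrable_const _)) fun x => ?_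
      have h2 := mul_le_klFun_add_expGap (r := r x) ENNReal.toReal_nonneg (l * f x)
      have h3 : |l * f x| ≤ 1 := by
        rw [abs_mul]; exact mul_le_one₀ hl1 (abs_nonneg _) (hf1 x)
      have h4 := expGap_le_sq h3
      have h5 : Real.exp 1 * (l * f x) ^ 2 ≤ 3 * l ^ 2 := by
        have : f x ^ 2 ≤ 1 := (sq_le_one_iff_abs_le_one _).2 (hf1 x)
        have he : Real.exp 1 ≤ 3 := by linarith [Real.exp_one_lt_d9]
        calc Real.exp 1 * (l * f x) ^ 2 = Real.exp 1 * (l ^ 2 * f x ^ 2) := by ring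
          _ ≤ 3 * (l ^ 2 * 1) := by gcongr
          _ = 3 * l ^ 2 := by ring
      simp only
      linarith
    rw [integral_const_mul, integral_sub hrf (hfi ν inferInstance), hrfv,
      integral_add hki (integrable_const _), ← hkl] at h1
    simpa using h1
  have hfin : D ^ 2 ≤ 12 * (klDiv μ ν).toReal := by
    rw [hl] at hmain
    nlinarith
  calc ENNReal.ofReal (D ^ 2) ≤ ENNReal.ofReal (12 * (klDiv μ ν).toReal) := ENNReal.ofReal_le_ofReal hfin
    _ = 12 * klDiv μ ν := by
      rw [ENNReal.ofReal_mul (by norm_num), ENNReal.ofReal_toReal htop]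
      norm_num

variable {d : ℕ} {T : ℕ} {σ : ℕ → ℝ} {σ₁ : ℝ}

/-- Couple X_0 with X_1 = ᾱ_1 X_0 + σ_1 Z. The displacement is at most σ_1(‖X_0‖ + ‖Z‖). -/
lemma sq_integral_sub_forwardLaw_le (pdata : Measure (Euc d)) [IsProbabilityMeasure pdata]
    (hm : Integrable (fun x : Euc d => ‖x‖ ^ 2) pdata) (h : IsVPSchedule T σ σ₁) {f : Euc d → ℝ}
    (hf1 : ∀ x, |f x| ≤ 1) (hf : LipschitzWith 1 f) :
    (∫ x, f x ∂pdata - ∫ x, f x ∂(forwardLaw pdata σ 1)) ^ 2 ≤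
      2 * σ₁ ^ 2 * (d + secondMoment pdata) := by
  have hσ : 0 < σ 1 := h.pos 1 le_rfl h.one_le
  have hσ1 : σ 1 < 1 := h.lt_one 1 le_rfl h.one_le
  set a := vpAlphaBar σ 1 with ha
  have ha0 : 0 ≤ a := Real.sqrt_nonneg _
  have ha2 : a ^ 2 = 1 - σ 1 ^ 2 := Real.sq_sqrt (by nlinarith)
  have hfm : Measurable f := hf.continuous.measurable
  set m := pdata.prod (stdGaussian (Euc d)) with hmdef
  set F : Euc d × Euc d → ℝ := fun z => f z.1 - f (a • z.1 + σ 1 • z.2) with hF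
  have hFm : Measurable F := by fun_prop
  have hi1 : Integrable (fun z : Euc d × Euc d => f z.1) m :=
    Integrable.of_bound (hfm.comp (by fun_prop)).aestronglyMeasurable 1 (ae_of_all _ fun z => hf1 _)
  have hi2 : Integrable (fun z : Euc d × Euc d => f (a • z.1 + σ 1 • z.2)) m :=
    Integrable.of_bound (hfm.comp (by fun_prop)).aestronglyMeasurable 1 (ae_of_all _ fun z => hf1 _)
  have hint : ∫ x, f x ∂pdata - ∫ x, f x ∂(forwardLaw pdata σ 1) = ∫ z, F z ∂m := by
    rw [hF, integral_sub hi1 hi2, forwardLaw_eq_map pdata h h.one_le,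
      integral_map (by fun_prop) (by fun_prop)]
    congr 1
    have : pdata = m.map Prod.fst := by rw [hmdef, ← Measure.fst, Measure.fst_prod]
    conv_lhs => rw [this]
    rw [integral_map (by fun_prop) (by fun_prop)]
  have hFb : ∀ z, |F z| ≤ 2 := fun z => (abs_sub _ _).trans (by linarith [hf1 z.1, hf1 (a • z.1 + σ 1 • z.2)])
  have hy : Integrable (fun z : Euc d × Euc d => ‖z.1‖ ^ 2) m := hm.comp_fst _
  have hg : Integrable (fun z : Euc d × Euc d => ‖z.2‖ ^ 2) m := integrable_norm_sq_stdGaussian.comp_snd _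
  have hG : Integrable (fun z : Euc d × Euc d => 2 * σ 1 ^ 2 * (‖z.1‖ ^ 2 + ‖z.2‖ ^ 2)) m :=
    (hy.add hg).const_mul _
  have hpt : ∀ z, F z ^ 2 ≤ 2 * σ 1 ^ 2 * (‖z.1‖ ^ 2 + ‖z.2‖ ^ 2) := by
    intro z
    have h1 : |F z| ≤ ‖(1 - a) • z.1‖ + ‖σ 1 • z.2‖ := by
      have := hf.dist_le_mul z.1 (a • z.1 + σ 1 • z.2)
      rw [NNReal.coe_one, one_mul, Real.dist_eq, dist_eq_norm] at this
      refine this.trans ?_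
      rw [show z.1 - (a • z.1 + σ 1 • z.2) = (1 - a) • z.1 - σ 1 • z.2 by module]
      exact norm_sub_le _ _
    rw [norm_smul, norm_smul, Real.norm_eq_abs, Real.norm_eq_abs, abs_of_pos hσ] at h1
    -- Since 0 ≤ a ≤ 1, one has 1 - a ≤ 1 - a² = σ_1² ≤ σ_1.
    have h2 : |1 - a| ≤ σ 1 := by
      rw [abs_le]; constructor <;> nlinarith
    have h3 : |F z| ≤ σ 1 * (‖z.1‖ + ‖z.2‖) := by
      nlinarith [norm_nonneg z.1]
    rw [← sq_abs]
    calc |F z| ^ 2 ≤ (σ 1 * (‖z.1‖ + ‖z.2‖)) ^ 2 := by gcongr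
      _ ≤ _ := by
        rw [mul_pow, mul_comm 2 (σ 1 ^ 2), mul_assoc]
        gcongr
        nlinarith [sq_nonneg (‖z.1‖ - ‖z.2‖)]
  rw [hint]
  have hsq := sq_integral_le_integral_sq hFm hFb (μ := m)
  have hle : ∫⁻ z, ENNReal.ofReal (F z ^ 2) ∂m ≤ ENNReal.ofReal (2 * σ₁ ^ 2 * (d + secondMoment pdata)) := by
    calc ∫⁻ z, ENNReal.ofReal (F z ^ 2) ∂m
        ≤ ∫⁻ z, ENNReal.ofReal (2 * σ 1 ^ 2 * (‖z.1‖ ^ 2 + ‖z.2‖ ^ 2)) ∂m :=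
          lintegral_mono fun z => ENNReal.ofReal_le_ofReal (hpt z)
      _ = _ := by
          rw [← ofReal_integral_eq_lintegral_ofReal hG (ae_of_all _ fun z => by positivity),
            integral_const_mul, integral_add hy hg, h.one]
          congr 2
          rw [add_comm]
          congr 1
          · rw [← integral_norm_sq_stdGaussian (d := d)]
            have : stdGaussian (Euc d) = m.map Prod.snd := by rw [hmdef, ← Measure.snd, Measure.snd_prod]
            conv_rhs => rw [this]
            rw [integral_map (by fun_prop) (by fun_prop)]
          · rw [secondMoment]
            have : pdata = m.map Prod.fst := by rw [hmdef, ← Measure.fst, Measure.fst_prod]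
            conv_rhs => rw [this]
            rw [integral_map (by fun_prop) (by fun_prop)]
  have hM : 0 ≤ secondMoment pdata := integral_nonneg fun x => by positivity
  exact (ENNReal.ofReal_le_ofReal_iff (by positivity)).1 (hsq.trans hle)

lemma blDist_sq_le (pdata : Measure (Euc d)) [IsProbabilityMeasure pdata]
    (hm : Integrable (fun x : Euc d => ‖x‖ ^ 2) pdata) (h : IsVPSchedule T σ σ₁)
    (μ : Measure (Euc d)) [IsProbabilityMeasure μ] :
    blDist pdata μ ^ 2 ≤ ENNReal.ofReal (4 * σ₁ ^ 2 * (d + secondMoment pdata)) +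
      24 * klDiv (forwardLaw pdata σ 1) μ := by
  have := isProbabilityMeasure_forwardLaw pdata h h.one_le
  set R := ENNReal.ofReal (4 * σ₁ ^ 2 * (d + secondMoment pdata)) +
      24 * klDiv (forwardLaw pdata σ 1) μ with hR
  have hM : 0 ≤ secondMoment pdata := integral_nonneg fun x => by positivity
  suffices hs : blDist pdata μ ≤ R ^ (1 / 2 : ℝ) by
    calc blDist pdata μ ^ 2 ≤ (R ^ (1 / 2 : ℝ)) ^ 2 := by gcongr
      _ = R := by rw [← ENNReal.rpow_natCast, ← ENNReal.rpow_mul]; norm_num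
  refine iSup₂_le fun f hf => ?_
  obtain ⟨hf1, hfl⟩ := hf
  have key : ENNReal.ofReal (∫ x, f x ∂pdata - ∫ x, f x ∂μ) ^ 2 ≤ R := by
    set a := ∫ x, f x ∂pdata - ∫ x, f x ∂(forwardLaw pdata σ 1) with ha
    set b := ∫ x, f x ∂(forwardLaw pdata σ 1) - ∫ x, f x ∂μ with hb
    have hab : ∫ x, f x ∂pdata - ∫ x, f x ∂μ = a + b := by ring
    have h1 : a ^ 2 ≤ 2 * σ₁ ^ 2 * (d + secondMoment pdata) := sq_integral_sub_forwardLaw_le pdata hm h hf1 hfl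
    have h2 : ENNReal.ofReal (b ^ 2) ≤ 12 * klDiv (forwardLaw pdata σ 1) μ :=
      sq_integral_sub_le_klDiv _ _ hfl.continuous.measurable hf1
    calc ENNReal.ofReal (∫ x, f x ∂pdata - ∫ x, f x ∂μ) ^ 2
        ≤ ENNReal.ofReal |a + b| ^ 2 := by rw [hab]; gcongr; exact le_abs_self _
      _ = ENNReal.ofReal ((a + b) ^ 2) := by rw [← ENNReal.ofReal_pow (abs_nonneg _), sq_abs]
      _ ≤ ENNReal.ofReal (4 * σ₁ ^ 2 * (d + secondMoment pdata) + 2 * b ^ 2) :=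
          ENNReal.ofReal_le_ofReal (by nlinarith [sq_nonneg (a - b)])
      _ ≤ _ := by
          rw [ENNReal.ofReal_add (by positivity) (by positivity), hR,
            ENNReal.ofReal_mul (by norm_num : (0 : ℝ) ≤ 2)]
          refine add_le_add le_rfl ?_
          calc ENNReal.ofReal 2 * ENNReal.ofReal (b ^ 2)
              ≤ ENNReal.ofReal 2 * (12 * klDiv (forwardLaw pdata σ 1) μ) := by gcongr
            _ = 24 * klDiv (forwardLaw pdata σ 1) μ := by
              rw [← mul_assoc]; congr 1
              rw [ENNReal.ofReal_ofNat]; norm_num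
  calc ENNReal.ofReal (∫ x, f x ∂pdata - ∫ x, f x ∂μ)
      = (ENNReal.ofReal (∫ x, f x ∂pdata - ∫ x, f x ∂μ) ^ 2) ^ (1 / 2 : ℝ) := by
        rw [← ENNReal.rpow_natCast, ← ENNReal.rpow_mul]; norm_num
    _ ≤ R ^ (1 / 2 : ℝ) := ENNReal.rpow_le_rpow key (by norm_num)

end BoundedLipschitz

/-! ### Tail bound for the total number of queries. -/

section Queries

variable {d : ℕ} {B : ℝ} {s : ℕ → Euc d → Euc d} {σ : ℕ → ℝ} {T : ℕ}

lemma isProbabilityMeasure_outputLaw (hs : ∀ t, Measurable (s t)) :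
    IsProbabilityMeasure (outputLaw B s σ T) := by
  have := isProbabilityMeasure_isoGaussian (0 : Euc d) (σ T ^ 2)
  have := isProbabilityMeasure_backwardLaw (B := B) (σ := σ) (T := T)
    (init := isoGaussian 0 (σ T ^ 2)) hs (T - 1)
  exact Measure.isProbabilityMeasure_map (μ := backwardLaw B s σ T (isoGaussian 0 (σ T ^ 2)) (T - 1))
    measurable_fst.aemeasurable

lemma le_queryLaw (hB : 0 < B) (hs : ∀ t, Measurable (s t)) {ε x : ℝ} (hε : 0 < ε)
    (hx : (2 * B + Real.log 4) * T + Real.log (1 / ε) ≤ queryRate B * x) :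
    ENNReal.ofReal (1 - ε) ≤ queryLaw B s σ T {n | (n : ℝ) ≤ x} := by
  have := isProbabilityMeasure_isoGaussian (0 : Euc d) (σ T ^ 2)
  have hp := isProbabilityMeasure_backwardLaw (B := B) (σ := σ) (T := T)
    (init := isoGaussian 0 (σ T ^ 2)) hs (T - 1)
  have hpq : IsProbabilityMeasure (queryLaw B s σ T) := Measure.isProbabilityMeasure_map
    (μ := backwardLaw B s σ T (isoGaussian 0 (σ T ^ 2)) (T - 1)) measurable_snd.aemeasurable
  have hq := queryRate_pos hB
  have hlog4 : 0 ≤ Real.log 4 := Real.log_nonneg (by norm_num)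
  have hE := lintegral_exp_query_le (σ := σ) (T := T) (init := isoGaussian 0 (σ T ^ 2)) hB hs (T - 1)
  have hE' : ∫⁻ n, ENNReal.ofReal (Real.exp (queryRate B * n)) ∂(queryLaw B s σ T) ≤
      ENNReal.ofReal (Real.exp ((2 * B + Real.log 4) * T)) := by
    rw [queryLaw, samplerLaw, lintegral_map (by fun_prop) measurable_snd]
    refine hE.trans ?_
    rw [← ENNReal.ofReal_pow (by positivity)]
    refine ENNReal.ofReal_le_ofReal ?_
    have : 4 * Real.exp (2 * B) = Real.exp (2 * B + Real.log 4) := by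
      rw [Real.exp_add, Real.exp_log (by norm_num)]; ring
    rw [this, ← Real.exp_nat_mul, mul_comm]
    refine Real.exp_le_exp.2 (mul_le_mul_of_nonneg_left ?_ (by positivity))
    exact_mod_cast Nat.sub_le _ _
  have hbad : queryLaw B s σ T {n | (n : ℝ) ≤ x}ᶜ ≤ ENNReal.ofReal ε := by
    have h1 := mul_meas_ge_le_lintegral (μ := queryLaw B s σ T)
      (f := fun n : ℕ => ENNReal.ofReal (Real.exp (queryRate B * n))) (by fun_prop)
      (ENNReal.ofReal (Real.exp (queryRate B * x)))
    have h2 : queryLaw B s σ T {n | (n : ℝ) ≤ x}ᶜ ≤ queryLaw B s σ T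
        {n : ℕ | ENNReal.ofReal (Real.exp (queryRate B * x)) ≤ ENNReal.ofReal (Real.exp (queryRate B * n))} := by
      refine measure_mono fun n hn => ?_
      have hn' : x < n := not_le.1 hn
      exact ENNReal.ofReal_le_ofReal (Real.exp_le_exp.2 (by gcongr))
    have h3 : ENNReal.ofReal (Real.exp (queryRate B * x)) * queryLaw B s σ T {n | (n : ℝ) ≤ x}ᶜ ≤
        ENNReal.ofReal (Real.exp (queryRate B * x)) * ENNReal.ofReal ε := by
      refine (mul_le_mul_right h2 _).trans (h1.trans (hE'.trans ?_))
      rw [← ENNReal.ofReal_mul (Real.exp_pos _).le]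
      refine ENNReal.ofReal_le_ofReal ?_
      rw [← Real.exp_log hε, ← Real.exp_add]
      refine Real.exp_le_exp.2 ?_
      rw [one_div, Real.log_inv] at hx
      linarith
    exact (ENNReal.mul_le_mul_iff_right (by simp [Real.exp_pos]) ENNReal.ofReal_ne_top).1 h3
  rw [ENNReal.ofReal_sub _ hε.le, ENNReal.ofReal_one, tsub_le_iff_right]
  calc (1 : ℝ≥0∞) = queryLaw B s σ T Set.univ := measure_univ.symm
    _ = queryLaw B s σ T {n | (n : ℝ) ≤ x} + queryLaw B s σ T {n | (n : ℝ) ≤ x}ᶜ :=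
      (measure_add_measure_compl (MeasurableSet.of_discrete)).symm
    _ ≤ _ := by gcongr

end Queries
end

noncomputable section

/-! ### The noise schedule -/

section Schedule

/-- The schedule with first noise level `σ₀` along which `σ_t² / (1 - σ_t²)` grows by the factor `1 + h`. -/
def geomSchedule (σ₀ h : ℝ) (t : ℕ) : ℝ :=
  if t = 0 then 0 else √((σ₀ ^ 2 / (1 - σ₀ ^ 2) * (1 + h) ^ (t - 1)) /
    (1 + σ₀ ^ 2 / (1 - σ₀ ^ 2) * (1 + h) ^ (t - 1)))

variable {σ₀ h : ℝ}

lemma geomSchedule_ratio_pos (h0 : 0 < σ₀) (h1 : σ₀ < 1) (hh : 0 < h) (n : ℕ) :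
    0 < σ₀ ^ 2 / (1 - σ₀ ^ 2) * (1 + h) ^ n := by
  have : 0 < 1 - σ₀ ^ 2 := by nlinarith
  positivity

lemma sq_geomSchedule_succ (h0 : 0 < σ₀) (h1 : σ₀ < 1) (hh : 0 < h) (n : ℕ) :
    geomSchedule σ₀ h (n + 1) ^ 2 = (σ₀ ^ 2 / (1 - σ₀ ^ 2) * (1 + h) ^ n) /
      (1 + σ₀ ^ 2 / (1 - σ₀ ^ 2) * (1 + h) ^ n) := by
  have := geomSchedule_ratio_pos h0 h1 hh n
  rw [geomSchedule, if_neg n.succ_ne_zero, Nat.add_sub_cancel, Real.sq_sqrt (by positivity)]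

lemma sq_vpAlphaBar_geomSchedule_succ (h0 : 0 < σ₀) (h1 : σ₀ < 1) (hh : 0 < h) (n : ℕ) :
    vpAlphaBar (geomSchedule σ₀ h) (n + 1) ^ 2 = 1 / (1 + σ₀ ^ 2 / (1 - σ₀ ^ 2) * (1 + h) ^ n) := by
  have := geomSchedule_ratio_pos h0 h1 hh n
  have key : 1 - geomSchedule σ₀ h (n + 1) ^ 2 = 1 / (1 + σ₀ ^ 2 / (1 - σ₀ ^ 2) * (1 + h) ^ n) := by
    rw [sq_geomSchedule_succ h0 h1 hh]
    generalize σ₀ ^ 2 / (1 - σ₀ ^ 2) * (1 + h) ^ n = x at *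
    field_simp
    ring
  rw [vpAlphaBar, key, Real.sq_sqrt (by positivity)]

/-- With ρ = σ²/(1-σ²), η_t = ᾱ_t²(ρ_{t+1} - ρ_t), so geometric growth of ρ makes the step variance
proportional to σ_t², the scale at which p_t is smooth. The case t = 0 is different because σ_0 = 0.
-/
lemma vpEta_geomSchedule (h0 : 0 < σ₀) (h1 : σ₀ < 1) (hh : 0 < h) {t : ℕ} (ht : 1 ≤ t) :
    vpEta (geomSchedule σ₀ h) t = h * geomSchedule σ₀ h t ^ 2 := by
  obtain ⟨n, rfl⟩ : ∃ n, t = n + 1 := ⟨t - 1, by omega⟩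
  have hn := geomSchedule_ratio_pos h0 h1 hh n
  have hn1 := geomSchedule_ratio_pos h0 h1 hh (n + 1)
  rw [vpEta, vpAlpha, div_pow, sq_vpAlphaBar_geomSchedule_succ h0 h1 hh,
    sq_vpAlphaBar_geomSchedule_succ h0 h1 hh, sq_geomSchedule_succ h0 h1 hh,
    sq_geomSchedule_succ h0 h1 hh]
  have hs : σ₀ ^ 2 / (1 - σ₀ ^ 2) * (1 + h) ^ (n + 1) = σ₀ ^ 2 / (1 - σ₀ ^ 2) * (1 + h) ^ n * (1 + h) := by
    rw [pow_succ (1 + h), mul_assoc]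
  rw [hs] at hn1 ⊢
  generalize σ₀ ^ 2 / (1 - σ₀ ^ 2) * (1 + h) ^ n = x at *
  field_simp
  ring

lemma geomSchedule_one (h0 : 0 < σ₀) (h1 : σ₀ < 1) : geomSchedule σ₀ h 1 = σ₀ := by
  have : 0 < 1 - σ₀ ^ 2 := by nlinarith
  rw [geomSchedule, if_neg one_ne_zero, Nat.sub_self, pow_zero, mul_one]
  have : σ₀ ^ 2 / (1 - σ₀ ^ 2) / (1 + σ₀ ^ 2 / (1 - σ₀ ^ 2)) = σ₀ ^ 2 := by field_simp; ring
  rw [this, Real.sqrt_sq h0.le]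

lemma isVPSchedule_geomSchedule (h0 : 0 < σ₀) (h1 : σ₀ < 1) (hh : 0 < h) {T : ℕ} (hT : 1 ≤ T) :
    IsVPSchedule T (geomSchedule σ₀ h) σ₀ := by
  have hnn : ∀ t, 0 ≤ geomSchedule σ₀ h t := fun t => by
    unfold geomSchedule; split_ifs; exacts [le_rfl, Real.sqrt_nonneg _]
  have hpos : ∀ t, 1 ≤ t → 0 < geomSchedule σ₀ h t := fun t ht => by
    obtain ⟨n, rfl⟩ : ∃ n, t = n + 1 := ⟨t - 1, by omega⟩
    have := geomSchedule_ratio_pos h0 h1 hh n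
    refine lt_of_le_of_ne (hnn _) fun h0' => ?_
    have hsq := sq_geomSchedule_succ h0 h1 hh n
    rw [← h0'] at hsq
    refine absurd hsq (ne_of_lt ?_)
    rw [sq, mul_zero]
    positivity
  refine ⟨hT, by simp [geomSchedule], geomSchedule_one h0 h1, fun t ht _ => hpos t ht, fun t ht _ => ?_,
    fun t _ => ?_⟩
  · obtain ⟨n, rfl⟩ : ∃ n, t = n + 1 := ⟨t - 1, by omega⟩
    have := geomSchedule_ratio_pos h0 h1 hh n
    refine (sq_lt_one_iff₀ (hnn _)).1 ?_
    rw [sq_geomSchedule_succ h0 h1 hh, div_lt_one (by positivity)]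
    linarith
  · rcases Nat.eq_zero_or_pos t with rfl | ht
    · have hz : geomSchedule σ₀ h 0 = 0 := by simp [geomSchedule]
      have h1' : 0 < 1 - σ₀ ^ 2 := by nlinarith
      rw [vpEta, vpAlpha, vpAlphaBar, vpAlphaBar, zero_add, geomSchedule_one h0 h1, hz]
      have : 0 < √(1 - σ₀ ^ 2) := Real.sqrt_pos.2 h1'
      simp only [ne_eq, OfNat.ofNat_ne_zero, not_false_eq_true, zero_pow, sub_zero, Real.sqrt_one, div_one]
      positivity
    · rw [vpEta_geomSchedule h0 h1 hh ht]
      have := hpos t ht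
      positivity

lemma sq_vpAlphaBar_div_geomSchedule_le (h0 : 0 < σ₀) (h1 : σ₀ < 1) (hh : 0 < h) (n : ℕ) :
    (vpAlphaBar (geomSchedule σ₀ h) (n + 1) / geomSchedule σ₀ h (n + 1)) ^ 2 ≤
      1 / (σ₀ ^ 2 * (1 + h) ^ n) := by
  have hn := geomSchedule_ratio_pos h0 h1 hh n
  have h1' : 0 < 1 - σ₀ ^ 2 := by nlinarith
  rw [div_pow, sq_vpAlphaBar_geomSchedule_succ h0 h1 hh, sq_geomSchedule_succ h0 h1 hh]
  have : 1 / (1 + σ₀ ^ 2 / (1 - σ₀ ^ 2) * (1 + h) ^ n) / ((σ₀ ^ 2 / (1 - σ₀ ^ 2) * (1 + h) ^ n) /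
      (1 + σ₀ ^ 2 / (1 - σ₀ ^ 2) * (1 + h) ^ n)) = 1 / (σ₀ ^ 2 / (1 - σ₀ ^ 2) * (1 + h) ^ n) := by
    field_simp
  rw [this]
  refine one_div_le_one_div_of_le (by positivity) ?_
  gcongr
  rw [le_div_iff₀ h1']
  nlinarith [sq_nonneg (σ₀ ^ 2)]

lemma exp_mul_half_le_one_add_pow (hh : 0 ≤ h) (hh1 : h ≤ 1) (n : ℕ) :
    Real.exp (n * (h / 2)) ≤ (1 + h) ^ n := by
  rw [Real.exp_nat_mul]
  gcongr
  have h1 := Real.one_sub_le_exp_neg (h / 2)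
  rw [Real.exp_neg] at h1
  have h2 := Real.exp_pos (h / 2)
  have h3 : (1 - h / 2) * Real.exp (h / 2) ≤ 1 := by
    calc (1 - h / 2) * Real.exp (h / 2) ≤ (Real.exp (h / 2))⁻¹ * Real.exp (h / 2) := by gcongr
      _ = 1 := inv_mul_cancel₀ h2.ne'
  nlinarith

end Schedule

/-! ### Choice of the step size and the resulting tail exponent. -/

section StepSize

variable {a L c B : ℝ}

/-- The exponent in the probability that a step is not good. -/
def tailExponent (a L : ℝ) : ℝ := √(min a L * L)

lemma sq_tailExponent (ha : 1 ≤ a) (hL : 1 / 2 ≤ L) : tailExponent a L ^ 2 = min a L * L :=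
  Real.sq_sqrt (mul_nonneg (le_min (by linarith) (by linarith)) (by linarith))

lemma le_tailExponent {l : ℝ} (hl : 0 ≤ l) (hla : l ≤ a) (hlL : l ≤ L) : l ≤ tailExponent a L := by
  refine Real.le_sqrt_of_sq_le ?_
  rw [sq]
  exact mul_le_mul (le_min hla hlL) hlL hl (hl.trans (le_min hla hlL))

lemma min_le_tailExponent (ha : 1 ≤ a) (hL : 1 / 2 ≤ L) : min a L ≤ tailExponent a L :=
  le_tailExponent (le_min (by linarith) (by linarith)) (min_le_left _ _) (min_le_right _ _)

/-- Here aL² is the order of the number of steps. If a ≤ L then L ≤ S², so aL² = S²L ≤ S⁴ ≤ 24e^S.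
If L ≤ a then S = L and the hypothesis a ≤ 2e^L takes over. -/
lemma mul_sq_le_exp_tailExponent (ha : 1 ≤ a) (hL : 1 / 2 ≤ L) (haL : a ≤ 2 * Real.exp L) :
    a * L ^ 2 ≤ 24 * Real.exp (2 * tailExponent a L) := by
  have hS := sq_tailExponent ha hL
  set S := tailExponent a L with hSdef
  have hS0 : 0 ≤ S := Real.sqrt_nonneg _
  rcases le_total a L with h | h
  · rw [min_eq_left h] at hS
    have h1 : L ≤ S ^ 2 := by nlinarith
    have h2 : a * L ^ 2 ≤ S ^ 4 := by
      calc a * L ^ 2 = S ^ 2 * L := by rw [hS]; ring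
        _ ≤ S ^ 2 * S ^ 2 := by gcongr
        _ = S ^ 4 := by ring
    have h3 : S ^ 4 / 24 ≤ Real.exp S := by
      have := Real.pow_div_factorial_le_exp S hS0 4
      simpa [Nat.factorial] using this
    have h4 : Real.exp S ≤ Real.exp (2 * S) := Real.exp_le_exp.2 (by linarith)
    linarith
  · rw [min_eq_right h] at hS
    have hSL : S = L := by
      rw [← sq] at hS
      exact (sq_eq_sq₀ hS0 (by linarith)).1 hS
    rw [hSL]
    have h3 : L ^ 2 ≤ 2 * Real.exp L := sq_le_two_mul_exp (by linarith)
    calc a * L ^ 2 ≤ (2 * Real.exp L) * (2 * Real.exp L) := by gcongr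
      _ = 4 * Real.exp (2 * L) := by rw [two_mul L, Real.exp_add]; ring
      _ ≤ 24 * Real.exp (2 * L) := by gcongr; norm_num

variable {d : ℕ} {p : Euc d → ℝ} {σ η h : ℝ}

/-- The Chernoff parameter 17S/B gives the exponent 17S/2, of which at most S/2 is lost to the
dimension. Here c ≤ B²/580 makes 289c/B² ≤ 1/2, and c ≤ B/144 gives the norm event an exponent of at
least 18aL. The exponent S = min(L, √(aL)) reflects the two constraints on the parameter, from the
dimension term and from the range of the Gaussian moment bound. -/
lemma measure_compl_goodStep_le_exp (hp : LogSmooth p σ) (hp1 : ∫⁻ x, ENNReal.ofReal (p x) = 1)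
    (hσ : 0 < σ) (hB : 0 < B) (hc0 : 0 < c) (hc1 : c ≤ B ^ 2 / 580) (hc2 : c ≤ B / 144)
    (hd : (d : ℝ) ≤ a) (ha : 1 ≤ a) (hL : 1 / 2 ≤ L) (hh : h = c / (a * L)) (hη : η = h * σ ^ 2) :
    stateNoise p (goodStep p η h (B / 2))ᶜ ≤
      ENNReal.ofReal ((2 + Real.exp B) * Real.exp (-8 * tailExponent a L)) := by
  have haL : 0 < a * L := by positivity
  have hh0 : 0 < h := by rw [hh]; positivity
  have hS := sq_tailExponent ha hL
  have hmS := min_le_tailExponent ha hL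
  have hS1 : 1 / 2 ≤ tailExponent a L := (le_min (by linarith) hL).trans hmS
  set S := tailExponent a L with hSdef
  have hSaL : S ^ 2 ≤ a * L := by
    rw [hS]; gcongr; exact min_le_left _ _
  have hch : (17 * S / B) ^ 2 * h = 289 * c / B ^ 2 * (S ^ 2 / (a * L)) := by
    rw [hh]; field_simp; ring
  have hcB : 289 * c / B ^ 2 ≤ 1 / 2 := by
    rw [div_le_iff₀ (by positivity)]; linarith
  have hcB0 : 0 ≤ 289 * c / B ^ 2 := by positivity
  have h1 : (17 * S / B) ^ 2 * h ≤ 1 / 2 := by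
    rw [hch]
    have : S ^ 2 / (a * L) ≤ 1 := (div_le_one haL).2 hSaL
    have : 0 ≤ S ^ 2 / (a * L) := by positivity
    nlinarith
  have h2 : (17 * S / B) ^ 2 * h * d ≤ S / 2 := by
    rw [hch, mul_assoc]
    have h3 : S ^ 2 / (a * L) * d ≤ S := by
      rw [div_mul_eq_mul_div, div_le_iff₀ haL, hS]
      have hm0 : 0 ≤ min a L := le_min (by linarith) (by linarith)
      calc min a L * L * d ≤ S * L * a := by gcongr
        _ = S * (a * L) := by ring
    have h4 : 0 ≤ S ^ 2 / (a * L) * d := by positivity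
    nlinarith
  have hgood := measure_compl_goodStep_le (β := B / 2) (c := 17 * S / B) hp hp1 hσ hh0 hη (by positivity)
    (by positivity) h1
  refine hgood.trans (ENNReal.ofReal_le_ofReal ?_)
  have e1 : Real.exp ((17 * S / B) ^ 2 * h * d - 17 * S / B * (B / 2)) ≤ Real.exp (-8 * S) := by
    refine Real.exp_le_exp.2 ?_
    have : 17 * S / B * (B / 2) = 17 / 2 * S := by field_simp
    linarith
  have e2 : Real.exp (d / 2 - B / 2 / (4 * h)) ≤ Real.exp (-8 * S) := by
    refine Real.exp_le_exp.2 ?_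
    have h5 : 18 * (a * L) ≤ B / 2 / (4 * h) := by
      rw [hh, le_div_iff₀ (by positivity)]
      have : 18 * (a * L) * (4 * (c / (a * L))) = 72 * c := by field_simp; ring
      linarith
    have h6 : (d : ℝ) / 2 ≤ a * L := by nlinarith
    nlinarith
  have e3 : Real.exp (2 * (B / 2)) = Real.exp B := by congr 1; ring
  rw [e3]
  have := Real.exp_pos B
  nlinarith

lemma klDiv_step_le_exp {s : Euc d → Euc d} (hp : LogSmooth p σ) (hp1 : ∫⁻ x, ENNReal.ofReal (p x) = 1)
    (hs : Measurable s) (hσ : 0 < σ) (hB : 0 < B) (hc0 : 0 < c) (hc1 : c ≤ B ^ 2 / 580) (hc2 : c ≤ B / 144)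
    (hc3 : c ≤ 1 / 4) (hd : (d : ℝ) ≤ a) (ha : 1 ≤ a) (hL : 1 / 2 ≤ L) (hh : h = c / (a * L))
    (hη : η = h * σ ^ 2) :
    klDiv (((volume : Measure (Euc d)).prod (stdGaussian (Euc d))).withDensity
        fun z => ENNReal.ofReal (p (z.1 + √η • z.2)))
      (((volume : Measure (Euc d)).prod (stdGaussian (Euc d))).withDensity
        fun z => ENNReal.ofReal (p z.1 * Real.exp (stepWeight B s η z))) ≤
      ENNReal.ofReal (Real.exp (3 * B)) * (ENNReal.ofReal η *
        ∫⁻ x, ENNReal.ofReal (p x) * ‖s x - gradient (fun y => Real.log (p y)) x‖ₑ ^ 2) +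
      ENNReal.ofReal (((Real.exp B + 1) * (2 + Real.exp B) + 6 * (B ^ 2 + 3 * Real.exp 1)) *
        Real.exp (-4 * tailExponent a L)) := by
  have haL : 1 / 2 ≤ a * L := by nlinarith
  have hh0 : 0 < h := by rw [hh]; positivity
  have hh2 : h ≤ 1 / 2 := by
    rw [hh, div_le_iff₀ (by positivity)]; linarith
  have hhd : h * d ≤ 1 := by
    rw [hh, div_mul_eq_mul_div, div_le_one (by positivity)]
    calc c * d ≤ (1 / 4) * a := by gcongr
      _ ≤ a * L := by nlinarith
  have hP := measure_compl_goodStep_le_exp hp hp1 hσ hB hc0 hc1 hc2 hd ha hL hh hη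
  set S := tailExponent a L with hSdef
  have hS0 : 0 ≤ S := Real.sqrt_nonneg _
  -- The bad probability is of order e^{-8S}, so τ = e^{-4S} balances τ against its quotient by τ.
  refine (klDiv_step_le (τ := Real.exp (-4 * S)) hp hp1 hs hσ hB hh0.le hη hh2 hhd (Real.exp_pos _)
    (by positivity) hP).trans ?_
  refine add_le_add le_rfl (ENNReal.ofReal_le_ofReal ?_)
  have e8 : Real.exp (-8 * S) = Real.exp (-4 * S) * Real.exp (-4 * S) := by
    rw [← Real.exp_add]; congr 1; ring
  have e4 := Real.exp_pos (-4 * S)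
  have e41 : Real.exp (-4 * S) ≤ 1 := Real.exp_le_one_iff.2 (by linarith)
  rw [e8, mul_div_assoc, mul_div_assoc, div_self e4.ne', mul_one]
  have hB' := Real.exp_pos B
  have : Real.exp B * ((2 + Real.exp B) * (Real.exp (-4 * S) * Real.exp (-4 * S))) ≤
      Real.exp B * ((2 + Real.exp B) * (Real.exp (-4 * S) * 1)) := by gcongr
  linarith

end StepSize

/-! ### Assembly of the error bounds. -/

section Main

lemma mul_exp_neg_tailExponent_le {a L l C δ t : ℝ} (hC : 0 ≤ C) (ha : 1 ≤ a) (hL : 1 / 2 ≤ L)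
    (haL : a ≤ 2 * Real.exp L) (ht : t ≤ C * (a * L ^ 2)) (hδ : Real.exp (-l) = δ)
    (hl : l ≤ tailExponent a L) : t * Real.exp (-4 * tailExponent a L) ≤ C * 24 * δ ^ 2 := by
  have h1 := mul_sq_le_exp_tailExponent ha hL haL
  set S := tailExponent a L
  calc t * Real.exp (-4 * S) ≤ C * (24 * Real.exp (2 * S)) * Real.exp (-4 * S) := by
        gcongr; exact ht.trans (by gcongr)
    _ = C * 24 * Real.exp (-S) ^ 2 := by
        rw [← Real.exp_nat_mul, mul_assoc, mul_assoc 24, ← Real.exp_add, mul_assoc]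
        push_cast; ring_nf
    _ ≤ C * 24 * δ ^ 2 := by
        rw [← hδ]; gcongr

lemma klDiv_geomSchedule_isoGaussian_le {d : ℕ} (hd : 1 ≤ d) (pdata : Measure (Euc d))
    [IsProbabilityMeasure pdata] (hm : Integrable (fun x : Euc d => ‖x‖ ^ 2) pdata) {δ σ₀ h : ℝ}
    (hδ : 0 < δ) (h0 : 0 < σ₀) (h1 : σ₀ < 1) (hh0 : 0 < h) (hh1 : h ≤ 1) {n : ℕ}
    (hn : 4 * Real.log (((d + secondMoment pdata) / σ₀ ^ 2) / δ) ≤ n * h) :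
    klDiv (forwardLaw pdata (geomSchedule σ₀ h) (n + 1)) (isoGaussian 0 (geomSchedule σ₀ h (n + 1) ^ 2)) ≤
      ENNReal.ofReal (δ ^ 2) := by
  refine (klDiv_forwardLaw_isoGaussian_le pdata hm
    (isVPSchedule_geomSchedule h0 h1 hh0 (Nat.le_add_left 1 n))).trans (ENNReal.ofReal_le_ofReal ?_)
  have hM0 : 0 ≤ secondMoment pdata := integral_nonneg fun x => by positivity
  have hd1 : (1 : ℝ) ≤ d := by exact_mod_cast hd
  set M := secondMoment pdata
  set κ := (d + M) / σ₀ ^ 2 with hκ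
  have hκ1 : 1 ≤ κ := by
    rw [hκ, le_div_iff₀ (by positivity)]; nlinarith
  -- The factor 4 in the hypothesis pays for the square here and for the half in (1 + h)^n ≥
  -- e^{nh/2}.
  have h2 : (κ / δ) ^ 2 ≤ (1 + h) ^ n := by
    refine le_trans ?_ (exp_mul_half_le_one_add_pow hh0.le hh1 n)
    rw [← Real.exp_log (show 0 < κ / δ by positivity), ← Real.exp_nat_mul]
    refine Real.exp_le_exp.2 ?_
    push_cast
    linarith
  have h3 : M ≤ δ ^ 2 * (σ₀ ^ 2 * (1 + h) ^ n) := by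
    calc M ≤ d + M := by linarith
      _ = σ₀ ^ 2 * κ := by rw [hκ]; field_simp
      _ ≤ σ₀ ^ 2 * κ ^ 2 := by gcongr; nlinarith
      _ = δ ^ 2 * (σ₀ ^ 2 * (κ / δ) ^ 2) := by field_simp
      _ ≤ _ := by gcongr
  have hpos : 0 < σ₀ ^ 2 * (1 + h) ^ n := by positivity
  calc (vpAlphaBar (geomSchedule σ₀ h) (n + 1) / geomSchedule σ₀ h (n + 1)) ^ 2 * M / 2
      ≤ 1 / (σ₀ ^ 2 * (1 + h) ^ n) * M / 2 := by
        gcongr; exact sq_vpAlphaBar_div_geomSchedule_le h0 h1 hh0 n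
    _ = M / (σ₀ ^ 2 * (1 + h) ^ n) / 2 := by ring
    _ ≤ δ ^ 2 / 2 := by gcongr; rwa [div_le_iff₀ hpos]
    _ ≤ δ ^ 2 := by linarith [sq_nonneg δ]

lemma exists_stepSize {c a L : ℝ} (hc0 : 0 < c) (hc1 : c ≤ 1 / 4) (ha : 1 ≤ a) (hL : 1 / 2 ≤ L) :
    ∃ (h : ℝ) (n : ℕ), h = c / (a * L) ∧ 0 < h ∧ h ≤ 1 ∧ 4 * L ≤ n * h ∧
      (n : ℝ) + 1 ≤ (8 + 4 / c) * (a * L ^ 2) := by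
  have haL : 1 / 2 ≤ a * L := by nlinarith
  refine ⟨c / (a * L), ⌈4 * L / (c / (a * L))⌉₊, rfl, by positivity, ?_, ?_, ?_⟩
  · rw [div_le_one (by positivity)]; linarith
  · exact (div_le_iff₀ (by positivity)).1 (Nat.le_ceil _)
  -- Rounding up and the extra step cost at most 2 ≤ 8aL², the source of the 8.
  · have h1 : 1 / 4 ≤ a * L ^ 2 := by nlinarith
    have h2 := Nat.ceil_lt_add_one (show 0 ≤ 4 * L / (c / (a * L)) by positivity)
    have h3 : 4 * L / (c / (a * L)) = 4 / c * (a * L ^ 2) := by field_simp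
    linarith

lemma klDiv_outputLaw_le {d : ℕ} {B : ℝ} (hB : 0 < B) {s : ℕ → Euc d → Euc d} (hs : ∀ t, Measurable (s t))
    (pdata : Measure (Euc d)) [IsProbabilityMeasure pdata] {T : ℕ} {σ : ℕ → ℝ} {σ₀ : ℝ}
    (hsch : IsVPSchedule T σ σ₀) {a L c h : ℝ} (hc0 : 0 < c) (hc1 : c ≤ B ^ 2 / 580) (hc2 : c ≤ B / 144)
    (hc3 : c ≤ 1 / 4) (hd : (d : ℝ) ≤ a) (ha : 1 ≤ a) (hL : 1 / 2 ≤ L) (hh : h = c / (a * L))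
    (hη : ∀ t, 1 ≤ t → vpEta σ t = h * σ t ^ 2) :
    klDiv (forwardLaw pdata σ 1) (outputLaw B s σ T) ≤
      klDiv (forwardLaw pdata σ T) (isoGaussian 0 (σ T ^ 2)) +
      (ENNReal.ofReal (Real.exp (3 * B)) * totalScoreError pdata s σ T +
      ((T - 1 : ℕ) : ℝ≥0∞) * ENNReal.ofReal (((Real.exp B + 1) * (2 + Real.exp B) +
        6 * (B ^ 2 + 3 * Real.exp 1)) * Real.exp (-4 * tailExponent a L))) := by
  have := isProbabilityMeasure_isoGaussian (0 : Euc d) (σ T ^ 2)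
  have hchain := klDiv_forward_backward_le (init := isoGaussian 0 (σ T ^ 2)) hB hs pdata hsch
    (fun t => ENNReal.ofReal (Real.exp (3 * B)) * (ENNReal.ofReal (vpEta σ t) *
      scoreErrorSq (forwardLaw pdata σ t) (s t)) + ENNReal.ofReal (((Real.exp B + 1) * (2 + Real.exp B) +
        6 * (B ^ 2 + 3 * Real.exp 1)) * Real.exp (-4 * tailExponent a L))) (by
    intro t ht1 htT
    have hls := logSmooth_forwardDensity pdata hsch ht1 htT.le
    have hlaw := forwardLaw_eq_withDensity pdata hsch ht1 htT.le
    have hprob := isProbabilityMeasure_forwardLaw pdata hsch htT.le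
    have hp1 : ∫⁻ x, ENNReal.ofReal (forwardDensity pdata σ t x) = 1 := by
      have := hprob.measure_univ
      rwa [hlaw, withDensity_apply _ MeasurableSet.univ, setLIntegral_univ] at this
    have herr : scoreErrorSq (forwardLaw pdata σ t) (s t) = ∫⁻ x, ENNReal.ofReal (forwardDensity pdata σ t x) *
        ‖s t x - gradient (fun y => Real.log (forwardDensity pdata σ t y)) x‖ₑ ^ 2 := by
      have hsm : Measurable fun x =>
          ‖s t x - gradient (fun y => Real.log (forwardDensity pdata σ t y)) x‖ₑ ^ 2 :=
        (((hs t).sub (measurable_gradient _)).enorm).pow_const 2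
      rw [scoreErrorSq, score_forwardLaw pdata hsch ht1 htT.le, hlaw,
        lintegral_withDensity_eq_lintegral_mul _ hls.diff.continuous.measurable.ennreal_ofReal hsm]
      rfl
    rw [herr]
    exact klDiv_step_le_exp hls hp1 (hs t) (hsch.pos t ht1 htT.le) hB hc0 hc1 hc2 hc3 hd ha hL hh
      (hη t ht1))
  change klDiv (forwardLaw pdata σ 1) (backwardState B s σ T (isoGaussian 0 (σ T ^ 2)) (T - 1)) ≤ _
  refine hchain.trans ?_
  rw [Finset.sum_add_distrib, ← Finset.mul_sum, Finset.sum_const, Nat.card_Ico, nsmul_eq_mul]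
  exact le_rfl

lemma exists_schedule_klDiv_le (B : ℝ) (hB : 0 < B) :
    ∃ C : ℝ, 0 < C ∧ ∀ d : ℕ, 1 ≤ d → ∀ (pdata : Measure (Euc d)) [IsProbabilityMeasure pdata],
      Integrable (fun x : Euc d => ‖x‖ ^ 2) pdata → ∀ δ : ℝ, 0 < δ → δ ≤ 1 / 2 →
      ∀ σ₀ : ℝ, 0 < σ₀ → σ₀ < 1 →
      ∃ (T : ℕ) (σ : ℕ → ℝ), IsVPSchedule T σ σ₀ ∧ Real.log (1 / δ) ≤ T ∧
        (T : ℝ) ≤ C * (d + Real.log (1 / δ)) *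
          Real.log (((d + secondMoment pdata) / σ₀ ^ 2) / δ) ^ 2 ∧
        ∀ s : ℕ → Euc d → Euc d, (∀ t, Measurable (s t)) →
          klDiv (forwardLaw pdata σ 1) (outputLaw B s σ T) ≤
            ENNReal.ofReal C * (ENNReal.ofReal (δ ^ 2) + totalScoreError pdata s σ T) := by
  obtain ⟨c, hc0, hc1, hc2, hc3⟩ : ∃ c : ℝ, 0 < c ∧ c ≤ B ^ 2 / 580 ∧ c ≤ B / 144 ∧ c ≤ 1 / 4 :=
    ⟨min (B ^ 2 / 580) (min (B / 144) (1 / 4)), by positivity, min_le_left _ _,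
      (min_le_right _ _).trans (min_le_left _ _), (min_le_right _ _).trans (min_le_right _ _)⟩
  set C₁ := (Real.exp B + 1) * (2 + Real.exp B) + 6 * (B ^ 2 + 3 * Real.exp 1) with hC₁
  have hC₁0 : 0 < C₁ := by positivity
  set C₂ := 8 + 4 / c with hC₂
  have hC₂0 : 0 < C₂ := by positivity
  clear_value C₁ C₂
  refine ⟨C₂ + Real.exp (3 * B) + (1 + C₁ * (C₂ * 24)), by positivity, ?_⟩
  intro d hd pdata _ hm δ hδ hδ2 σ₀ hσ0 hσ1
  set M := secondMoment pdata with hM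
  have hM0 : 0 ≤ M := integral_nonneg fun x => by positivity
  have hd1 : (1 : ℝ) ≤ d := by exact_mod_cast hd
  set l := Real.log (1 / δ) with hl
  set κ := (d + M) / σ₀ ^ 2 with hκ
  set L := Real.log (κ / δ) with hLdef
  have hdκ : (d : ℝ) ≤ κ := by
    rw [hκ, le_div_iff₀ (by positivity)]
    have : σ₀ ^ 2 ≤ 1 := by nlinarith
    nlinarith
  have hκ1 : 1 ≤ κ := hd1.trans hdκ
  have hl2 : 1 / 2 ≤ l := by
    have h1 : Real.log 2 ≤ l := Real.log_le_log (by norm_num) (by rw [le_div_iff₀ hδ]; linarith)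
    linarith [Real.log_two_gt_d9]
  have hlL : l ≤ L := Real.log_le_log (by positivity) (by gcongr)
  have hexpL : Real.exp L = κ / δ := Real.exp_log (by positivity)
  have hexpl : Real.exp (-l) = δ := by
    rw [hl, one_div, Real.log_inv, neg_neg, Real.exp_log hδ]
  have hL : 1 / 2 ≤ L := hl2.trans hlL
  set a := d + l with ha
  have ha1 : 1 ≤ a := by linarith
  have hda : (d : ℝ) ≤ a := by linarith
  have haL : a ≤ 2 * Real.exp L := by
    have h1 : (d : ℝ) ≤ Real.exp L := by
      rw [hexpL, le_div_iff₀ hδ]; nlinarith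
    have h2 := Real.add_one_le_exp L
    linarith
  obtain ⟨h, n, hh, hh0, hh1, hn1, hn2⟩ := exists_stepSize hc0 hc3 ha1 hL
  set T := n + 1 with hT
  set σ := geomSchedule σ₀ h with hσdef
  have hsch : IsVPSchedule T σ σ₀ := isVPSchedule_geomSchedule hσ0 hσ1 hh0 (by omega)
  have hTle : (T : ℝ) ≤ C₂ * (a * L ^ 2) := by
    rw [hT, hC₂]; push_cast; exact hn2
  -- Used for the query bound with ε = δ: the term log(1/δ) is absorbed by T.
  have hTl : l ≤ T := by
    rw [hT]; push_cast; nlinarith [Nat.cast_nonneg (α := ℝ) n]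
  set S := tailExponent a L with hS
  have hlS : l ≤ S := le_tailExponent (by linarith) (by linarith) hlL
  have hTexp : (T : ℝ) * Real.exp (-4 * S) ≤ C₂ * 24 * δ ^ 2 :=
    mul_exp_neg_tailExponent_le hC₂0.le ha1 hL haL hTle hexpl hlS
  have hinit : klDiv (forwardLaw pdata σ T) (isoGaussian 0 (σ T ^ 2)) ≤ ENNReal.ofReal (δ ^ 2) := by
    refine klDiv_geomSchedule_isoGaussian_le hd pdata hm hδ hσ0 hσ1 hh0 hh1 ?_
    exact hn1
  clear_value S L a
  refine ⟨T, σ, hsch, hTl, ?_, ?_⟩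
  · refine hTle.trans ?_
    rw [← mul_assoc]
    gcongr
    have : 0 ≤ 1 + C₁ * (C₂ * 24) := by positivity
    linarith [Real.exp_pos (3 * B)]
  intro s hs
  refine (klDiv_outputLaw_le hB hs pdata hsch hc0 hc1 hc2 hc3 hda ha1 hL hh
    fun t ht => vpEta_geomSchedule hσ0 hσ1 hh0 ht).trans ?_
  rw [← hC₁, ← hS]
  have htail : ((T - 1 : ℕ) : ℝ≥0∞) * ENNReal.ofReal (C₁ * Real.exp (-4 * S)) ≤
      ENNReal.ofReal (C₁ * (C₂ * 24)) * ENNReal.ofReal (δ ^ 2) := by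
    rw [← ENNReal.ofReal_natCast, ← ENNReal.ofReal_mul (by positivity), ← ENNReal.ofReal_mul (by positivity)]
    refine ENNReal.ofReal_le_ofReal ?_
    have h1 : ((T - 1 : ℕ) : ℝ) ≤ T := by exact_mod_cast Nat.sub_le _ _
    calc ((T - 1 : ℕ) : ℝ) * (C₁ * Real.exp (-4 * S)) ≤ T * (C₁ * Real.exp (-4 * S)) := by gcongr
      _ = C₁ * (T * Real.exp (-4 * S)) := by ring
      _ ≤ C₁ * (C₂ * 24 * δ ^ 2) := by gcongr
      _ = _ := by ring
  calc _ ≤ ENNReal.ofReal (δ ^ 2) + (ENNReal.ofReal (Real.exp (3 * B)) * totalScoreError pdata s σ T +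
        ENNReal.ofReal (C₁ * (C₂ * 24)) * ENNReal.ofReal (δ ^ 2)) := by gcongr
    _ = ENNReal.ofReal (1 + C₁ * (C₂ * 24)) * ENNReal.ofReal (δ ^ 2) +
        ENNReal.ofReal (Real.exp (3 * B)) * totalScoreError pdata s σ T := by
      rw [ENNReal.ofReal_add one_pos.le (by positivity), ENNReal.ofReal_one]; ring
    _ ≤ _ := by
      have h0 : 0 ≤ C₁ * (C₂ * 24) := by positivity
      rw [mul_add]
      refine add_le_add (mul_le_mul_left (ENNReal.ofReal_le_ofReal ?_) _)
        (mul_le_mul_left (ENNReal.ofReal_le_ofReal ?_) _)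
      · linarith [Real.exp_pos (3 * B)]
      · linarith

end Main

theorem corollary4 (B : ℝ) (hB : 0 < B) :
    ∃ C : ℝ, 0 < C ∧
      ∀ (d : ℕ), 1 ≤ d →
      ∀ (pdata : Measure (Euc d)) [IsProbabilityMeasure pdata],
      Integrable (fun x : Euc d => ‖x‖ ^ 2) pdata →
      ∀ (δ : ℝ), 0 < δ → δ ≤ 1 / 2 →
        -- sampling from the early stopped law `p_1`, for every early stopping noise level
        (∀ σ₀ : ℝ, 0 < σ₀ → σ₀ < 1 →
          ∃ (T : ℕ) (σ : ℕ → ℝ), IsVPSchedule T σ σ₀ ∧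
            (T : ℝ) ≤ C * (d + Real.log (1 / δ)) *
              Real.log (((d + secondMoment pdata) / σ₀ ^ 2) / δ) ^ 2 ∧
            ∀ s : ℕ → Euc d → Euc d, (∀ t, Measurable (s t)) →
              klDiv (forwardLaw pdata σ 1) (outputLaw B s σ T) ≤
                ENNReal.ofReal C * (ENNReal.ofReal (δ ^ 2) + totalScoreError pdata s σ T) ∧
              ENNReal.ofReal (1 - δ) ≤ queryLaw B s σ T {n | (n : ℝ) ≤ C * T} ∧
              ∀ ε : ℝ, 0 < ε → ε < 1 →
                ENNReal.ofReal (1 - ε) ≤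
                  queryLaw B s σ T {n | (n : ℝ) ≤ C * (T + Real.log (1 / ε))}) ∧
        -- sampling from `p_data`, with early stopping noise level `δ / √(d + M₂²)`
        (∃ (T : ℕ) (σ : ℕ → ℝ), IsVPSchedule T σ (δ / √(d + secondMoment pdata)) ∧
            (T : ℝ) ≤ C * max (d : ℝ) (Real.log (1 / δ)) *
              Real.log ((d + secondMoment pdata) / δ ^ 2) ^ 2 ∧
            ∀ s : ℕ → Euc d → Euc d, (∀ t, Measurable (s t)) →
              blDist pdata (outputLaw B s σ T) ^ 2 ≤
                ENNReal.ofReal C * (ENNReal.ofReal (δ ^ 2) + totalScoreError pdata s σ T) ∧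
              ENNReal.ofReal (1 - δ) ≤ queryLaw B s σ T {n | (n : ℝ) ≤ C * T} ∧
              ∀ ε : ℝ, 0 < ε → ε < 1 →
                ENNReal.ofReal (1 - ε) ≤
                  queryLaw B s σ T {n | (n : ℝ) ≤ C * (T + Real.log (1 / ε))}) := by
  obtain ⟨C₀, hC₀, hmain⟩ := exists_schedule_klDiv_le B hB
  have hq := queryRate_pos hB
  have hlog4 : 0 ≤ Real.log 4 := Real.log_nonneg (by norm_num)
  -- Each step costs 2B + log 4 in the exponential moment; the extra 1 absorbs log(1/ε), and for ε =
  -- δ it uses log(1/δ) ≤ T.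
  set q := (2 * B + Real.log 4 + 1) / queryRate B with hqdef
  have hq0 : 0 < q := by positivity
  refine ⟨24 * C₀ + 4 + q, by positivity, fun d hd pdata _ hm δ hδ hδ2 => ?_⟩
  set C := 24 * C₀ + 4 + q with hC
  have hqC : 2 * B + Real.log 4 + 1 ≤ queryRate B * C := by
    calc 2 * B + Real.log 4 + 1 = queryRate B * q := by rw [hqdef]; field_simp
      _ ≤ queryRate B * C := by gcongr; linarith
  have hquery : ∀ (T : ℕ) (σ : ℕ → ℝ) (s : ℕ → Euc d → Euc d), (∀ t, Measurable (s t)) →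
      Real.log (1 / δ) ≤ T →
      ENNReal.ofReal (1 - δ) ≤ queryLaw B s σ T {n | (n : ℝ) ≤ C * T} ∧
      ∀ ε : ℝ, 0 < ε → ε < 1 →
        ENNReal.ofReal (1 - ε) ≤ queryLaw B s σ T {n | (n : ℝ) ≤ C * (T + Real.log (1 / ε))} := by
    intro T σ s hs hT
    refine ⟨le_queryLaw hB hs hδ ?_, fun ε hε hε1 => le_queryLaw hB hs hε ?_⟩
    · calc (2 * B + Real.log 4) * T + Real.log (1 / δ) ≤ (2 * B + Real.log 4 + 1) * T := by linarith
        _ ≤ queryRate B * C * T := by gcongr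
        _ = queryRate B * (C * T) := by ring
    · have hlε : 0 ≤ Real.log (1 / ε) := Real.log_nonneg (by rw [le_div_iff₀ hε]; linarith)
      have hT0 : (0 : ℝ) ≤ T := Nat.cast_nonneg T
      calc (2 * B + Real.log 4) * T + Real.log (1 / ε)
          ≤ (2 * B + Real.log 4 + 1) * (T + Real.log (1 / ε)) := by
            have : 0 ≤ (2 * B + Real.log 4) * Real.log (1 / ε) := by positivity
            linarith
        _ ≤ queryRate B * C * (T + Real.log (1 / ε)) := by gcongr
        _ = queryRate B * (C * (T + Real.log (1 / ε))) := by ring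
  have hd1 : (1 : ℝ) ≤ d := by exact_mod_cast hd
  have hM0 : 0 ≤ secondMoment pdata := integral_nonneg fun x => by positivity
  have hl0 : 0 ≤ Real.log (1 / δ) := Real.log_nonneg (by rw [le_div_iff₀ hδ]; linarith)
  refine ⟨fun σ₀ h0 h1 => ?_, ?_⟩
  · obtain ⟨T, σ, hsch, hlT, hT, hkl⟩ := hmain d hd pdata hm δ hδ hδ2 σ₀ h0 h1
    refine ⟨T, σ, hsch, hT.trans ?_, fun s hs => ⟨(hkl s hs).trans ?_, hquery T σ s hs hlT⟩⟩
    · gcongr; linarith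
    · gcongr; linarith
  · set A := d + secondMoment pdata with hA
    have hA1 : 1 ≤ A := by linarith
    have hsA : 1 ≤ √A := Real.one_le_sqrt.2 hA1
    have hσpos : 0 < δ / √A := by positivity
    have hσlt : δ / √A < 1 := by
      rw [div_lt_one (by positivity)]; linarith
    have hσsq : (δ / √A) ^ 2 = δ ^ 2 / A := by rw [div_pow, Real.sq_sqrt (by linarith)]
    obtain ⟨T, σ, hsch, hlT, hT, hkl⟩ := hmain d hd pdata hm δ hδ hδ2 (δ / √A) hσpos hσlt
    refine ⟨T, σ, hsch, hT.trans ?_, fun s hs => ⟨?_, hquery T σ s hs hlT⟩⟩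
    -- At this noise level κ/δ = A²/δ³, which is at most (A/δ²)² since δ ≤ 1.
    · have hlog : Real.log (A / (δ / √A) ^ 2 / δ) ≤ 2 * Real.log (A / δ ^ 2) := by
        rw [hσsq, ← Nat.cast_ofNat (R := ℝ), ← Real.log_pow]
        refine Real.log_le_log (by positivity) ?_
        have h1 : A / (δ ^ 2 / A) / δ = A ^ 2 / δ ^ 3 := by field_simp
        have h2 : (A / δ ^ 2) ^ 2 = A ^ 2 / δ ^ 4 := by field_simp
        rw [h1, h2]
        gcongr A ^ 2 / ?_
        exact pow_le_pow_of_le_one hδ.le (by linarith) (by norm_num)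
      have hlog0 : 0 ≤ Real.log (A / (δ / √A) ^ 2 / δ) := by
        refine Real.log_nonneg ?_
        rw [hσsq, le_div_iff₀ hδ, le_div_iff₀ (by positivity), one_mul, mul_div_assoc']
        rw [div_le_iff₀ (by positivity)]
        have : δ * δ ^ 2 ≤ 1 := by
          calc δ * δ ^ 2 = δ ^ 3 := by ring
            _ ≤ 1 := pow_le_one₀ hδ.le (by linarith)
        nlinarith
      have hmax : d + Real.log (1 / δ) ≤ 2 * max (d : ℝ) (Real.log (1 / δ)) := by
        linarith [le_max_left (d : ℝ) (Real.log (1 / δ)), le_max_right (d : ℝ) (Real.log (1 / δ))]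
      calc C₀ * (d + Real.log (1 / δ)) * Real.log (A / (δ / √A) ^ 2 / δ) ^ 2
          ≤ C₀ * (2 * max (d : ℝ) (Real.log (1 / δ))) * (2 * Real.log (A / δ ^ 2)) ^ 2 := by gcongr
        _ = 8 * C₀ * (max (d : ℝ) (Real.log (1 / δ)) * Real.log (A / δ ^ 2) ^ 2) := by ring
        _ ≤ C * (max (d : ℝ) (Real.log (1 / δ)) * Real.log (A / δ ^ 2) ^ 2) := by
          gcongr; linarith
        _ = _ := by ring
    · have := isProbabilityMeasure_outputLaw (B := B) (σ := σ) (T := T) hs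
      refine (blDist_sq_le pdata hm hsch (outputLaw B s σ T)).trans ?_
      have h4 : 4 * (δ / √A) ^ 2 * (d + secondMoment pdata) = 4 * δ ^ 2 := by
        rw [hσsq, ← hA]; field_simp
      rw [h4, ENNReal.ofReal_mul (by norm_num)]
      calc ENNReal.ofReal 4 * ENNReal.ofReal (δ ^ 2) + 24 * klDiv (forwardLaw pdata σ 1) (outputLaw B s σ T)
          ≤ ENNReal.ofReal 4 * (ENNReal.ofReal (δ ^ 2) + totalScoreError pdata s σ T) +
            24 * (ENNReal.ofReal C₀ * (ENNReal.ofReal (δ ^ 2) + totalScoreError pdata s σ T)) := by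
            gcongr
            · exact le_self_add
            · exact hkl s hs
        _ = ENNReal.ofReal (24 * C₀ + 4) * (ENNReal.ofReal (δ ^ 2) + totalScoreError pdata s σ T) := by
            rw [ENNReal.ofReal_add (by positivity) (by norm_num), ENNReal.ofReal_mul (by norm_num),
              show ENNReal.ofReal 24 = 24 from ENNReal.ofReal_ofNat 24]
            ring
        _ ≤ _ := by gcongr; linarith

end
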